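/- Let $n\ge 1$, $1<p<\infty$, $0<s<1$ and $\Lambda\ge 1$. Set $\kappa=\frac{n}{n-p}$ if $p<n$ and $\kappa=2$ if $p\ge n$. There exists a constant $c=c(n,p,s,\Lambda)>0$ with the following property. Let $\Omega\subset\mathbb{R}^n$ be a bounded domain, and let $K:\mathbb{R}^n\times\mathbb{R}^n\to\mathbb{R}$ be a measurable symmetric kernel with $$\frac{\Lambda^{-1}}{|x-y|^{n+ps}}\le K(x,y)\le\frac{\Lambda}{|x-y|^{n+ps}}\qquad (x\neq y).$$ Let $u$ be a weak subsolution of $-\Delta_p u+\mathcal{L}(u)=0$ in $\Omega$, where $\mathcal{L}(u)(x)=\mathrm{P.V.}\int_{\mathbb{R}^n}|u(x)-u(y)|^{p-2}(u(x)-u(y))K(x,y)\,dy$. That is, $u\in L^\infty(\mathbb{R}^n)\cap W^{1,p}_{\mathrm{loc}}(\Omega)$, and for every open $\Omega'$ whose closure is a compact subset of $\Omega$ and every nonnegative $\phi\in W_0^{1,p}(\Omega')$ (extended by zero to $\mathbb{R}^n$), $$\int_{\Omega'}|\nabla u|^{p-2}\nabla u\cdot\nabla\phi\,dx+\int_{\mathbb{R}^n}\int_{\mathbb{R}^n}|u(x)-u(y)|^{p-2}(u(x)-u(y))(\phi(x)-\phi(y))K(x,y)\,dx\,dy\le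 0 .$$ Then $u$ is locally bounded above in $\Omega$ (essentially bounded above on every compact subset of $\Omega$), and quantitatively $$\operatorname*{ess\,sup}_{B_{r/2}(x_0)}u\le\delta\,\mathrm{Tail}\big(u_+;x_0,\tfrac r2\big)+c\,\delta^{-\frac{(p-1)\kappa}{p(\kappa-1)}}\bigg(\frac{1}{|B_r(x_0)|}\int_{B_r(x_0)}u_+^p\,dx\bigg)^{\frac1p}$$ for every open ball $B_r(x_0)\subset\Omega$ with $r\in(0,1]$ and every $\delta\in(0,1]$. Here $u_+=\max\{u,0\}$ and $$\mathrm{Tail}(v;x_0,\rho)=\bigg(\rho^{p}\int_{\mathbb{R}^n\setminus B_\rho(x_0)}\frac{|v(y)|^{p-1}}{|y-x_0|^{n+ps}}\,dy\bigg)^{\frac1{p-1}} .$$ -/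

import Mathlib

open MeasureTheory Filter Topology Set
open scoped ContDiff

namespace MixedPLaplace

noncomputable section

/-- `η` is a test function in `C_c^∞(U)`. -/
def IsTestFunction {n : ℕ} (U : Set (EuclideanSpace ℝ (Fin n)))
    (η : EuclideanSpace ℝ (Fin n) → ℝ) : Prop :=
  ContDiff ℝ ∞ η ∧ HasCompactSupport η ∧ tsupport η ⊆ U

/-- `u` belongs to `W^{1,p}(U)` and its weak gradient on `U` is (represented by) `G`. -/
def HasSobolevGradient {n : ℕ} (p : ℝ) (U : Set (EuclideanSpace ℝ (Fin n)))
    (u : EuclideanSpace ℝ (Fin n) → ℝ)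
    (G : EuclideanSpace ℝ (Fin n) → EuclideanSpace ℝ (Fin n)) : Prop :=
  MemLp u (ENNReal.ofReal p) (volume.restrict U) ∧
  MemLp G (ENNReal.ofReal p) (volume.restrict U) ∧
  ∀ η : EuclideanSpace ℝ (Fin n) → ℝ, IsTestFunction U η →
    ∀ v : EuclideanSpace ℝ (Fin n),
      ∫ x in U, u x * fderiv ℝ η x v = - ∫ x in U, inner ℝ (G x) v * η x

/-- The Sobolev space `W^{1,p}(U)`. -/
def MemW1p {n : ℕ} (p : ℝ) (U : Set (EuclideanSpace ℝ (Fin n)))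
    (u : EuclideanSpace ℝ (Fin n) → ℝ) : Prop :=
  ∃ G, HasSobolevGradient p U u G

/-- `U ⋐ Ω`: the closure of the open set `U` is a compact subset of `Ω`. -/
def CompactlyContained {n : ℕ} (U Ω : Set (EuclideanSpace ℝ (Fin n))) : Prop :=
  IsOpen U ∧ IsCompact (closure U) ∧ closure U ⊆ Ω

/-- The local Sobolev space `W^{1,p}_loc(Ω)`. -/
def MemW1pLoc {n : ℕ} (p : ℝ) (Ω : Set (EuclideanSpace ℝ (Fin n)))
    (u : EuclideanSpace ℝ (Fin n) → ℝ) : Prop :=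
  ∀ U : Set (EuclideanSpace ℝ (Fin n)), CompactlyContained U Ω → MemW1p p U u

/-- The space `W_0^{1,p}(U)`, the closure of `C_c^∞(U)` in `W^{1,p}(U)`; its elements are
extended by zero to the complement of `U`. -/
def MemW1pZero {n : ℕ} (p : ℝ) (U : Set (EuclideanSpace ℝ (Fin n)))
    (φ : EuclideanSpace ℝ (Fin n) → ℝ) : Prop :=
  (∀ x, x ∉ U → φ x = 0) ∧
  ∃ H, HasSobolevGradient p U φ H ∧
    ∃ η : ℕ → EuclideanSpace ℝ (Fin n) → ℝ, (∀ k, IsTestFunction U (η k)) ∧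
      Tendsto (fun k => eLpNorm (fun x => η k x - φ x) (ENNReal.ofReal p)
        (volume.restrict U)) atTop (𝓝 0) ∧
      Tendsto (fun k => eLpNorm (fun x => gradient (η k) x - H x) (ENNReal.ofReal p)
        (volume.restrict U)) atTop (𝓝 0)

/-- A measurable symmetric kernel comparable to `|x - y|^{-(n + ps)}` with constant `Λ`. -/
def IsAdmissibleKernel {n : ℕ} (p s Λ : ℝ)
    (K : EuclideanSpace ℝ (Fin n) → EuclideanSpace ℝ (Fin n) → ℝ) : Prop :=
  Measurable (Function.uncurry K) ∧
  (∀ x y, K x y = K y x) ∧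
  ∀ x y, x ≠ y →
    Λ⁻¹ / ‖x - y‖ ^ ((n : ℝ) + p * s) ≤ K x y ∧
    K x y ≤ Λ / ‖x - y‖ ^ ((n : ℝ) + p * s)

/-- Weak subsolutions of `-Δ_p u + L(u) = 0` in `Ω`, where `L` is the nonlocal operator with
kernel `K`. The weak gradients `G` of `u` and `H` of `φ` on `U` exist by the membership
assumptions and are unique almost everywhere. -/
def IsWeakSubsolution {n : ℕ} (p : ℝ)
    (K : EuclideanSpace ℝ (Fin n) → EuclideanSpace ℝ (Fin n) → ℝ)
    (Ω : Set (EuclideanSpace ℝ (Fin n))) (u : EuclideanSpace ℝ (Fin n) → ℝ) : Prop :=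
  MemLp u ⊤ volume ∧ MemW1pLoc p Ω u ∧
  ∀ U : Set (EuclideanSpace ℝ (Fin n)), CompactlyContained U Ω →
    ∀ φ : EuclideanSpace ℝ (Fin n) → ℝ, MemW1pZero p U φ → (∀ᵐ x, 0 ≤ φ x) →
      ∀ G H, HasSobolevGradient p U u G → HasSobolevGradient p U φ H →
        (∫ x in U, ‖G x‖ ^ (p - 2) * inner ℝ (G x) (H x)) +
          ∫ x, ∫ y, |u x - u y| ^ (p - 2) * (u x - u y) * (φ x - φ y) * K x y ≤ 0

/-- The nonlocal tail of `u` with respect to the ball `B_r(x₀)`. -/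
def Tail {n : ℕ} (p s : ℝ) (u : EuclideanSpace ℝ (Fin n) → ℝ)
    (x₀ : EuclideanSpace ℝ (Fin n)) (r : ℝ) : ℝ :=
  (r ^ p * ∫ y in (Metric.ball x₀ r)ᶜ,
    |u y| ^ (p - 1) / ‖y - x₀‖ ^ ((n : ℝ) + p * s)) ^ (1 / (p - 1))

/-- The Sobolev exponent `κ`: `n / (n - p)` if `p < n`, and `2` if `p ≥ n`. -/
def kappa (n : ℕ) (p : ℝ) : ℝ :=
  if p < (n : ℝ) then (n : ℝ) / ((n : ℝ) - p) else 2

end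

end MixedPLaplace

/-! The estimate is a De Giorgi iteration driven by the local term alone. Testing with φ = (u - ℓ)₊
ψ^m, where ψ is a cutoff and m = ⌈p⌉, the p-Laplacian controls ∫ |∇φ|^p up to ∫ (u - ℓ)₊^p |∇ψ|^p.
The nonlocal term only has to be bounded below: its coercive part is discarded, so K enters through
nonnegativity and its upper bound. For x, y in one ball, the negative part of the integrand is at
most a constant times ((u(x) - ℓ)₊^p + (u(y) - ℓ)₊^p) |ψ(x) - ψ(y)|^p K(x,y), integrable near the
diagonal because p - ps > 0. If y lies outside, it is at most (u(y) - ℓ)₊^(p-1) (u(x) - ℓ)₊ K(x,y),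
which integrates to a tail times an L¹ norm. As r ≤ 1, everything scales no worse than r^(-p). This
is `caccioppoli`, resting on `neg_le_nonlocal_energy` and `local_integrand_ge`.

Sobolev's inequality turns this into an L^(κp) bound (`higher_integrability`), and raising the level
trades the extra integrability for a power κ > 1 (`level_step`). With levels k_j = m(1 - 2^(-j)) and
radii r/2 + r/2^(j+1), the normalized quantities Z_j = r^(-n) m^(-p) ∫ (u - k_j)₊^p satisfy Z_(j+1)
≤ C δ^((1-p)κ) b^j Z_j^κ as soon as δ Tail ≤ m. They tend to 0 when Z_0 is at most a constant times
δ^((p-1)κ/(κ-1)). That smallness is the condition that m dominates the averaged term of the claim,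
and the limit says u ≤ m on the half ball.

Two points need care. The test function must be shown to lie in W_0^(1,p) with the expected
gradient: mollification handles smooth functions of u, and a smooth regularization of the positive
part handles the truncation (`isSobolevLimit_posPart_mul`). The double integral is a Bochner
integral with no integrability assumed, so it is bounded below through its negative part only. -/

namespace MixedPLaplace

open scoped Convolution
open ContinuousLinearMap (lsmul)

variable {n : ℕ}

local notation "𝔼" => EuclideanSpace ℝ (Fin n)

/-! ### Pointwise inequalities for the test function, and one-sided integral bounds -/

/-- Either mB ≤ Aτ/2, and the product is absorbed by the first term, or Aτ < 2mB. In the second case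
τ^(m-1) ≤ τ^(p-1), because m ≥ p, so A^(p-1) τ^(m-1) ≤ (2mB)^(p-1). An integer exponent m keeps ψ^m
smooth. -/
theorem young_absorb {p : ℝ} (hp : 1 < p) {m : ℕ} (hm : p ≤ m) {A B τ : ℝ} (hA : 0 ≤ A)
    (hB : 0 ≤ B) (hτ : 0 ≤ τ) (hτ1 : τ ≤ 1) :
    m * A ^ (p - 1) * B * τ ^ (m - 1) ≤ A ^ p * τ ^ m / 2 + (2 * m) ^ p * B ^ p := by
  have hm1 : 1 ≤ m := by
    by_contra h
    have : m = 0 := by omega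
    subst this
    norm_num at hm
    linarith
  have hm0 : (1 : ℝ) ≤ m := by exact_mod_cast hm1
  have hAp : A ^ p = A ^ (p - 1) * A := by
    rw [← Real.rpow_add_one' hA (by linarith)]; ring_nf
  have hA1 : 0 ≤ A ^ (p - 1) := Real.rpow_nonneg hA _
  have hτm : τ ^ m = τ ^ (m - 1) * τ := by rw [← pow_succ]; congr 1; omega
  have hτ' : 0 ≤ τ ^ (m - 1) := pow_nonneg hτ _
  by_cases h : m * B ≤ A * τ / 2
  · have h1 : A ^ (p - 1) * τ ^ (m - 1) * (m * B) ≤ A ^ (p - 1) * τ ^ (m - 1) * (A * τ / 2) := by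
      gcongr
    have h2 : 0 ≤ (2 * m : ℝ) ^ p * B ^ p := by positivity
    rw [hAp, hτm]
    nlinarith
  · push Not at h
    have h1 : τ ^ (m - 1) ≤ τ ^ (p - 1) := by
      rw [← Real.rpow_natCast]
      rcases hτ.eq_or_lt with h0 | h0
      · subst h0
        have hm2 : m - 1 ≠ 0 := by
          intro h
          have : m = 1 := by omega
          subst this
          norm_num at hm
          linarith
        rw [Real.zero_rpow (by linarith : p - 1 ≠ 0), Real.zero_rpow (by exact_mod_cast hm2)]
      · apply Real.rpow_le_rpow_of_exponent_ge h0 hτ1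
        push_cast [Nat.cast_sub hm1]
        linarith
    have h2 : A ^ (p - 1) * τ ^ (m - 1) ≤ (2 * m * B) ^ (p - 1) := by
      calc A ^ (p - 1) * τ ^ (m - 1) ≤ A ^ (p - 1) * τ ^ (p - 1) := by gcongr
        _ = (A * τ) ^ (p - 1) := (Real.mul_rpow hA hτ).symm
        _ ≤ _ := by
          apply Real.rpow_le_rpow (by positivity) (by linarith) (by linarith)
    have h3 : (2 * m : ℝ) ^ p * B ^ p = (2 * m * B) ^ (p - 1) * (2 * m * B) := by
      rw [← Real.mul_rpow (by positivity) hB, ← Real.rpow_add_one' (by positivity) (by linarith)]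
      ring_nf
    have h4 : 0 ≤ A ^ p * τ ^ m / 2 := by positivity
    have h5 : 0 ≤ (2 * m * B) ^ (p - 1) := by positivity
    have h6 : A ^ (p - 1) * τ ^ (m - 1) * (m * B) ≤ (2 * m * B) ^ (p - 1) * (m * B) := by gcongr
    have h7 : (2 * m * B) ^ (p - 1) * (m * B) ≤ (2 * m * B) ^ (p - 1) * (2 * m * B) := by
      apply mul_le_mul_of_nonneg_left _ h5
      nlinarith [mul_nonneg (zero_le_one.trans hm0) hB]
    rw [h3]
    nlinarith

theorem abs_rpow_sub_two_mul_self {p t : ℝ} (hp : 1 < p) (ht : 0 ≤ t) :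
    |t| ^ (p - 2) * t = t ^ (p - 1) := by
  rw [abs_of_nonneg ht, ← Real.rpow_add_one' ht (by linarith)]
  ring_nf

theorem pow_sub_pow_le_mul {a b : ℝ} (m : ℕ) (ha : 0 ≤ a) (hab : a ≤ b) :
    b ^ m - a ^ m ≤ m * b ^ (m - 1) * (b - a) := by
  have hb := ha.trans hab
  rw [← Commute.geom_sum₂_mul (Commute.all b a) m]
  apply mul_le_mul_of_nonneg_right _ (by linarith)
  calc ∑ i ∈ Finset.range m, b ^ i * a ^ (m - 1 - i)
      ≤ ∑ i ∈ Finset.range m, b ^ (m - 1) := by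
        apply Finset.sum_le_sum
        intro i hi
        rw [Finset.mem_range] at hi
        calc b ^ i * a ^ (m - 1 - i) ≤ b ^ i * b ^ (m - 1 - i) := by gcongr
          _ = b ^ (m - 1) := by rw [← pow_add]; congr 1; omega
    _ = m * b ^ (m - 1) := by simp

/-- The integrand can be negative only if b > ℓ and τ₁ < τ₂. Then the difference of test values is
(a - b)τ₂^m - (a - ℓ)(τ₂^m - τ₁^m); its first term absorbs the second by `young_absorb`, and what is
left of it is dropped. -/
theorem nonlocal_integrand_ge_aux {p : ℝ} (hp : 1 < p) {m : ℕ} (hm : p ≤ m) {a b ℓ τ₁ τ₂ : ℝ}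
    (hτ₁ : 0 ≤ τ₁) (hτ₂ : 0 ≤ τ₂) (hτ₂' : τ₂ ≤ 1) (hab : b ≤ a) :
    -((2 * m) ^ p * ((max (a - ℓ) 0) ^ p * |τ₁ - τ₂| ^ p)) ≤
      |a - b| ^ (p - 2) * (a - b) * (max (a - ℓ) 0 * τ₁ ^ m - max (b - ℓ) 0 * τ₂ ^ m) := by
  rw [abs_rpow_sub_two_mul_self hp (by linarith)]
  have h0 : 0 ≤ (2 * m : ℝ) ^ p * ((max (a - ℓ) 0) ^ p * |τ₁ - τ₂| ^ p) := by positivity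
  have hJ : 0 ≤ (a - b) ^ (p - 1) := Real.rpow_nonneg (by linarith) _
  by_cases h : max (b - ℓ) 0 * τ₂ ^ m ≤ max (a - ℓ) 0 * τ₁ ^ m
  · have := mul_nonneg hJ (sub_nonneg.2 h)
    linarith
  · push Not at h
    have hwa : 0 ≤ max (a - ℓ) 0 := le_max_right _ _
    have hb : 0 < b - ℓ := by
      by_contra hb
      rw [max_eq_right (not_lt.1 hb)] at h
      have : 0 ≤ max (a - ℓ) 0 * τ₁ ^ m := by positivity
      linarith
    rw [max_eq_left hb.le] at h ⊢
    rw [max_eq_left (show 0 ≤ a - ℓ by linarith)] at h h0 ⊢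
    have hτ : τ₁ < τ₂ := by
      by_contra hτ
      push Not at hτ
      have : (b - ℓ) * τ₂ ^ m ≤ (a - ℓ) * τ₁ ^ m := by gcongr; linarith
      linarith
    have h1 := young_absorb hp hm (A := a - b) (B := (a - ℓ) * (τ₂ - τ₁)) (τ := τ₂)
      (by linarith) (mul_nonneg (by linarith) (by linarith)) hτ₂ hτ₂'
    rw [Real.mul_rpow (x := a - ℓ) (by linarith) (by linarith)] at h1
    rw [abs_of_neg (by linarith), neg_sub]
    have h2 := mul_le_mul_of_nonneg_left (pow_sub_pow_le_mul m hτ₁ hτ.le)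
      (show 0 ≤ a - ℓ by linarith)
    have h3 : (a - b) ^ p = (a - b) ^ (p - 1) * (a - b) := by
      rw [← Real.rpow_add_one' (by linarith) (by linarith)]; ring_nf
    have h4 : (a - b) * τ₂ ^ m - (a - ℓ) * (m * τ₂ ^ (m - 1) * (τ₂ - τ₁)) ≤
        (a - ℓ) * τ₁ ^ m - (b - ℓ) * τ₂ ^ m := by linarith
    have h5 := mul_le_mul_of_nonneg_left h4 hJ
    have h6 : 0 ≤ (a - b) ^ p * τ₂ ^ m := by
      have : 0 ≤ a - b := by linarith
      positivity
    rw [h3] at h1 h6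
    linarith

/-- Pointwise lower bound for the nonlocal integrand tested with `(u - ℓ)₊ ψ ^ m`. -/
theorem nonlocal_integrand_ge {p : ℝ} (hp : 1 < p) {m : ℕ} (hm : p ≤ m) {a b ℓ τ₁ τ₂ : ℝ}
    (hτ₁ : 0 ≤ τ₁) (hτ₁' : τ₁ ≤ 1) (hτ₂ : 0 ≤ τ₂) (hτ₂' : τ₂ ≤ 1) :
    -((2 * m) ^ p * (((max (a - ℓ) 0) ^ p + (max (b - ℓ) 0) ^ p) * |τ₁ - τ₂| ^ p)) ≤
      |a - b| ^ (p - 2) * (a - b) * (max (a - ℓ) 0 * τ₁ ^ m - max (b - ℓ) 0 * τ₂ ^ m) := by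
  have ha : 0 ≤ (2 * m : ℝ) ^ p * ((max (a - ℓ) 0) ^ p * |τ₁ - τ₂| ^ p) := by positivity
  have hb : 0 ≤ (2 * m : ℝ) ^ p * ((max (b - ℓ) 0) ^ p * |τ₁ - τ₂| ^ p) := by positivity
  rcases le_total b a with h | h
  · have := nonlocal_integrand_ge_aux hp hm (ℓ := ℓ) hτ₁ hτ₂ hτ₂' h
    linarith
  · have := nonlocal_integrand_ge_aux hp hm (ℓ := ℓ) hτ₂ hτ₁ hτ₁' h
    rw [abs_sub_comm τ₂, abs_sub_comm b] at this
    linarith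

/-- Covers pairs whose second point lies outside the support of the cutoff. A negative value
requires b > a > ℓ, and then b - a ≤ b - ℓ. -/
theorem nonlocal_integrand_ge_of_zero {p : ℝ} (hp : 1 < p) {a b ℓ τ : ℝ}
    (hτ : 0 ≤ τ) (hτ' : τ ≤ 1) :
    -((max (b - ℓ) 0) ^ (p - 1) * max (a - ℓ) 0) ≤
      |a - b| ^ (p - 2) * (a - b) * (max (a - ℓ) 0 * τ) := by
  have hb0 : 0 ≤ max (b - ℓ) 0 := le_max_right _ _
  have ha0 : 0 ≤ max (a - ℓ) 0 := le_max_right _ _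
  rcases le_or_gt b a with h | h
  · rw [abs_rpow_sub_two_mul_self hp (by linarith)]
    have hJ : 0 ≤ (a - b) ^ (p - 1) := Real.rpow_nonneg (by linarith) _
    have : 0 ≤ (max (b - ℓ) 0) ^ (p - 1) * max (a - ℓ) 0 := by positivity
    have : 0 ≤ (a - b) ^ (p - 1) * (max (a - ℓ) 0 * τ) := by positivity
    linarith
  · rw [abs_sub_comm, ← neg_sub b a, mul_neg, abs_rpow_sub_two_mul_self hp (by linarith), neg_mul]
    rw [neg_le_neg_iff]
    rcases ha0.eq_or_lt with h0 | h0
    · rw [← h0]; simp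
    · have h1 : 0 < a - ℓ := by
        by_contra h2
        rw [max_eq_right (not_lt.1 h2)] at h0
        exact lt_irrefl _ h0
      have h2 : (b - a) ^ (p - 1) ≤ (max (b - ℓ) 0) ^ (p - 1) := by
        apply Real.rpow_le_rpow (by linarith) _ (by linarith)
        exact le_max_of_le_left (by linarith)
      have h3 : max (a - ℓ) 0 * τ ≤ max (a - ℓ) 0 := mul_le_of_le_one_right ha0 hτ'
      gcongr

theorem norm_rpow_sub_two_mul_inner_self {E : Type*} [NormedAddCommGroup E] [InnerProductSpace ℝ E]
    {p : ℝ} (hp : 1 < p) (G : E) : ‖G‖ ^ (p - 2) * inner ℝ G G = ‖G‖ ^ p := by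
  rw [real_inner_self_eq_norm_sq]
  rcases eq_or_ne G 0 with rfl | h
  · simp [Real.zero_rpow (by linarith : p ≠ 0)]
  · rw [← Real.rpow_natCast, ← Real.rpow_add (norm_pos_iff.2 h)]
    congr 1; push_cast; ring

theorem norm_rpow_sub_two_mul_norm {E : Type*} [NormedAddCommGroup E]
    {p : ℝ} (hp : 1 < p) (G : E) : ‖G‖ ^ (p - 2) * ‖G‖ = ‖G‖ ^ (p - 1) := by
  simpa using abs_rpow_sub_two_mul_self hp (norm_nonneg G)

/-- Supplies the integrability of the local flux, so that the pointwise coercivity can be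
integrated. -/
theorem norm_flux_inner_le {E : Type*} [NormedAddCommGroup E] [InnerProductSpace ℝ E]
    {p : ℝ} (hp : 1 < p) (G H : E) :
    |‖G‖ ^ (p - 2) * inner ℝ G H| ≤ ‖G‖ ^ p + ‖H‖ ^ p := by
  have h1 : |‖G‖ ^ (p - 2) * inner ℝ G H| ≤ ‖G‖ ^ (p - 1) * ‖H‖ := by
    rw [abs_mul, abs_of_nonneg (by positivity), ← norm_rpow_sub_two_mul_norm hp, mul_assoc]
    gcongr
    exact abs_real_inner_le_norm G H
  have h2 : ∀ t : ℝ, 0 ≤ t → t ^ p = t ^ (p - 1) * t := fun t ht => by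
    rw [← Real.rpow_add_one' ht (by linarith)]; ring_nf
  refine h1.trans ?_
  rcases le_total ‖G‖ ‖H‖ with h | h
  · have : ‖G‖ ^ (p - 1) * ‖H‖ ≤ ‖H‖ ^ (p - 1) * ‖H‖ := by
      gcongr
    have h3 : 0 ≤ ‖G‖ ^ p := by positivity
    rw [← h2 _ (norm_nonneg H)] at this
    linarith
  · have : ‖G‖ ^ (p - 1) * ‖H‖ ≤ ‖G‖ ^ (p - 1) * ‖G‖ := by gcongr
    have h3 : 0 ≤ ‖H‖ ^ p := by positivity
    rw [← h2 _ (norm_nonneg G)] at this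
    linarith

/-- Pointwise coercivity of the local integrand tested with `w ψ ^ m`; `D` is `∇ψ`. -/
theorem local_integrand_ge {E : Type*} [NormedAddCommGroup E] [InnerProductSpace ℝ E]
    {p : ℝ} (hp : 1 < p) {m : ℕ} (hm : p ≤ m) (G D : E) {w τ L : ℝ} (hw : 0 ≤ w)
    (hτ : 0 ≤ τ) (hτ' : τ ≤ 1) (hD : ‖D‖ ≤ L) :
    ‖τ ^ m • G + (w * (m * τ ^ (m - 1))) • D‖ ^ p ≤
      (2 * 2 ^ p) * (‖G‖ ^ (p - 2) * inner ℝ G (τ ^ m • G + (w * (m * τ ^ (m - 1))) • D)) +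
        (2 * 2 ^ p * (2 * m) ^ p + 2 ^ p * m ^ p) * (w * L) ^ p := by
  have hL : 0 ≤ L := (norm_nonneg D).trans hD
  have hm1 : 1 ≤ m := by
    by_contra h
    have : m = 0 := by omega
    subst this
    norm_num at hm
    linarith
  set a := ‖τ ^ m • G‖
  set b := ‖(w * (m * τ ^ (m - 1))) • D‖
  have ha : a = τ ^ m * ‖G‖ := by simp [a, norm_smul, abs_of_nonneg hτ]
  have hb : b ≤ m * (w * L) := by
    have : b = w * (m * τ ^ (m - 1)) * ‖D‖ := by
      simp [b, norm_smul, abs_of_nonneg hτ, abs_of_nonneg hw]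
    rw [this]
    have h1 : τ ^ (m - 1) ≤ 1 := pow_le_one₀ hτ hτ'
    calc w * (m * τ ^ (m - 1)) * ‖D‖ ≤ w * (m * 1) * L := by gcongr
      _ = _ := by ring
  have h1 : ‖τ ^ m • G + (w * (m * τ ^ (m - 1))) • D‖ ^ p ≤ 2 ^ p * a ^ p + 2 ^ p * b ^ p := by
    have ha0 : 0 ≤ a := norm_nonneg _
    have hb0 : 0 ≤ b := norm_nonneg _
    have h2 : ‖τ ^ m • G + (w * (m * τ ^ (m - 1))) • D‖ ≤ 2 * max a b := by
      refine (norm_add_le _ _).trans ?_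
      change a + b ≤ _
      linarith [le_max_left a b, le_max_right a b]
    refine (Real.rpow_le_rpow (norm_nonneg _) h2 (by linarith)).trans ?_
    rw [Real.mul_rpow (by norm_num) (le_max_of_le_left ha0)]
    rcases max_choice a b with h | h <;> rw [h]
    · have : 0 ≤ (2 : ℝ) ^ p * b ^ p := by positivity
      linarith
    · have : 0 ≤ (2 : ℝ) ^ p * a ^ p := by positivity
      linarith
  -- Since τ^m ≤ 1 and p ≥ 1, (τ^m)^p ≤ τ^m. By `young_absorb` the flux is at least half of ‖G‖^p
  -- τ^m minus an error, whence the factor 2 in 2 * 2 ^ p.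
  have h2 : a ^ p ≤ ‖G‖ ^ p * τ ^ m := by
    rw [ha, Real.mul_rpow (by positivity) (norm_nonneg _), mul_comm]
    gcongr
    exact Real.rpow_le_self_of_le_one (by positivity) (pow_le_one₀ hτ hτ') hp.le
  have h3 : b ^ p ≤ m ^ p * (w * L) ^ p := by
    rw [← Real.mul_rpow (by positivity) (by positivity)]
    exact Real.rpow_le_rpow (norm_nonneg _) hb (by linarith)
  have h4 := young_absorb hp hm (norm_nonneg G) (B := w * L) (by positivity) hτ hτ'
  have h5 : ‖G‖ ^ p * τ ^ m - m * ‖G‖ ^ (p - 1) * (w * L) * τ ^ (m - 1) ≤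
      ‖G‖ ^ (p - 2) * inner ℝ G (τ ^ m • G + (w * (m * τ ^ (m - 1))) • D) := by
    rw [inner_add_right, inner_smul_right, inner_smul_right, mul_add]
    have h6 : ‖G‖ ^ (p - 2) * (τ ^ m * inner ℝ G G) = ‖G‖ ^ p * τ ^ m := by
      rw [← norm_rpow_sub_two_mul_inner_self hp]; ring
    have h7 : -(‖G‖ * L) ≤ inner ℝ G D := by
      have := neg_le_of_abs_le (abs_real_inner_le_norm G D)
      have h8 : ‖G‖ * ‖D‖ ≤ ‖G‖ * L := by gcongr
      linarith
    have h8 : ‖G‖ ^ (p - 2) * (w * (m * τ ^ (m - 1)) * -(‖G‖ * L)) ≤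
        ‖G‖ ^ (p - 2) * (w * (m * τ ^ (m - 1)) * inner ℝ G D) := by
      gcongr
    rw [h6, ← norm_rpow_sub_two_mul_norm hp]
    linarith
  have h6 : (0 : ℝ) < 2 ^ p := by positivity
  have h7 := mul_le_mul_of_nonneg_left (h4) h6.le
  have h8 := mul_le_mul_of_nonneg_left (h5) h6.le
  have h9 := mul_le_mul_of_nonneg_left (h2) h6.le
  have h10 := mul_le_mul_of_nonneg_left (h3) h6.le
  linarith

/-- No integrability is needed to bound a Bochner integral below by its negative part. -/
theorem neg_toReal_lintegral_le_integral {α : Type*} [MeasurableSpace α] {μ : Measure α}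
    {f : α → ℝ} {g : α → ENNReal} (h : ∀ᵐ x ∂μ, ENNReal.ofReal (-f x) ≤ g x)
    (hg : ∫⁻ x, g x ∂μ ≠ ⊤) : -(∫⁻ x, g x ∂μ).toReal ≤ ∫ x, f x ∂μ := by
  by_cases hf : Integrable f μ
  · rw [integral_eq_lintegral_pos_part_sub_lintegral_neg_part hf]
    have h1 : (∫⁻ x, ENNReal.ofReal (-f x) ∂μ).toReal ≤ (∫⁻ x, g x ∂μ).toReal :=
      ENNReal.toReal_mono hg (lintegral_mono_ae h)
    have h2 : 0 ≤ (∫⁻ x, ENNReal.ofReal (f x) ∂μ).toReal := ENNReal.toReal_nonneg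
    linarith
  -- The integral is 0 by convention here, and the left side is nonpositive.
  · rw [integral_undef hf]
    simp

theorem neg_toReal_lintegral_lintegral_le_integral {α β : Type*} [MeasurableSpace α]
    [MeasurableSpace β] {μ : Measure α} {ν : Measure β} {f : α → β → ℝ} {g : α → β → ENNReal}
    (h : ∀ᵐ x ∂μ, ∀ᵐ y ∂ν, ENNReal.ofReal (-f x y) ≤ g x y)
    (hg : ∫⁻ x, ∫⁻ y, g x y ∂ν ∂μ ≠ ⊤) :
    -(∫⁻ x, ∫⁻ y, g x y ∂ν ∂μ).toReal ≤ ∫ x, ∫ y, f x y ∂ν ∂μ := by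
  refine neg_toReal_lintegral_le_integral ?_ hg
  filter_upwards [h] with x hx
  by_cases hgx : ∫⁻ y, g x y ∂ν = ⊤
  · rw [hgx]; exact le_top
  · rw [ENNReal.ofReal_le_iff_le_toReal hgx]
    linarith [neg_toReal_lintegral_le_integral hx hgx]

/-! ### Mollification in L^p and commutation with the weak gradient -/

section Mollification

variable {V F : Type*} [NormedAddCommGroup V] [InnerProductSpace ℝ V] [FiniteDimensional ℝ V]
  [MeasurableSpace V] [BorelSpace V] [NormedAddCommGroup F]

/-- Translations form a continuous family of measure-preserving maps, and composition with such a
family is continuous in L^p for p < ∞. -/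
theorem tendsto_eLpNorm_translate_sub {p : ENNReal} (hp : 1 ≤ p) (hp' : p ≠ ⊤) {f : V → F}
    (hf : MemLp f p volume) :
    Tendsto (fun t : V => eLpNorm (fun x => f (x - t) - f x) p volume) (𝓝 0) (𝓝 0) := by
  have : Fact (1 ≤ p) := ⟨hp⟩
  let g : V → C(V, V) := fun t => ⟨fun x => x - t, by fun_prop⟩
  have hg : ContinuousAt g 0 := by
    have : Continuous g := ContinuousMap.continuous_of_continuous_uncurry _ (by
      change Continuous fun q : V × V => q.2 - q.1
      fun_prop)
    exact this.continuousAt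
  have hgm : ∀ t, MeasurePreserving (g t) (volume : Measure V) volume :=
    fun t => measurePreserving_sub_right volume t
  have h1 : ContinuousAt (fun t => Lp.compMeasurePreserving (g t) (hgm t) (hf.toLp f)) 0 :=
    continuousAt_const.compMeasurePreservingLp hg hgm hp'
  have h2 := (Lp.tendsto_Lp_iff_tendsto_eLpNorm' _ _).1 h1
  refine h2.congr fun t => eLpNorm_congr_ae ?_
  have h3 := hf.coeFn_toLp
  have h4 := (hgm t).quasiMeasurePreserving.ae_eq_comp h3
  have h5 := (hgm 0).quasiMeasurePreserving.ae_eq_comp h3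
  have h6 := Lp.coeFn_compMeasurePreserving (hf.toLp f) (hgm t)
  have h7 := Lp.coeFn_compMeasurePreserving (hf.toLp f) (hgm 0)
  filter_upwards [h4, h5, h6, h7] with x h4 h5 h6 h7
  simp only [Pi.sub_apply, h6, h7, h4, h5]
  simp [g]

variable [NormedSpace ℝ F]

/-- Jensen's inequality for the probability measure whose density is the normalized bump. -/
theorem enorm_bump_convolution_sub_rpow_le {p : ℝ} (hp : 1 ≤ p) [CompleteSpace F] {f : V → F}
    (hf : LocallyIntegrable f volume) (φ : ContDiffBump (0 : V)) (x : V) :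
    ‖(φ.normed volume ⋆[lsmul ℝ ℝ, volume] f) x - f x‖ₑ ^ p ≤
      ∫⁻ t, ENNReal.ofReal (φ.normed volume t) * ‖f (x - t) - f x‖ₑ ^ p := by
  set w : V → ENNReal := fun t => ENNReal.ofReal (φ.normed volume t) with hw
  have hwm : Measurable w := (φ.continuous_normed.measurable).ennreal_ofReal
  have hw1 : ∫⁻ t, w t = 1 := by
    rw [← ofReal_integral_eq_lintegral_ofReal (φ.integrable_normed (μ := volume))
      (Eventually.of_forall φ.nonneg_normed), φ.integral_normed]
    simp
  let ν : Measure V := volume.withDensity w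
  have : IsProbabilityMeasure ν := ⟨by simp [ν, hw1]⟩
  have hfm : AEStronglyMeasurable (fun t => f (x - t) - f x) volume :=
    (hf.aestronglyMeasurable.comp_quasiMeasurePreserving
      (quasiMeasurePreserving_sub_left volume x)).sub aestronglyMeasurable_const
  have hfν : AEStronglyMeasurable (fun t => f (x - t) - f x) ν :=
    hfm.mono_ac (withDensity_absolutelyContinuous _ _)
  have hint : Integrable (fun t => φ.normed volume t • f (x - t)) volume := by
    have := (φ.hasCompactSupport_normed (μ := volume)).convolutionExists_left (lsmul ℝ ℝ)
      (μ := volume) φ.continuous_normed hf x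
    exact this
  have h1 : (φ.normed volume ⋆[lsmul ℝ ℝ, volume] f) x - f x =
      ∫ t, φ.normed volume t • (f (x - t) - f x) := by
    simp only [smul_sub]
    rw [integral_sub hint ((φ.integrable_normed (μ := volume)).smul_const _), integral_smul_const,
      φ.integral_normed, one_smul]
    rfl
  have h2 : ‖(φ.normed volume ⋆[lsmul ℝ ℝ, volume] f) x - f x‖ₑ ≤
      ∫⁻ t, ‖f (x - t) - f x‖ₑ ∂ν := by
    rw [h1, lintegral_withDensity_eq_lintegral_mul₀ hwm.aemeasurable hfm.enorm]
    refine (enorm_integral_le_lintegral_enorm _).trans (le_of_eq ?_)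
    refine lintegral_congr fun t => ?_
    rw [enorm_smul, Real.enorm_of_nonneg (φ.nonneg_normed t)]
    rfl
  have h3 := eLpNorm'_le_eLpNorm'_of_exponent_le one_pos hp ν hfν
  simp only [eLpNorm', ENNReal.rpow_one, div_one] at h3
  have h4 : ∫⁻ t, w t * ‖f (x - t) - f x‖ₑ ^ p = ∫⁻ t, ‖f (x - t) - f x‖ₑ ^ p ∂ν := by
    rw [lintegral_withDensity_eq_lintegral_mul₀ hwm.aemeasurable (hfm.enorm.pow_const p)]
    rfl
  rw [h4]
  calc _ ≤ ((∫⁻ t, ‖f (x - t) - f x‖ₑ ^ p ∂ν) ^ (1 / p)) ^ p := by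
        gcongr
        exact h2.trans h3
    _ = _ := by rw [← ENNReal.rpow_mul, one_div_mul_cancel (by linarith), ENNReal.rpow_one]

/-- Integrating the Jensen bound and applying Tonelli leaves an average of ‖f(· - t) - f‖_p^p over
|t| < `rOut`, which is small by continuity of translations. Values in F allow the same statement to
serve u and its gradient. -/
theorem tendsto_eLpNorm_bump_convolution_sub {p : ℝ} (hp : 1 ≤ p) [CompleteSpace F] {f : V → F}
    (hf : MemLp f (ENNReal.ofReal p) volume) {φ : ℕ → ContDiffBump (0 : V)}
    (hφ : Tendsto (fun i => (φ i).rOut) atTop (𝓝 0)) :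
    Tendsto (fun i => eLpNorm (fun x => ((φ i).normed volume ⋆[lsmul ℝ ℝ, volume] f) x - f x)
      (ENNReal.ofReal p) volume) atTop (𝓝 0) := by
  have hp0 : 0 < p := by linarith
  have hp1 : 1 ≤ ENNReal.ofReal p := by simpa using hp
  have hE : ∀ g : V → F, eLpNorm g (ENNReal.ofReal p) volume = (∫⁻ x, ‖g x‖ₑ ^ p) ^ (1 / p) := by
    intro g
    rw [eLpNorm_eq_lintegral_rpow_enorm_toReal (by positivity) ENNReal.ofReal_ne_top,
      ENNReal.toReal_ofReal hp0.le]
  have ht := tendsto_eLpNorm_translate_sub hp1 ENNReal.ofReal_ne_top hf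
  rw [ENNReal.tendsto_nhds_zero] at ht ⊢
  intro ε hε
  obtain ⟨δ, hδ, hδt⟩ := Metric.eventually_nhds_iff.1 (ht ε hε)
  filter_upwards [hφ.eventually_lt_const hδ] with i hi
  rw [hE, one_div, ENNReal.rpow_inv_le_iff hp0]
  have hfl : LocallyIntegrable f volume := hf.locallyIntegrable hp1
  calc ∫⁻ x, ‖((φ i).normed volume ⋆[lsmul ℝ ℝ, volume] f) x - f x‖ₑ ^ p
      ≤ ∫⁻ x, ∫⁻ t, ENNReal.ofReal ((φ i).normed volume t) * ‖f (x - t) - f x‖ₑ ^ p :=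
        lintegral_mono fun x => enorm_bump_convolution_sub_rpow_le hp hfl (φ i) x
    _ = ∫⁻ t, ∫⁻ x, ENNReal.ofReal ((φ i).normed volume t) * ‖f (x - t) - f x‖ₑ ^ p := by
        apply lintegral_lintegral_swap
        have h1 : AEStronglyMeasurable (fun z : V × V => f (z.1 - z.2) - f z.1)
            (volume.prod volume) :=
          (hf.1.comp_quasiMeasurePreserving
            (quasiMeasurePreserving_sub_of_right_invariant volume volume)).sub
            (hf.1.comp_quasiMeasurePreserving Measure.quasiMeasurePreserving_fst)
        have h2 : AEMeasurable (fun z : V × V => ENNReal.ofReal ((φ i).normed volume z.2))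
            (volume.prod volume) :=
          (((φ i).continuous_normed.comp continuous_snd).measurable.ennreal_ofReal).aemeasurable
        exact h2.mul (h1.enorm.pow_const p)
    _ ≤ ∫⁻ t, ENNReal.ofReal ((φ i).normed volume t) * ε ^ p := by
        refine lintegral_mono fun t => ?_
        rw [lintegral_const_mul' _ _ ENNReal.ofReal_ne_top]
        by_cases htm : t ∈ Metric.ball (0 : V) (φ i).rOut
        · gcongr
          have h3 := hδt (y := t) (by
            rw [Metric.mem_ball] at htm
            exact htm.trans hi)
          rwa [hE, one_div, ENNReal.rpow_inv_le_iff hp0] at h3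
        · have : (φ i).normed volume t = 0 := by
            rw [← Function.notMem_support, (φ i).support_normed_eq]
            exact htm
          simp [this]
    _ = ε ^ p := by
        rw [lintegral_mul_const _
          ((φ i).continuous_normed.measurable).ennreal_ofReal,
          ← ofReal_integral_eq_lintegral_ofReal (φ i).integrable_normed
          (Eventually.of_forall (φ i).nonneg_normed), (φ i).integral_normed]
        simp

end Mollification

theorem inner_gradient_eq_fderiv (f : 𝔼 → ℝ) (x v : 𝔼) :
    inner ℝ (gradient f x) v = fderiv ℝ f x v := by
  simp [gradient]

theorem norm_gradient_eq (f : 𝔼 → ℝ) (x : 𝔼) : ‖gradient f x‖ = ‖fderiv ℝ f x‖ := by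
  simp [gradient]

/-- Mollification commutes with weak differentiation away from the boundary. -/
theorem gradient_bump_convolution {p : ℝ} (hp : 1 ≤ p) {U : Set 𝔼} (hU : IsOpen U) {u : 𝔼 → ℝ}
    {G : 𝔼 → 𝔼} (hu : HasSobolevGradient p U u G) (φ : ContDiffBump (0 : 𝔼)) {x : 𝔼}
    (hx : Metric.closedBall x φ.rOut ⊆ U) :
    gradient (φ.normed volume ⋆[lsmul ℝ ℝ, volume] U.indicator u) x =
      (φ.normed volume ⋆[lsmul ℝ ℝ, volume] U.indicator G) x := by
  have hp1 : 1 ≤ ENNReal.ofReal p := by simpa using hp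
  have hul : LocallyIntegrable (U.indicator u) volume :=
    ((memLp_indicator_iff_restrict hU.measurableSet).2 hu.1).locallyIntegrable hp1
  have hGl : LocallyIntegrable (U.indicator G) volume :=
    ((memLp_indicator_iff_restrict hU.measurableSet).2 hu.2.1).locallyIntegrable hp1
  have hsm : ContDiff ℝ ∞ (φ.normed volume) := φ.contDiff_normed
  refine ext_inner_right ℝ fun v => ?_
  rw [inner_gradient_eq_fderiv]
  have h1 := (φ.hasCompactSupport_normed (μ := volume)).hasFDerivAt_convolution_left (lsmul ℝ ℝ)
    (hsm.of_le (by norm_cast)) hul x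
  rw [h1.fderiv]
  -- The reflected bump is supported in the closed ball around x, hence admissible in the definition
  -- of the weak gradient.
  let η : 𝔼 → ℝ := fun t => φ.normed volume (x - t)
  have hηd : ∀ t, fderiv ℝ η t v = - fderiv ℝ (φ.normed volume) (x - t) v := by
    intro t
    have h2 : HasFDerivAt (fun t : 𝔼 => x - t) (-ContinuousLinearMap.id ℝ 𝔼) t := by
      simpa using (hasFDerivAt_id t).const_sub x
    have h3 := ((hsm.differentiable (by simp)).differentiableAt (x := x - t)).hasFDerivAt.comp t h2
    change fderiv ℝ (φ.normed volume ∘ fun t => x - t) t v = _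
    rw [h3.fderiv]
    simp
  have hsupp : tsupport η ⊆ Metric.closedBall x φ.rOut := by
    refine closure_minimal ?_ Metric.isClosed_closedBall
    intro t ht
    have : x - t ∈ Function.support (φ.normed volume) := ht
    rw [φ.support_normed_eq, Metric.mem_ball, dist_zero_right] at this
    rw [Metric.mem_closedBall, dist_comm, dist_eq_norm]
    exact this.le
  have hη : IsTestFunction U η := by
    refine ⟨hsm.comp (contDiff_const.sub contDiff_id), ?_, hsupp.trans hx⟩
    exact HasCompactSupport.intro (isCompact_closedBall x φ.rOut) fun t ht =>
      image_eq_zero_of_notMem_tsupport fun h => ht (hsupp h)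
  have h4 := hu.2.2 η hη v
  rw [convolution_eq_swap, convolution_eq_swap]
  have h5 : Integrable (fun t => (ContinuousLinearMap.precompL 𝔼 (lsmul ℝ ℝ))
      (fderiv ℝ (φ.normed volume) (x - t)) (U.indicator u t)) volume := by
    have := (φ.hasCompactSupport_normed (μ := volume)).fderiv ℝ |>.convolutionExists_left
      (ContinuousLinearMap.precompL 𝔼 (lsmul ℝ ℝ)) (μ := volume)
      (hsm.continuous_fderiv (by simp)) hul x
    exact this.integrable_swap
  have h6 : Integrable (fun t => (lsmul ℝ ℝ) (φ.normed volume (x - t)) (U.indicator G t))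
      volume := by
    have := (φ.hasCompactSupport_normed (μ := volume)).convolutionExists_left
      (lsmul ℝ ℝ) (μ := volume) φ.continuous_normed hGl x
    exact this.integrable_swap
  rw [ContinuousLinearMap.integral_apply h5, real_inner_comm, ← integral_inner h6]
  rw [← integral_indicator hU.measurableSet, ← integral_indicator hU.measurableSet] at h4
  calc _ = - ∫ t, U.indicator (fun t => u t * fderiv ℝ η t v) t := by
        rw [← integral_neg]
        refine integral_congr_ae (Eventually.of_forall fun t => ?_)
        by_cases ht : t ∈ U
        · simp [ht, hηd, ContinuousLinearMap.precompL, mul_comm]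
        · simp [ht, ContinuousLinearMap.precompL]
    _ = ∫ t, U.indicator (fun t => inner ℝ (G t) v * η t) t := by rw [h4, neg_neg]
    _ = _ := by
        refine integral_congr_ae (Eventually.of_forall fun t => ?_)
        by_cases ht : t ∈ U
        · simp [ht, η, inner_smul_right, real_inner_comm, mul_comm]
        · simp [ht]

/-! ### Smooth regularization of the positive part -/

theorem deriv_smoothTransition_eq_zero {t : ℝ} (ht : t ∉ Icc (0 : ℝ) 1) :
    deriv Real.smoothTransition t = 0 := by
  rw [mem_Icc, not_and_or, not_le, not_le] at ht
  rcases ht with h | h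
  · have : Real.smoothTransition =ᶠ[𝓝 t] fun _ => 0 := by
      filter_upwards [Iio_mem_nhds h] with s hs
      exact Real.smoothTransition.zero_of_nonpos (le_of_lt hs)
    rw [this.deriv_eq, deriv_const]
  · have : Real.smoothTransition =ᶠ[𝓝 t] fun _ => 1 := by
      filter_upwards [Ioi_mem_nhds h] with s hs
      exact Real.smoothTransition.one_of_one_le (le_of_lt hs)
    rw [this.deriv_eq, deriv_const]

theorem exists_abs_deriv_smoothTransition_le :
    ∃ M : ℝ, 0 ≤ M ∧ ∀ t, |deriv Real.smoothTransition t| ≤ M := by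
  have hc : Continuous (deriv Real.smoothTransition) :=
    (Real.smoothTransition.contDiff (n := 1)).continuous_deriv (by simp)
  obtain ⟨M, hM⟩ := (isCompact_Icc (a := (0 : ℝ)) (b := 1)).exists_bound_of_continuousOn
    hc.continuousOn
  refine ⟨max M 0, le_max_right _ _, fun t => ?_⟩
  by_cases ht : t ∈ Icc (0 : ℝ) 1
  · exact (hM t ht).trans (le_max_left _ _)
  · rw [deriv_smoothTransition_eq_zero ht]; simp

/-- A smooth regularization of the positive part. -/
noncomputable def smoothPosPart (j : ℕ) (t : ℝ) : ℝ := t * Real.smoothTransition ((j + 1) * t)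

theorem contDiff_smoothPosPart (j : ℕ) : ContDiff ℝ ∞ (smoothPosPart j) :=
  contDiff_id.mul (Real.smoothTransition.contDiff.comp (contDiff_const.mul contDiff_id))

theorem deriv_smoothPosPart (j : ℕ) (t : ℝ) : deriv (smoothPosPart j) t =
    Real.smoothTransition ((j + 1) * t) +
      ((j + 1) * t) * deriv Real.smoothTransition ((j + 1) * t) := by
  have h1 : HasDerivAt (fun t : ℝ => ((j : ℝ) + 1) * t) ((j : ℝ) + 1) t := by
    simpa using (hasDerivAt_id t).const_mul ((j : ℝ) + 1)
  have h2 := ((Real.smoothTransition.contDiff (n := 1)).differentiable (by simp)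
    |>.differentiableAt (x := ((j : ℝ) + 1) * t)).hasDerivAt
  have h3 := (hasDerivAt_id t).mul (h2.comp t h1)
  change deriv (id * (Real.smoothTransition ∘ fun t : ℝ => ((j : ℝ) + 1) * t)) t = _
  rw [h3.deriv]
  simp
  ring

/-- The bound is uniform in j: with s = (j + 1)t the derivative is S(s) + s S'(s), where S is the
smooth transition, and S' vanishes outside [0, 1]. -/
theorem exists_abs_deriv_smoothPosPart_le :
    ∃ M : ℝ, 0 ≤ M ∧ ∀ j t, |deriv (smoothPosPart j) t| ≤ M := by
  obtain ⟨M, hM0, hM⟩ := exists_abs_deriv_smoothTransition_le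
  refine ⟨1 + M, by linarith, fun j t => ?_⟩
  rw [deriv_smoothPosPart]
  set s := ((j : ℝ) + 1) * t
  refine (abs_add_le _ _).trans (add_le_add ?_ ?_)
  · rw [abs_of_nonneg (Real.smoothTransition.nonneg _)]
    exact Real.smoothTransition.le_one _
  · by_cases hs : s ∈ Icc (0 : ℝ) 1
    · rw [abs_mul, abs_of_nonneg hs.1]
      calc s * |deriv Real.smoothTransition s| ≤ 1 * M :=
            mul_le_mul hs.2 (hM s) (abs_nonneg _) zero_le_one
        _ = M := one_mul M
    · rw [deriv_smoothTransition_eq_zero hs]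
      simpa using hM0

theorem abs_smoothPosPart_le (j : ℕ) (t : ℝ) : |smoothPosPart j t| ≤ |t| := by
  rw [smoothPosPart, abs_mul, abs_of_nonneg (Real.smoothTransition.nonneg _)]
  exact mul_le_of_le_one_right (abs_nonneg _) (Real.smoothTransition.le_one _)

theorem eventually_one_lt_succ_mul {t : ℝ} (ht : 0 < t) :
    ∀ᶠ j : ℕ in atTop, 1 < ((j : ℝ) + 1) * t :=
  (Tendsto.atTop_mul_const ht (tendsto_atTop_add_const_right _ 1
    tendsto_natCast_atTop_atTop)).eventually_gt_atTop 1

theorem tendsto_smoothPosPart (t : ℝ) :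
    Tendsto (fun j => smoothPosPart j t) atTop (𝓝 (max t 0)) := by
  rcases le_or_gt t 0 with h | h
  · refine tendsto_const_nhds.congr fun j => ?_
    rw [smoothPosPart, Real.smoothTransition.zero_of_nonpos, max_eq_right h, mul_zero]
    exact mul_nonpos_of_nonneg_of_nonpos (by positivity) h
  · refine tendsto_const_nhds.congr' ?_
    filter_upwards [eventually_one_lt_succ_mul h] with j hj
    rw [smoothPosPart, Real.smoothTransition.one_of_one_le hj.le, max_eq_left h.le, mul_one]

theorem tendsto_deriv_smoothPosPart (t : ℝ) :
    Tendsto (fun j => deriv (smoothPosPart j) t) atTop (𝓝 (if 0 < t then 1 else 0)) := by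
  simp only [deriv_smoothPosPart]
  split_ifs with h
  · refine tendsto_const_nhds.congr' ?_
    filter_upwards [eventually_one_lt_succ_mul h] with j hj
    rw [Real.smoothTransition.one_of_one_le hj.le, deriv_smoothTransition_eq_zero]
    · simp
    · exact fun h => absurd h.2 (not_le.2 hj)
  · refine tendsto_const_nhds.congr fun j => ?_
    rcases (not_lt.1 h).eq_or_lt with h | h
    · simp [h]
    · have : ((j : ℝ) + 1) * t < 0 := mul_neg_of_pos_of_neg (by positivity) h
      rw [Real.smoothTransition.zero_of_nonpos this.le, deriv_smoothTransition_eq_zero]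
      · simp
      · exact fun h => absurd h.1 (not_le.2 this)

/-! ### Limits of test functions: chain rule, truncation, weak gradients -/

theorem tendsto_eLpNorm_zero_of_dominated {α F : Type*} [MeasurableSpace α] {μ : Measure α}
    [NormedAddCommGroup F] {p : ℝ} (hp : 1 ≤ p) {f : ℕ → α → F}
    (hf : ∀ j, AEStronglyMeasurable (f j) μ) {g : α → ℝ} (hg : MemLp g (ENNReal.ofReal p) μ)
    (hb : ∀ j, ∀ᵐ x ∂μ, ‖f j x‖ ≤ g x)
    (hl : ∀ᵐ x ∂μ, Tendsto (fun j => f j x) atTop (𝓝 0)) :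
    Tendsto (fun j => eLpNorm (f j) (ENNReal.ofReal p) μ) atTop (𝓝 0) := by
  have hp0 : 0 < p := by linarith
  have hE : ∀ j, eLpNorm (f j) (ENNReal.ofReal p) μ = (∫⁻ x, ‖f j x‖ₑ ^ p ∂μ) ^ (1 / p) := by
    intro j
    rw [eLpNorm_eq_lintegral_rpow_enorm_toReal (by positivity) ENNReal.ofReal_ne_top,
      ENNReal.toReal_ofReal hp0.le]
  simp only [hE]
  have hgfin : ∫⁻ x, ‖g x‖ₑ ^ p ∂μ ≠ ⊤ := by
    have := lintegral_rpow_enorm_lt_top_of_eLpNorm_lt_top (by positivity) ENNReal.ofReal_ne_top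
      hg.2
    rw [ENNReal.toReal_ofReal hp0.le] at this
    exact this.ne
  have h1 : Tendsto (fun j => ∫⁻ x, ‖f j x‖ₑ ^ p ∂μ) atTop (𝓝 (∫⁻ x, 0 ∂μ)) := by
    refine tendsto_lintegral_of_dominated_convergence' (fun x => ‖g x‖ₑ ^ p)
      (fun j => ((hf j).enorm).pow_const p) (fun j => ?_) hgfin ?_
    · filter_upwards [hb j] with x hx
      gcongr
      rw [← ofReal_norm, ← ofReal_norm]
      exact ENNReal.ofReal_le_ofReal (hx.trans (le_abs_self _))
    · filter_upwards [hl] with x hx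
      have := ((ENNReal.continuous_rpow_const (y := p)).tendsto _).comp hx.enorm
      simpa [ENNReal.zero_rpow_of_pos hp0, Function.comp_def] using this
  rw [lintegral_zero] at h1
  have := ((ENNReal.continuous_rpow_const (y := 1 / p)).tendsto _).comp h1
  simpa [ENNReal.zero_rpow_of_pos (inv_pos.2 hp0), Function.comp_def] using this

/-- `(φ, H)` lies in the closure of the pairs `(η, ∇η)`, `η ∈ C_c^∞(U)`, in `L^p(U)`. -/
def IsSobolevLimit (p : ℝ) (U : Set 𝔼) (φ : 𝔼 → ℝ) (H : 𝔼 → 𝔼) : Prop :=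
  ∀ ε : ENNReal, 0 < ε → ∃ η, IsTestFunction U η ∧
    eLpNorm (fun x => η x - φ x) (ENNReal.ofReal p) (volume.restrict U) ≤ ε ∧
    eLpNorm (fun x => gradient η x - H x) (ENNReal.ofReal p) (volume.restrict U) ≤ ε

theorem IsTestFunction.continuous {U : Set 𝔼} {η : 𝔼 → ℝ} (h : IsTestFunction U η) :
    Continuous η := h.1.continuous

theorem IsTestFunction.continuous_gradient {U : Set 𝔼} {η : 𝔼 → ℝ} (h : IsTestFunction U η) :
    Continuous (gradient η) :=
  (LinearIsometryEquiv.continuous _).comp (h.1.continuous_fderiv (by simp))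

theorem IsTestFunction.exists_bound {U : Set 𝔼} {η : 𝔼 → ℝ} (h : IsTestFunction U η) :
    ∃ B : ℝ, 0 ≤ B ∧ (∀ x, |η x| ≤ B) ∧ ∀ x, ‖gradient η x‖ ≤ B := by
  obtain ⟨B₁, h1⟩ := h.2.1.exists_bound_of_continuous h.continuous
  obtain ⟨B₂, h2⟩ := (h.2.1.fderiv ℝ).exists_bound_of_continuous
    (h.1.continuous_fderiv (by simp))
  refine ⟨max (max B₁ B₂) 0, le_max_right _ _, fun x => ?_, fun x => ?_⟩
  · exact (h1 x).trans (le_max_of_le_left (le_max_left _ _))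
  · rw [norm_gradient_eq]
    exact (h2 x).trans (le_max_of_le_left (le_max_right _ _))

theorem IsSobolevLimit.of_tendsto {p : ℝ} (hp : 1 ≤ p) {U : Set 𝔼} {φ : ℕ → 𝔼 → ℝ}
    {H : ℕ → 𝔼 → 𝔼} {φ₀ : 𝔼 → ℝ} {H₀ : 𝔼 → 𝔼} (h : ∀ j, IsSobolevLimit p U (φ j) (H j))
    (hφm : ∀ j, AEStronglyMeasurable (φ j) (volume.restrict U))
    (hHm : ∀ j, AEStronglyMeasurable (H j) (volume.restrict U))
    (hφ₀ : AEStronglyMeasurable φ₀ (volume.restrict U))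
    (hH₀ : AEStronglyMeasurable H₀ (volume.restrict U))
    (hφ : Tendsto (fun j => eLpNorm (fun x => φ j x - φ₀ x) (ENNReal.ofReal p)
      (volume.restrict U)) atTop (𝓝 0))
    (hH : Tendsto (fun j => eLpNorm (fun x => H j x - H₀ x) (ENNReal.ofReal p)
      (volume.restrict U)) atTop (𝓝 0)) : IsSobolevLimit p U φ₀ H₀ := by
  have hp1 : 1 ≤ ENNReal.ofReal p := by simpa using hp
  intro ε hε
  have hε2 : 0 < ε / 2 := ENNReal.half_pos hε.ne'
  rw [ENNReal.tendsto_nhds_zero] at hφ hH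
  obtain ⟨j, hj1, hj2⟩ := ((hφ _ hε2).and (hH _ hε2)).exists
  obtain ⟨η, hη, h1, h2⟩ := h j _ hε2
  refine ⟨η, hη, ?_, ?_⟩
  · have := eLpNorm_add_le (hη.continuous.aestronglyMeasurable.sub (hφm j))
      ((hφm j).sub hφ₀) hp1
    rw [← ENNReal.add_halves ε]
    refine le_trans (le_of_eq ?_) (this.trans (add_le_add h1 hj1))
    congr 1; ext x; simp
  · have := eLpNorm_add_le (hη.continuous_gradient.aestronglyMeasurable.sub (hHm j))
      ((hHm j).sub hH₀) hp1
    rw [← ENNReal.add_halves ε]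
    refine le_trans (le_of_eq ?_) (this.trans (add_le_add h2 hj2))
    congr 1; ext x; simp

theorem gradient_comp_mul {F : ℝ → ℝ} {v θ : 𝔼 → ℝ} {x : 𝔼} (hF : DifferentiableAt ℝ F (v x))
    (hv : DifferentiableAt ℝ v x) (hθ : DifferentiableAt ℝ θ x) :
    gradient (fun y => F (v y) * θ y) x =
      (deriv F (v x) * θ x) • gradient v x + F (v x) • gradient θ x := by
  have h1 : HasFDerivAt (fun y => F (v y)) (deriv F (v x) • fderiv ℝ v x) x :=
    hF.hasDerivAt.comp_hasFDerivAt x hv.hasFDerivAt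
  have h2 : HasFDerivAt (fun y => F (v y) * θ y) _ x := h1.mul hθ.hasFDerivAt
  rw [gradient, h2.fderiv]
  simp only [gradient, map_add, map_smul, smul_smul]
  rw [add_comm, mul_comm (θ x)]

theorem gradient_eq_zero_of_notMem_tsupport {f : 𝔼 → ℝ} {x : 𝔼} (hx : x ∉ tsupport f) :
    gradient f x = 0 := by
  have : fderiv ℝ f x = 0 := by
    by_contra h
    exact hx (support_fderiv_subset ℝ h)
  simp [gradient, this]

/-- Chain and product rule in `W^{1,p}_0(U)`, for smooth nonlinearities. -/
theorem isSobolevLimit_comp_mul {p : ℝ} (hp : 1 ≤ p) {U : Set 𝔼} (hU : IsOpen U) {u : 𝔼 → ℝ}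
    {G : 𝔼 → 𝔼} (hu : HasSobolevGradient p U u G) {θ : 𝔼 → ℝ} (hθ : IsTestFunction U θ)
    {F : ℝ → ℝ} (hF : ContDiff ℝ ∞ F) {M : ℝ} (hM : ∀ t, |deriv F t| ≤ M) :
    IsSobolevLimit p U (fun x => F (u x) * θ x)
      (fun x => (deriv F (u x) * θ x) • G x + F (u x) • gradient θ x) := by
  have hp0 : 0 < p := by linarith
  have hp1 : 1 ≤ ENNReal.ofReal p := by simpa using hp
  have hM0 : 0 ≤ M := (abs_nonneg _).trans (hM 0)
  obtain ⟨B, hB0, hB1, hB2⟩ := hθ.exists_bound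
  have hFL : ∀ a b, |F a - F b| ≤ M * |a - b| := fun a b => by
    have := Convex.norm_image_sub_le_of_norm_deriv_le (f := F) (s := univ) (C := M)
      (fun x _ => (hF.differentiable (by simp)).differentiableAt) (fun x _ => hM x) convex_univ
      (mem_univ b) (mem_univ a)
    simpa using this
  have hF' : Continuous (deriv F) := hF.continuous_deriv (by simp)
  set μ := (volume : Measure 𝔼).restrict U
  have hum : MemLp (U.indicator u) (ENNReal.ofReal p) volume :=
    (memLp_indicator_iff_restrict hU.measurableSet).2 hu.1
  have hGm : MemLp (U.indicator G) (ENNReal.ofReal p) volume :=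
    (memLp_indicator_iff_restrict hU.measurableSet).2 hu.2.1
  have hul := hum.locallyIntegrable hp1
  have hGl := hGm.locallyIntegrable hp1
  -- Keeping the ratio of outer to inner radius equal to 2 gives the almost everywhere convergence
  -- of the mollifications used in `hvae`.
  let φ : ℕ → ContDiffBump (0 : 𝔼) := fun i =>
    ⟨1 / ((i : ℝ) + 1), 2 * (1 / ((i : ℝ) + 1)), by positivity, by
      have : 0 < 1 / ((i : ℝ) + 1) := by positivity
      linarith⟩
  have hφ : Tendsto (fun i => (φ i).rOut) atTop (𝓝 0) := by
    have := (tendsto_one_div_add_atTop_nhds_zero_nat (𝕜 := ℝ)).const_mul 2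
    rwa [mul_zero] at this
  let v : ℕ → 𝔼 → ℝ := fun i => (φ i).normed volume ⋆[lsmul ℝ ℝ, volume] U.indicator u
  let W : ℕ → 𝔼 → 𝔼 := fun i => (φ i).normed volume ⋆[lsmul ℝ ℝ, volume] U.indicator G
  have hvs : ∀ i, ContDiff ℝ ∞ (v i) := fun i =>
    ((φ i).hasCompactSupport_normed (μ := volume)).contDiff_convolution_left (lsmul ℝ ℝ)
      (φ i).contDiff_normed hul
  have hWc : ∀ i, Continuous (W i) := fun i =>
    (((φ i).hasCompactSupport_normed (μ := volume)).contDiff_convolution_left (lsmul ℝ ℝ)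
      ((φ i).contDiff_normed (n := 0)) hGl).continuous
  have hv : Tendsto (fun i => eLpNorm (fun x => v i x - u x) (ENNReal.ofReal p) μ) atTop
      (𝓝 0) := by
    refine tendsto_of_tendsto_of_tendsto_of_le_of_le tendsto_const_nhds
      (tendsto_eLpNorm_bump_convolution_sub hp hum hφ) (fun _ => zero_le) fun i => ?_
    refine le_trans (le_of_eq ?_) (eLpNorm_mono_measure _ (Measure.restrict_le_self (s := U)))
    refine eLpNorm_congr_ae ?_
    filter_upwards [ae_restrict_mem hU.measurableSet] with x hx
    simp [v, hx]
  have hW : Tendsto (fun i => eLpNorm (fun x => W i x - G x) (ENNReal.ofReal p) μ) atTop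
      (𝓝 0) := by
    refine tendsto_of_tendsto_of_tendsto_of_le_of_le tendsto_const_nhds
      (tendsto_eLpNorm_bump_convolution_sub hp hGm hφ) (fun _ => zero_le) fun i => ?_
    refine le_trans (le_of_eq ?_) (eLpNorm_mono_measure _ (Measure.restrict_le_self (s := U)))
    refine eLpNorm_congr_ae ?_
    filter_upwards [ae_restrict_mem hU.measurableSet] with x hx
    simp [W, hx]
  have hvae : ∀ᵐ x ∂μ, Tendsto (fun i => v i x) atTop (𝓝 (u x)) := by
    filter_upwards [ae_restrict_mem hU.measurableSet, ae_restrict_of_ae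
      (ContDiffBump.ae_convolution_tendsto_right_of_locallyIntegrable (K := 2) hφ
        (Eventually.of_forall fun i => le_rfl) hul)] with x hx h
    rwa [indicator_of_mem hx] at h
  -- Once the mollification radius is below the distance from the support of θ to the complement of
  -- U, the convolution sees only values inside U, so its gradient is the mollified G.
  have hgrad : ∀ᶠ i in atTop, ∀ x, gradient (fun y => F (v i y) * θ y) x =
      (deriv F (v i x) * θ x) • W i x + F (v i x) • gradient θ x := by
    obtain ⟨δ, hδ, hδU⟩ := hθ.2.1.isCompact.exists_cthickening_subset_open hU hθ.2.2
    filter_upwards [hφ.eventually_lt_const hδ] with i hi x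
    by_cases hx : x ∈ tsupport θ
    · rw [gradient_comp_mul ((hF.differentiable (by simp)) _)
        (((hvs i).differentiable (by simp)) _) ((hθ.1.differentiable (by simp)) _)]
      have hb : Metric.closedBall x (φ i).rOut ⊆ U :=
        ((Metric.closedBall_subset_closedBall hi.le).trans
          (Metric.closedBall_subset_cthickening hx δ)).trans hδU
      rw [gradient_bump_convolution hp hU hu (φ i) hb]
    · have h1 : x ∉ tsupport (fun y => F (v i y) * θ y) := fun h =>
        hx (tsupport_mul_subset_right h)
      rw [gradient_eq_zero_of_notMem_tsupport h1, gradient_eq_zero_of_notMem_tsupport hx,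
        image_eq_zero_of_notMem_tsupport hx]
      simp
  have humeas : AEStronglyMeasurable u μ := hu.1.1
  have hGmeas : AEStronglyMeasurable G μ := hu.2.1.1
  have hθc := hθ.continuous
  have hθg := hθ.continuous_gradient
  have hvc : ∀ i, Continuous (v i) := fun i => (hvs i).continuous
  have hFc := hF.continuous
  have hbd : ∀ (c : ℝ), 0 ≤ c → ∀ {g : ℕ → ENNReal}, Tendsto g atTop (𝓝 0) →
      Tendsto (fun i => ENNReal.ofReal c * g i) atTop (𝓝 0) := fun c _ g hg => by
    simpa using ENNReal.Tendsto.const_mul hg (Or.inr ENNReal.ofReal_ne_top)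
  have hA : Tendsto (fun i => eLpNorm (fun x => F (v i x) * θ x - F (u x) * θ x)
      (ENNReal.ofReal p) μ) atTop (𝓝 0) := by
    refine tendsto_of_tendsto_of_tendsto_of_le_of_le tendsto_const_nhds
      (hbd (M * B) (by positivity) hv) (fun _ => zero_le) fun i => ?_
    refine eLpNorm_le_mul_eLpNorm_of_ae_le_mul (Eventually.of_forall fun x => ?_) _
    rw [← sub_mul, norm_mul, Real.norm_eq_abs, Real.norm_eq_abs, Real.norm_eq_abs]
    calc |F (v i x) - F (u x)| * |θ x| ≤ (M * |v i x - u x|) * B :=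
          mul_le_mul (hFL _ _) (hB1 x) (abs_nonneg _) (by positivity)
      _ = _ := by ring
  have hT1 : Tendsto (fun i => eLpNorm (fun x => (deriv F (v i x) * θ x) • (W i x - G x))
      (ENNReal.ofReal p) μ) atTop (𝓝 0) := by
    refine tendsto_of_tendsto_of_tendsto_of_le_of_le tendsto_const_nhds
      (hbd (M * B) (by positivity) hW) (fun _ => zero_le) fun i => ?_
    refine eLpNorm_le_mul_eLpNorm_of_ae_le_mul (Eventually.of_forall fun x => ?_) _
    rw [norm_smul, norm_mul, Real.norm_eq_abs, Real.norm_eq_abs]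
    gcongr
    · exact hM _
    · exact hB1 x
  have hT3 : Tendsto (fun i => eLpNorm (fun x => (F (v i x) - F (u x)) • gradient θ x)
      (ENNReal.ofReal p) μ) atTop (𝓝 0) := by
    refine tendsto_of_tendsto_of_tendsto_of_le_of_le tendsto_const_nhds
      (hbd (M * B) (by positivity) hv) (fun _ => zero_le) fun i => ?_
    refine eLpNorm_le_mul_eLpNorm_of_ae_le_mul (Eventually.of_forall fun x => ?_) _
    rw [norm_smul, Real.norm_eq_abs, Real.norm_eq_abs]
    calc |F (v i x) - F (u x)| * ‖gradient θ x‖ ≤ (M * |v i x - u x|) * B :=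
          mul_le_mul (hFL _ _) (hB2 x) (norm_nonneg _) (by positivity)
      _ = _ := by ring
  have hm1 : ∀ i, AEStronglyMeasurable (fun x => (deriv F (v i x) * θ x) • (W i x - G x)) μ :=
    fun i => (((hF'.comp (hvc i)).mul hθc).aestronglyMeasurable).smul
      ((hWc i).aestronglyMeasurable.sub hGmeas)
  have hm2 : ∀ i, AEStronglyMeasurable
      (fun x => ((deriv F (v i x) - deriv F (u x)) * θ x) • G x) μ :=
    fun i => (((hF'.comp (hvc i)).aestronglyMeasurable.sub
      (hF'.comp_aestronglyMeasurable humeas)).mul hθc.aestronglyMeasurable).smul hGmeas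
  have hm3 : ∀ i, AEStronglyMeasurable (fun x => (F (v i x) - F (u x)) • gradient θ x) μ :=
    fun i => ((hFc.comp (hvc i)).aestronglyMeasurable.sub
      (hFc.comp_aestronglyMeasurable humeas)).smul hθg.aestronglyMeasurable
  -- The only term not controlled by the L^p convergence of v_i or W_i: `deriv F` is merely
  -- continuous and bounded, so dominated convergence against ‖G‖ is used.
  have hT2 : Tendsto (fun i => eLpNorm (fun x => ((deriv F (v i x) - deriv F (u x)) * θ x) • G x)
      (ENNReal.ofReal p) μ) atTop (𝓝 0) := by
    refine tendsto_eLpNorm_zero_of_dominated hp hm2 (g := fun x => (2 * M * B) * ‖G x‖)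
      (hu.2.1.norm.const_mul _) (fun i => Eventually.of_forall fun x => ?_) ?_
    · rw [norm_smul, norm_mul, Real.norm_eq_abs, Real.norm_eq_abs]
      have h1 : |deriv F (v i x) - deriv F (u x)| ≤ 2 * M := by
        refine (abs_sub _ _).trans ?_
        linarith [hM (v i x), hM (u x)]
      gcongr
      exact hB1 x
    · filter_upwards [hvae] with x hx
      have h1 := (hF'.tendsto _).comp hx
      have h2 := ((h1.sub_const (deriv F (u x))).mul_const (θ x)).smul_const (G x)
      simpa [Function.comp_def] using h2
  intro ε hε
  have hε2 : 0 < ε / 2 := ENNReal.half_pos hε.ne'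
  have hε4 : 0 < ε / 2 / 2 := ENNReal.half_pos hε2.ne'
  rw [ENNReal.tendsto_nhds_zero] at hA hT1 hT2 hT3
  obtain ⟨i, h0, h1, h2, h3, h4⟩ := (hgrad.and ((hA _ hε).and ((hT1 _ hε4).and
    ((hT2 _ hε4).and (hT3 _ hε2))))).exists
  refine ⟨fun y => F (v i y) * θ y, ⟨(hF.comp (hvs i)).mul hθ.1, hθ.2.1.mul_left,
    (tsupport_mul_subset_right).trans hθ.2.2⟩, h1, ?_⟩
  have h5 := eLpNorm_add_le ((hm1 i).add (hm2 i)) (hm3 i) hp1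
  have h6 := eLpNorm_add_le (hm1 i) (hm2 i) hp1
  have h7 := h5.trans (add_le_add (h6.trans (add_le_add h2 h3)) h4)
  rw [ENNReal.add_halves, ENNReal.add_halves] at h7
  refine le_trans (le_of_eq ?_) h7
  congr 1
  ext1 x
  rw [h0 x]
  simp only [Pi.add_apply, smul_sub, sub_mul, sub_smul]
  abel

/-- Truncation and localization in `W^{1,p}_0(U)`. -/
theorem isSobolevLimit_posPart_mul {p : ℝ} (hp : 1 ≤ p) {U : Set 𝔼} (hU : IsOpen U)
    (hUv : volume U ≠ ⊤) {u : 𝔼 → ℝ}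
    {G : 𝔼 → 𝔼} (hu : HasSobolevGradient p U u G) {θ : 𝔼 → ℝ} (hθ : IsTestFunction U θ) (ℓ : ℝ) :
    MemLp (fun x => max (u x - ℓ) 0 * θ x) (ENNReal.ofReal p) (volume.restrict U) ∧
    MemLp (fun x => ((if 0 < u x - ℓ then 1 else 0) * θ x) • G x + max (u x - ℓ) 0 • gradient θ x)
      (ENNReal.ofReal p) (volume.restrict U) ∧
    IsSobolevLimit p U (fun x => max (u x - ℓ) 0 * θ x)
      (fun x => ((if 0 < u x - ℓ then 1 else 0) * θ x) • G x +
        max (u x - ℓ) 0 • gradient θ x) := by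
  obtain ⟨M, hM0, hM⟩ := exists_abs_deriv_smoothPosPart_le
  obtain ⟨B, hB0, hB1, hB2⟩ := hθ.exists_bound
  have hp1 : 1 ≤ ENNReal.ofReal p := by simpa using hp
  set μ := (volume : Measure 𝔼).restrict U
  have : IsFiniteMeasure μ := ⟨by simpa [μ] using hUv.lt_top⟩
  have humeas : AEStronglyMeasurable u μ := hu.1.1
  have hGmeas : AEStronglyMeasurable G μ := hu.2.1.1
  have hul : MemLp (fun x => u x - ℓ) (ENNReal.ofReal p) μ := hu.1.sub (memLp_const ℓ)
  have hθm : AEStronglyMeasurable θ μ := hθ.continuous.aestronglyMeasurable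
  have hθg : AEStronglyMeasurable (gradient θ) μ := hθ.continuous_gradient.aestronglyMeasurable
  have hPm : AEStronglyMeasurable (fun x => max (u x - ℓ) 0) μ :=
    (hul.1.aemeasurable.max aemeasurable_const).aestronglyMeasurable
  have hSm : AEStronglyMeasurable (fun x => if 0 < u x - ℓ then (1 : ℝ) else 0) μ := by
    have : Measurable fun t : ℝ => if 0 < t then (1 : ℝ) else 0 :=
      Measurable.ite measurableSet_Ioi measurable_const measurable_const
    exact (this.comp_aemeasurable hul.1.aemeasurable).aestronglyMeasurable
  have hPle : ∀ t : ℝ, |max t 0| ≤ |t| := fun t => by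
    rw [abs_of_nonneg (le_max_right _ _)]
    exact max_le (le_abs_self t) (abs_nonneg t)
  have hφ₀ : AEStronglyMeasurable (fun x => max (u x - ℓ) 0 * θ x) μ := hPm.mul hθm
  have hH₀ : AEStronglyMeasurable (fun x => ((if 0 < u x - ℓ then 1 else 0) * θ x) • G x +
      max (u x - ℓ) 0 • gradient θ x) μ :=
    ((hSm.mul hθm).smul hGmeas).add (hPm.smul hθg)
  have hdom1 : MemLp (fun x => (2 * B) * ‖u x - ℓ‖) (ENNReal.ofReal p) μ := hul.norm.const_mul _
  have hdom2 : MemLp (fun x => ((M + 1) * B) * ‖G x‖ + (2 * B) * ‖u x - ℓ‖)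
      (ENNReal.ofReal p) μ := (hu.2.1.norm.const_mul _).add hdom1
  refine ⟨hdom1.mono' hφ₀ (Eventually.of_forall fun x => ?_),
    hdom2.mono' hH₀ (Eventually.of_forall fun x => ?_), ?_⟩
  · rw [norm_mul, Real.norm_eq_abs, Real.norm_eq_abs, Real.norm_eq_abs]
    have := mul_le_mul (hPle (u x - ℓ)) (hB1 x) (abs_nonneg _) (abs_nonneg _)
    nlinarith [mul_nonneg hB0 (abs_nonneg (u x - ℓ))]
  · refine (norm_add_le _ _).trans (add_le_add ?_ ?_)
    · rw [norm_smul, norm_mul, Real.norm_eq_abs, Real.norm_eq_abs]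
      gcongr
      · split_ifs <;> simp <;> linarith
      · exact hB1 x
    · rw [norm_smul, Real.norm_eq_abs, Real.norm_eq_abs]
      have := mul_le_mul (hPle (u x - ℓ)) (hB2 x) (norm_nonneg _) (abs_nonneg _)
      nlinarith [mul_nonneg hB0 (abs_nonneg (u x - ℓ))]
  have hd : ∀ j t, deriv (fun t => smoothPosPart j (t - ℓ)) t =
      deriv (smoothPosPart j) (t - ℓ) := fun j t => deriv_comp_sub_const _ _ _
  have hs : ∀ j, ContDiff ℝ ∞ fun t => smoothPosPart j (t - ℓ) := fun j =>
    (contDiff_smoothPosPart j).comp (contDiff_id.sub contDiff_const)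
  have hc : ∀ j, Continuous (smoothPosPart j) := fun j => (contDiff_smoothPosPart j).continuous
  have hc' : ∀ j, Continuous (deriv (smoothPosPart j)) := fun j =>
    (contDiff_smoothPosPart j).continuous_deriv (by simp)
  have hm1 : ∀ j, AEStronglyMeasurable (fun x => smoothPosPart j (u x - ℓ)) μ := fun j =>
    (hc j).comp_aestronglyMeasurable hul.1
  have hm2 : ∀ j, AEStronglyMeasurable (fun x => deriv (smoothPosPart j) (u x - ℓ)) μ := fun j =>
    (hc' j).comp_aestronglyMeasurable hul.1
  have happ : ∀ j, IsSobolevLimit p U (fun x => smoothPosPart j (u x - ℓ) * θ x)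
      (fun x => (deriv (smoothPosPart j) (u x - ℓ) * θ x) • G x +
        smoothPosPart j (u x - ℓ) • gradient θ x) := fun j => by
    have := isSobolevLimit_comp_mul hp hU hu hθ (hs j) (M := M)
      (fun t => by rw [hd]; exact hM j _)
    simpa only [hd] using this
  have hdiff : ∀ j t, |smoothPosPart j t - max t 0| ≤ 2 * |t| := fun j t => by
    refine (abs_sub _ _).trans ?_
    linarith [abs_smoothPosPart_le j t, hPle t]
  have hdiff' : ∀ j (t : ℝ), |deriv (smoothPosPart j) t - (if 0 < t then 1 else 0)| ≤ M + 1 :=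
    fun j t => by
      refine (abs_sub _ _).trans ?_
      have : |if 0 < t then (1 : ℝ) else 0| ≤ 1 := by split_ifs <;> simp
      linarith [hM j t]
  -- The smooth case applies to each regularization. Their derivatives are uniformly bounded and
  -- converge pointwise to the indicator of t > 0, so both L^p limits follow by domination.
  refine IsSobolevLimit.of_tendsto hp happ (fun j => (hm1 j).mul hθm)
    (fun j => (((hm2 j).mul hθm).smul hGmeas).add ((hm1 j).smul hθg)) hφ₀ hH₀ ?_ ?_
  · refine tendsto_eLpNorm_zero_of_dominated hp (fun j => ((hm1 j).mul hθm).sub hφ₀) hdom1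
      (fun j => Eventually.of_forall fun x => ?_) (Eventually.of_forall fun x => ?_)
    · rw [← sub_mul, norm_mul, Real.norm_eq_abs, Real.norm_eq_abs, Real.norm_eq_abs]
      calc _ ≤ (2 * |u x - ℓ|) * B :=
            mul_le_mul (hdiff j _) (hB1 x) (abs_nonneg _) (by positivity)
        _ = _ := by ring
    · have h1 := ((tendsto_smoothPosPart (u x - ℓ)).mul_const (θ x)).sub_const
        (max (u x - ℓ) 0 * θ x)
      simpa using h1
  · refine tendsto_eLpNorm_zero_of_dominated hp
      (fun j => ((((hm2 j).mul hθm).smul hGmeas).add ((hm1 j).smul hθg)).sub hH₀) hdom2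
      (fun j => Eventually.of_forall fun x => ?_) (Eventually.of_forall fun x => ?_)
    · have : (deriv (smoothPosPart j) (u x - ℓ) * θ x) • G x +
          smoothPosPart j (u x - ℓ) • gradient θ x -
          (((if 0 < u x - ℓ then 1 else 0) * θ x) • G x + max (u x - ℓ) 0 • gradient θ x) =
          ((deriv (smoothPosPart j) (u x - ℓ) - (if 0 < u x - ℓ then 1 else 0)) * θ x) • G x +
          (smoothPosPart j (u x - ℓ) - max (u x - ℓ) 0) • gradient θ x := by
        simp only [sub_mul, sub_smul]; abel
      rw [this]
      refine (norm_add_le _ _).trans (add_le_add ?_ ?_)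
      · rw [norm_smul, norm_mul, Real.norm_eq_abs, Real.norm_eq_abs]
        gcongr
        · exact hdiff' j _
        · exact hB1 x
      · rw [norm_smul, Real.norm_eq_abs, Real.norm_eq_abs]
        calc _ ≤ (2 * |u x - ℓ|) * B :=
              mul_le_mul (hdiff j _) (hB2 x) (norm_nonneg _) (by positivity)
          _ = _ := by ring
    · have h1 := ((tendsto_deriv_smoothPosPart (u x - ℓ)).mul_const (θ x)).smul_const (G x)
      have h2 := (tendsto_smoothPosPart (u x - ℓ)).smul_const (gradient θ x)
      have h3 := (h1.add h2).sub_const (((if 0 < u x - ℓ then 1 else 0) * θ x) • G x +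
        max (u x - ℓ) 0 • gradient θ x)
      rwa [sub_self] at h3

theorem IsTestFunction.integral_mul_fderiv {U : Set 𝔼} {η ξ : 𝔼 → ℝ} (hη : IsTestFunction U η)
    (hξ : IsTestFunction U ξ) (v : 𝔼) :
    ∫ x in U, η x * fderiv ℝ ξ x v = - ∫ x in U, inner ℝ (gradient η x) v * ξ x := by
  have hξd : Continuous fun x => fderiv ℝ ξ x v :=
    (hξ.1.continuous_fderiv (by simp)).clm_apply continuous_const
  have hηd : Continuous fun x => fderiv ℝ η x v :=
    (hη.1.continuous_fderiv (by simp)).clm_apply continuous_const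
  rw [setIntegral_eq_integral_of_forall_compl_eq_zero, setIntegral_eq_integral_of_forall_compl_eq_zero]
  · simp only [inner_gradient_eq_fderiv]
    exact integral_mul_fderiv_eq_neg_fderiv_mul_of_integrable
      ((hηd.mul hξ.continuous).integrable_of_hasCompactSupport hξ.2.1.mul_left)
      ((hη.continuous.mul hξd).integrable_of_hasCompactSupport hη.2.1.mul_right)
      ((hη.continuous.mul hξ.continuous).integrable_of_hasCompactSupport hξ.2.1.mul_left)
      (fun x _ => (hη.1.differentiable (by simp)).differentiableAt)
      (fun x _ => (hξ.1.differentiable (by simp)).differentiableAt)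
  · intro x hx
    rw [image_eq_zero_of_notMem_tsupport fun h => hx (hξ.2.2 h), mul_zero]
  · intro x hx
    rw [image_eq_zero_of_notMem_tsupport fun h => hx (hη.2.2 h), zero_mul]

/-- Integration by parts holds for each approximating test function, and on a set of finite measure
both sides are continuous in L^p, so the defect is at most a constant times every ε. -/
theorem IsSobolevLimit.hasSobolevGradient {p : ℝ} (hp : 1 ≤ p) {U : Set 𝔼}
    (hUv : volume U ≠ ⊤) {φ : 𝔼 → ℝ} {H : 𝔼 → 𝔼}
    (hφ : MemLp φ (ENNReal.ofReal p) (volume.restrict U))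
    (hH : MemLp H (ENNReal.ofReal p) (volume.restrict U)) (h : IsSobolevLimit p U φ H) :
    HasSobolevGradient p U φ H := by
  have hp1 : 1 ≤ ENNReal.ofReal p := by simpa using hp
  refine ⟨hφ, hH, fun ξ hξ v => ?_⟩
  obtain ⟨B, hB0, hB1, hB2⟩ := hξ.exists_bound
  set μ := (volume : Measure 𝔼).restrict U
  have : IsFiniteMeasure μ := ⟨by simpa [μ] using hUv.lt_top⟩
  have hξd : Continuous fun x => fderiv ℝ ξ x v :=
    (hξ.1.continuous_fderiv (by simp)).clm_apply continuous_const
  have hb1 : ∀ x, |fderiv ℝ ξ x v| ≤ B * ‖v‖ := fun x => by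
    have h1 := (fderiv ℝ ξ x).le_opNorm v
    rw [← norm_gradient_eq] at h1
    exact h1.trans (by gcongr; exact hB2 x)
  have hi1 : ∀ {f : 𝔼 → ℝ}, MemLp f (ENNReal.ofReal p) μ →
      Integrable (fun x => f x * fderiv ℝ ξ x v) μ := fun {f} hf =>
    (hf.integrable hp1).mul_bdd (c := B * ‖v‖) hξd.aestronglyMeasurable
      (Eventually.of_forall hb1)
  have hi2 : ∀ {g : 𝔼 → 𝔼}, MemLp g (ENNReal.ofReal p) μ →
      Integrable (fun x => inner ℝ (g x) v * ξ x) μ := fun {g} hg =>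
    ((hg.integrable hp1).inner_const v).mul_bdd (c := B) hξ.continuous.aestronglyMeasurable
      (Eventually.of_forall hB1)
  have hη : ∀ {η}, IsTestFunction U η → MemLp η (ENNReal.ofReal p) μ := fun {η} hη =>
    hη.continuous.memLp_of_hasCompactSupport hη.2.1
  have hηg : ∀ {η}, IsTestFunction U η → MemLp (gradient η) (ENNReal.ofReal p) μ := fun {η} hη =>
    hη.continuous_gradient.memLp_of_hasCompactSupport (by
      refine hη.2.1.mono' fun x hx => ?_
      by_contra hx'
      exact hx (gradient_eq_zero_of_notMem_tsupport hx'))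
  have key : ∀ ε : ENNReal, 0 < ε →
      ‖∫ x, φ x * fderiv ℝ ξ x v ∂μ + ∫ x, inner ℝ (H x) v * ξ x ∂μ‖ₑ ≤
        ENNReal.ofReal (B * ‖v‖) * 2 * (μ univ ^ (1 - 1 / p)) * ε := by
    intro ε hε
    obtain ⟨η, ht, h1, h2⟩ := h ε hε
    have h3 := ht.integral_mul_fderiv hξ v
    have h4 : ∫ x, φ x * fderiv ℝ ξ x v ∂μ + ∫ x, inner ℝ (H x) v * ξ x ∂μ =
        -(∫ x, (η x - φ x) * fderiv ℝ ξ x v ∂μ +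
          ∫ x, inner ℝ (gradient η x - H x) v * ξ x ∂μ) := by
      simp only [sub_mul, inner_sub_left]
      rw [integral_sub (hi1 (hη ht)) (hi1 hφ), integral_sub (hi2 (hηg ht)) (hi2 hH), h3]
      ring
    have hLp : ∀ {F : Type} [NormedAddCommGroup F] {g : 𝔼 → F},
        AEStronglyMeasurable g μ → eLpNorm g (ENNReal.ofReal p) μ ≤ ε →
        ∫⁻ x, ‖g x‖ₑ ∂μ ≤ ε * μ univ ^ (1 - 1 / p) := fun {F} _ {g} hg hle => by
      rw [← eLpNorm_one_eq_lintegral_enorm]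
      refine (eLpNorm_le_eLpNorm_mul_rpow_measure_univ hp1 hg).trans ?_
      rw [ENNReal.toReal_ofReal (by linarith), ENNReal.toReal_one, one_div_one]
      gcongr
    have h5 : ‖∫ x, (η x - φ x) * fderiv ℝ ξ x v ∂μ‖ₑ ≤
        ENNReal.ofReal (B * ‖v‖) * (ε * μ univ ^ (1 - 1 / p)) := by
      refine (enorm_integral_le_lintegral_enorm _).trans ?_
      refine le_trans ?_ (mul_le_mul_right (hLp ((hη ht).1.sub hφ.1) h1) _)
      rw [← lintegral_const_mul' _ _ ENNReal.ofReal_ne_top]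
      refine lintegral_mono fun x => ?_
      simp only [Pi.sub_apply]
      rw [enorm_mul, mul_comm]
      gcongr
      rw [← ofReal_norm]
      exact ENNReal.ofReal_le_ofReal (hb1 x)
    have h6 : ‖∫ x, inner ℝ (gradient η x - H x) v * ξ x ∂μ‖ₑ ≤
        ENNReal.ofReal (B * ‖v‖) * (ε * μ univ ^ (1 - 1 / p)) := by
      refine (enorm_integral_le_lintegral_enorm _).trans ?_
      refine le_trans ?_ (mul_le_mul_right (hLp ((hηg ht).1.sub hH.1) h2) _)
      rw [← lintegral_const_mul' _ _ ENNReal.ofReal_ne_top]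
      refine lintegral_mono fun x => ?_
      simp only [Pi.sub_apply]
      rw [← ofReal_norm, ← ofReal_norm, ← ENNReal.ofReal_mul (by positivity)]
      refine ENNReal.ofReal_le_ofReal ?_
      rw [norm_mul]
      calc _ ≤ (‖gradient η x - H x‖ * ‖v‖) * B := by
            gcongr
            · exact norm_inner_le_norm _ _
            · exact hB1 x
        _ = _ := by ring
    rw [h4, enorm_neg]
    refine (enorm_add_le _ _).trans ((add_le_add h5 h6).trans (le_of_eq ?_))
    ring
  have hC : ENNReal.ofReal (B * ‖v‖) * 2 * (μ univ ^ (1 - 1 / p)) ≠ ⊤ := by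
    refine ENNReal.mul_ne_top (ENNReal.mul_ne_top ENNReal.ofReal_ne_top (by simp)) ?_
    refine ENNReal.rpow_ne_top_of_nonneg ?_ (measure_ne_top _ _)
    rw [sub_nonneg, div_le_one (by linarith)]
    exact hp
  have hz : ‖∫ x, φ x * fderiv ℝ ξ x v ∂μ + ∫ x, inner ℝ (H x) v * ξ x ∂μ‖ₑ ≤ 0 := by
    have ht : Tendsto (fun ε : ENNReal =>
        ENNReal.ofReal (B * ‖v‖) * 2 * (μ univ ^ (1 - 1 / p)) * ε) (𝓝[>] 0) (𝓝 0) := by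
      have := ENNReal.Tendsto.const_mul (tendsto_id (α := ENNReal) (x := 𝓝 0)) (Or.inr hC)
      rw [mul_zero] at this
      exact this.mono_left nhdsWithin_le_nhds
    exact ge_of_tendsto ht (eventually_mem_nhdsWithin.mono fun ε hε => key ε hε)
  have := enorm_eq_zero.1 (le_antisymm hz (zero_le))
  linarith

theorem IsSobolevLimit.exists_seq {p : ℝ} {U : Set 𝔼} {φ : 𝔼 → ℝ} {H : 𝔼 → 𝔼}
    (h : IsSobolevLimit p U φ H) :
    ∃ η : ℕ → 𝔼 → ℝ, (∀ k, IsTestFunction U (η k)) ∧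
      Tendsto (fun k => eLpNorm (fun x => η k x - φ x) (ENNReal.ofReal p)
        (volume.restrict U)) atTop (𝓝 0) ∧
      Tendsto (fun k => eLpNorm (fun x => gradient (η k) x - H x) (ENNReal.ofReal p)
        (volume.restrict U)) atTop (𝓝 0) := by
  choose η h1 h2 h3 using fun k : ℕ => h ((k : ENNReal) + 1)⁻¹ (by simp)
  have ht : Tendsto (fun k : ℕ => ((k : ENNReal) + 1)⁻¹) atTop (𝓝 0) := by
    have := ENNReal.tendsto_inv_nat_nhds_zero.comp (tendsto_add_atTop_nat 1)
    simpa [Function.comp_def] using this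
  exact ⟨η, h1, tendsto_of_tendsto_of_tendsto_of_le_of_le tendsto_const_nhds ht
    (fun _ => zero_le) h2, tendsto_of_tendsto_of_tendsto_of_le_of_le tendsto_const_nhds ht
    (fun _ => zero_le) h3⟩

/-! ### Sobolev inequality on balls -/

theorem one_lt_kappa (n : ℕ) {p : ℝ} (hp : 1 < p) : 1 < kappa n p := by
  unfold kappa
  split_ifs with h
  · rw [one_lt_div (by linarith)]; linarith
  · norm_num

theorem volume_ball_rpow {x₀ : 𝔼} {r : ℝ} (hr : 0 < r) {e : ℝ} (he : 0 ≤ e) :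
    volume (Metric.ball x₀ r) ^ e =
      ENNReal.ofReal (r ^ (n * e)) * volume (Metric.ball (0 : 𝔼) 1) ^ e := by
  rw [Measure.addHaar_ball_of_pos _ _ hr, ENNReal.mul_rpow_of_nonneg _ _ he,
    ENNReal.ofReal_rpow_of_nonneg (by positivity) he, ← Real.rpow_natCast, ← Real.rpow_mul hr.le]
  simp

theorem eLpNorm_restrict_of_zero_compl {F : Type*} [NormedAddCommGroup F] {U : Set 𝔼}
    (hU : MeasurableSet U) {f : 𝔼 → F} (hf : ∀ x, x ∉ U → f x = 0) (q : ENNReal) :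
    eLpNorm f q (volume.restrict U) = eLpNorm f q volume := by
  rw [← eLpNorm_indicator_eq_eLpNorm_restrict hU]
  congr 1
  exact indicator_eq_self.2 fun x hx => by
    by_contra h
    exact hx (hf x h)

theorem eLpNorm_ball_le_mul {F : Type*} [NormedAddCommGroup F] {x₀ : 𝔼} {r : ℝ} (hr : 0 < r)
    {f : 𝔼 → F} (hf : ∀ x, x ∉ Metric.ball x₀ r → f x = 0) (hfm : AEStronglyMeasurable f volume)
    {q p : ℝ} (hq : 0 < q) (hqp : q ≤ p) :
    eLpNorm f (ENNReal.ofReal q) volume ≤ eLpNorm f (ENNReal.ofReal p) volume *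
      (ENNReal.ofReal (r ^ (n * (1 / q - 1 / p))) *
        volume (Metric.ball (0 : 𝔼) 1) ^ (1 / q - 1 / p)) := by
  have h1 := eLpNorm_le_eLpNorm_mul_rpow_measure_univ (μ := volume.restrict (Metric.ball x₀ r))
    (ENNReal.ofReal_le_ofReal hqp) hfm.restrict
  rw [eLpNorm_restrict_of_zero_compl measurableSet_ball hf,
    eLpNorm_restrict_of_zero_compl measurableSet_ball hf, ENNReal.toReal_ofReal hq.le,
    ENNReal.toReal_ofReal (by linarith), Measure.restrict_apply_univ, volume_ball_rpow hr] at h1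
  · exact h1
  · rw [sub_nonneg]
    exact one_div_le_one_div_of_le hq hqp

theorem IsTestFunction.eq_zero_of_notMem {U : Set 𝔼} {η : 𝔼 → ℝ} (h : IsTestFunction U η) (x : 𝔼)
    (hx : x ∉ U) : η x = 0 :=
  image_eq_zero_of_notMem_tsupport fun h' => hx (h.2.2 h')

theorem IsTestFunction.gradient_eq_zero_of_notMem {U : Set 𝔼} {η : 𝔼 → ℝ}
    (h : IsTestFunction U η) (x : 𝔼) (hx : x ∉ U) : gradient η x = 0 :=
  gradient_eq_zero_of_notMem_tsupport fun h' => hx (h.2.2 h')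

theorem gagliardo_nirenberg_sobolev (hn : 1 ≤ n) {q p' : ℝ} (hq : 1 ≤ q) (hp' : 0 < p')
    (h : p'⁻¹ = q⁻¹ - (n : ℝ)⁻¹) :
    ∃ C : NNReal, ∀ {U : Set 𝔼} {η : 𝔼 → ℝ}, IsTestFunction U η →
      eLpNorm η (ENNReal.ofReal p') volume ≤
        C * eLpNorm (gradient η) (ENNReal.ofReal q) volume := by
  refine ⟨SNormLESNormFDerivOfEqConst ℝ (volume : Measure 𝔼) (q.toNNReal : ℝ),
    fun {U η} hη => ?_⟩
  have h1 := eLpNorm_le_eLpNorm_fderiv_of_eq (volume : Measure 𝔼) (u := η) (p := q.toNNReal)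
    (p' := p'.toNNReal) (hη.1.of_le (by norm_cast)) hη.2.1 (by simpa using hq)
    (by simp; omega) (by
      rw [Real.coe_toNNReal _ hp'.le, NNReal.coe_inv, Real.coe_toNNReal _ (by linarith), h]
      simp)
  rw [eLpNorm_congr_norm_ae (g := fderiv ℝ η) (f := gradient η)
    (Eventually.of_forall fun x => norm_gradient_eq η x)]
  exact h1

/-- The fundamental theorem of calculus on a half-line, transported along the isometry between ℝ and
one-dimensional Euclidean space. -/
theorem IsTestFunction.enorm_le_lintegral_gradient {U : Set (EuclideanSpace ℝ (Fin 1))}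
    {η : EuclideanSpace ℝ (Fin 1) → ℝ} (hη : IsTestFunction U η) (x : EuclideanSpace ℝ (Fin 1)) :
    ‖η x‖ₑ ≤ ∫⁻ y, ‖gradient η y‖ₑ := by
  let ι : ℝ ≃ₗᵢ[ℝ] EuclideanSpace ℝ (Fin 1) := (OrthonormalBasis.singleton (Fin 1) ℝ).repr
  have hs : ContDiff ℝ 1 (η ∘ ι) :=
    (hη.1.of_le (by norm_cast)).comp ι.toContinuousLinearEquiv.contDiff
  have hc : HasCompactSupport (η ∘ ι) :=
    hη.2.1.comp_homeomorph ι.toHomeomorph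
  have h1 := hc.enorm_le_lintegral_Ici_deriv hs (ι.symm x)
  simp only [Function.comp_apply, LinearIsometryEquiv.apply_symm_apply] at h1
  refine h1.trans ((setLIntegral_le_lintegral _ _).trans ?_)
  rw [← ι.measurePreserving.lintegral_comp_emb ι.toHomeomorph.measurableEmbedding]
  refine lintegral_mono fun t => ?_
  have h2 : HasDerivAt (η ∘ ι) (fderiv ℝ η (ι t) (ι 1)) t := by
    have h3 := ((hη.1.differentiable (by simp)) (ι t)).hasFDerivAt
    have h4 : HasDerivAt ι (ι 1) t := by
      have := (ι.toContinuousLinearEquiv : ℝ →L[ℝ] EuclideanSpace ℝ (Fin 1)).hasDerivAt (x := t)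
      simpa using this
    exact h3.comp_hasDerivAt t h4
  change ‖deriv (η ∘ ι) t‖ₑ ≤ _
  rw [h2.deriv, ← ofReal_norm, ← ofReal_norm]
  refine ENNReal.ofReal_le_ofReal ?_
  rw [norm_gradient_eq]
  refine ((fderiv ℝ η (ι t)).le_opNorm _).trans ?_
  simp

/-- Sobolev inequality on balls with the exponent `κ p`. -/
theorem sobolev_testFunction (hn : 1 ≤ n) {p : ℝ} (hp : 1 < p) :
    ∃ C : NNReal, ∀ (x₀ : 𝔼) (r : ℝ), 0 < r → ∀ η, IsTestFunction (Metric.ball x₀ r) η →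
      eLpNorm η (ENNReal.ofReal (kappa n p * p)) volume ≤
        C * ENNReal.ofReal (r ^ (1 - n * (1 - 1 / kappa n p) / p)) *
          eLpNorm (gradient η) (ENNReal.ofReal p) volume := by
  have hn0 : (1 : ℝ) ≤ n := by exact_mod_cast hn
  have hω : volume (Metric.ball (0 : 𝔼) 1) ≠ ⊤ := measure_ball_lt_top.ne
  by_cases hpn : p < n
  -- Here κp is the critical exponent np/(n - p), and the power of r is 0.
  · have hk : kappa n p = n / (n - p) := by simp [kappa, hpn]
    have hnp : (n : ℝ) - p ≠ 0 := by linarith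
    obtain ⟨C, hC⟩ := gagliardo_nirenberg_sobolev hn hp.le (p' := kappa n p * p)
      (by rw [hk]; have : 0 < (n : ℝ) - p := by linarith
          positivity)
      (by rw [hk]; field_simp)
    refine ⟨C, fun x₀ r hr η hη => ?_⟩
    have : 1 - n * (1 - 1 / kappa n p) / p = 0 := by
      rw [hk]; field_simp; ring
    rw [this]
    simpa using hC hη
  · have hk : kappa n p = 2 := by simp [kappa, hpn]
    rw [hk]
    push Not at hpn
    -- For n = 1 the auxiliary exponent used below would be less than 1, so this case uses the sup
    -- bound by ∫ |η'|, followed by Hölder's inequality.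
    rcases hn.eq_or_lt with h1 | h2
    · subst h1
      refine ⟨(volume (Metric.ball (0 : EuclideanSpace ℝ (Fin 1)) 1) ^ (1 / (2 * p)) *
        volume (Metric.ball (0 : EuclideanSpace ℝ (Fin 1)) 1) ^ (1 / 1 - 1 / p)).toNNReal,
        fun x₀ r hr η hη => ?_⟩
      rw [ENNReal.coe_toNNReal (ENNReal.mul_ne_top
        (ENNReal.rpow_ne_top_of_nonneg (by positivity) hω)
        (ENNReal.rpow_ne_top_of_nonneg (by
          rw [sub_nonneg]
          exact one_div_le_one_div_of_le one_pos hp.le) hω))]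
      have h3 := eLpNorm_ball_le_mul hr hη.gradient_eq_zero_of_notMem
        hη.continuous_gradient.aestronglyMeasurable one_pos hp.le
      have h4 : eLpNorm η (ENNReal.ofReal (2 * p)) volume ≤
          eLpNorm (gradient η) (ENNReal.ofReal 1) volume *
            volume (Metric.ball x₀ r) ^ (1 / (2 * p)) := by
        rw [← eLpNorm_restrict_of_zero_compl measurableSet_ball hη.eq_zero_of_notMem,
          ENNReal.ofReal_one, eLpNorm_one_eq_lintegral_enorm,
          eLpNorm_eq_lintegral_rpow_enorm_toReal (by simp; linarith) ENNReal.ofReal_ne_top,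
          ENNReal.toReal_ofReal (by linarith)]
        calc _ ≤ (∫⁻ _ in Metric.ball x₀ r, (∫⁻ y, ‖gradient η y‖ₑ) ^ (2 * p)) ^
              (1 / (2 * p)) := by
              gcongr with x
              exact hη.enorm_le_lintegral_gradient x
          _ = _ := by
              rw [setLIntegral_const, ENNReal.mul_rpow_of_nonneg _ _ (by positivity),
                ← ENNReal.rpow_mul, mul_one_div_cancel (by linarith), ENNReal.rpow_one]
      rw [volume_ball_rpow hr (by positivity)] at h4
      refine h4.trans ((mul_le_mul_left h3 _).trans (le_of_eq ?_))
      have h5 : r ^ (1 - ((1 : ℕ) : ℝ) * (1 - 1 / 2) / p) =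
          r ^ (((1 : ℕ) : ℝ) * (1 / 1 - 1 / p)) * r ^ (((1 : ℕ) : ℝ) * (1 / (2 * p))) := by
        rw [← Real.rpow_add hr]
        congr 1
        field_simp
        push_cast
        ring
      rw [h5, ENNReal.ofReal_mul (by positivity)]
      ring
    · have hn2 : (2 : ℝ) ≤ n := by exact_mod_cast h2
      -- The exponent whose Sobolev conjugate is 2p. It is at least 1 because n ≥ 2 and at most p
      -- because n ≤ p; Hölder on the ball then passes from L^q to L^p of the gradient.
      set q : ℝ := (n * (2 * p)) / (n + 2 * p) with hq
      have hq1 : 1 ≤ q := by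
        rw [hq, one_le_div (by positivity)]
        nlinarith
      have hqp : q ≤ p := by
        rw [hq, div_le_iff₀ (by positivity)]
        nlinarith
      have hqi : 1 / q = 1 / n + 1 / (2 * p) := by
        rw [hq]; field_simp; ring
      obtain ⟨C, hC⟩ := gagliardo_nirenberg_sobolev hn hq1 (p' := 2 * p) (by positivity)
        (by rw [← one_div q, hqi]; field_simp; ring)
      have he : 0 ≤ 1 / q - 1 / p := by
        rw [sub_nonneg]
        exact one_div_le_one_div_of_le (by positivity) hqp
      refine ⟨C * (volume (Metric.ball (0 : 𝔼) 1) ^ (1 / q - 1 / p)).toNNReal,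
        fun x₀ r hr η hη => ?_⟩
      rw [ENNReal.coe_mul, ENNReal.coe_toNNReal (ENNReal.rpow_ne_top_of_nonneg he hω)]
      have h3 := eLpNorm_ball_le_mul hr hη.gradient_eq_zero_of_notMem
        hη.continuous_gradient.aestronglyMeasurable (by linarith) hqp
      refine (hC hη).trans ((mul_le_mul_right h3 _).trans (le_of_eq ?_))
      have h5 : (n : ℝ) * (1 / q - 1 / p) = 1 - n * (1 - 1 / 2) / p := by
        rw [hqi]; field_simp; ring
      rw [h5]
      ring

/-- Convergence in L^p gives convergence in measure, under which the L^q norm is lower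
semicontinuous; φ need not be known to lie in L^q beforehand. -/
theorem IsSobolevLimit.eLpNorm_le {p q : ℝ} (hp : 1 ≤ p) {U : Set 𝔼}
    {φ : 𝔼 → ℝ} {H : 𝔼 → 𝔼} (h : IsSobolevLimit p U φ H)
    (hφ : AEStronglyMeasurable φ (volume.restrict U))
    (hH : AEStronglyMeasurable H (volume.restrict U)) {C : ENNReal} (hC : C ≠ ⊤)
    (hS : ∀ η, IsTestFunction U η → eLpNorm η (ENNReal.ofReal q) volume ≤
      C * eLpNorm (gradient η) (ENNReal.ofReal p) volume) (hU : MeasurableSet U) :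
    eLpNorm φ (ENNReal.ofReal q) (volume.restrict U) ≤
      C * eLpNorm H (ENNReal.ofReal p) (volume.restrict U) := by
  have hp1 : 1 ≤ ENNReal.ofReal p := by simpa using hp
  obtain ⟨η, hη, h1, h2⟩ := h.exists_seq
  have hm : TendstoInMeasure (volume.restrict U) η atTop φ :=
    tendstoInMeasure_of_tendsto_eLpNorm (by positivity)
      (fun k => (hη k).continuous.aestronglyMeasurable) hφ h1
  have key : ∀ ε : ENNReal, 0 < ε → eLpNorm φ (ENNReal.ofReal q) (volume.restrict U) ≤
      C * (ε + eLpNorm H (ENNReal.ofReal p) (volume.restrict U)) := by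
    intro ε hε
    refine eLpNorm_le_of_tendstoInMeasure ?_ hm
      (fun k => (hη k).continuous.aestronglyMeasurable)
    rw [ENNReal.tendsto_nhds_zero] at h2
    filter_upwards [h2 ε hε] with k hk
    rw [eLpNorm_restrict_of_zero_compl hU (hη k).eq_zero_of_notMem]
    refine (hS _ (hη k)).trans ?_
    rw [← eLpNorm_restrict_of_zero_compl hU (hη k).gradient_eq_zero_of_notMem]
    gcongr
    have h3 := eLpNorm_add_le ((hη k).continuous_gradient.aestronglyMeasurable.sub hH) hH hp1
    refine le_trans (le_of_eq ?_) (h3.trans (by gcongr; exact hk))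
    congr 1; ext1 x; simp
  have ht : Tendsto (fun ε : ENNReal => C * (ε + eLpNorm H (ENNReal.ofReal p)
      (volume.restrict U))) (𝓝[>] 0)
      (𝓝 (C * (0 + eLpNorm H (ENNReal.ofReal p) (volume.restrict U)))) := by
    refine Tendsto.mono_left ?_ nhdsWithin_le_nhds
    exact ENNReal.Tendsto.const_mul (tendsto_id.add tendsto_const_nhds) (Or.inr hC)
  rw [zero_add] at ht
  exact ge_of_tendsto ht (eventually_mem_nhdsWithin.mono fun ε hε => key ε hε)

/-! ### Cutoff functions and radial integrals -/

/-- The cutoff is the smooth transition of (b² - |x - x₀|²)/(b² - a²). Squared norms keep it smooth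
at the centre, and the gradient is controlled by 2b/(b² - a²) ≤ 2/(b - a). -/
theorem exists_cutoff (n : ℕ) : ∃ M : ℝ, 0 < M ∧ ∀ (x₀ : EuclideanSpace ℝ (Fin n)) (a b : ℝ),
    0 < a → a < b → ∃ ψ : EuclideanSpace ℝ (Fin n) → ℝ, ContDiff ℝ ∞ ψ ∧ (∀ x, 0 ≤ ψ x) ∧
      (∀ x, ψ x ≤ 1) ∧ (∀ x ∈ Metric.ball x₀ a, ψ x = 1) ∧
      tsupport ψ ⊆ Metric.closedBall x₀ b ∧ (∀ x, ‖gradient ψ x‖ ≤ M / (b - a)) ∧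
      ∀ x y, |ψ x - ψ y| ≤ M / (b - a) * ‖x - y‖ := by
  obtain ⟨M, hM0, hM⟩ := exists_abs_deriv_smoothTransition_le
  refine ⟨2 * M + 1, by linarith, fun x₀ a b ha hab => ?_⟩
  have hba : 0 < b ^ 2 - a ^ 2 := by nlinarith
  let q : EuclideanSpace ℝ (Fin n) → ℝ := fun x => (b ^ 2 - ‖x - x₀‖ ^ 2) / (b ^ 2 - a ^ 2)
  have hq : ContDiff ℝ ∞ q :=
    (contDiff_const.sub ((contDiff_id.sub contDiff_const).norm_sq ℝ)).div_const _
  have hψ : ContDiff ℝ ∞ fun x => Real.smoothTransition (q x) :=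
    Real.smoothTransition.contDiff.comp hq
  have hgrad : ∀ x, ‖gradient (fun x => Real.smoothTransition (q x)) x‖ ≤
      (2 * M + 1) / (b - a) := by
    intro x
    have h1 : HasFDerivAt q ((b ^ 2 - a ^ 2)⁻¹ •
        -((2 : ℕ) • (innerSL ℝ (x - x₀) : EuclideanSpace ℝ (Fin n) →L[ℝ] ℝ))) x := by
      have h2 : HasFDerivAt (fun x : EuclideanSpace ℝ (Fin n) => x - x₀)
        (ContinuousLinearMap.id ℝ _) x := (hasFDerivAt_id x).sub_const x₀
      have h3 := ((h2.norm_sq).const_sub (b ^ 2)).mul_const (b ^ 2 - a ^ 2)⁻¹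
      simpa only [q, div_eq_mul_inv, ContinuousLinearMap.comp_id] using h3
    have h4 : HasFDerivAt (fun x => Real.smoothTransition (q x)) _ x :=
      ((Real.smoothTransition.contDiff (n := 1)).differentiable (by simp)
        |>.differentiableAt (x := q x)).hasDerivAt.comp_hasFDerivAt x h1
    rw [norm_gradient_eq, h4.fderiv, norm_smul, norm_smul, norm_neg, ← Nat.cast_smul_eq_nsmul ℝ,
      norm_smul, innerSL_apply_norm, Real.norm_eq_abs, norm_inv, Real.norm_eq_abs,
      abs_of_pos hba]
    by_cases hs : q x ∈ Icc (0 : ℝ) 1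
    · have h5 : ‖x - x₀‖ ≤ b := by
        have h6 : 0 ≤ b ^ 2 - ‖x - x₀‖ ^ 2 := by
          by_contra h
          have : q x < 0 := div_neg_of_neg_of_pos (not_le.1 h) hba
          exact absurd hs.1 (not_le.2 this)
        exact abs_le_of_sq_le_sq' (by linarith) (by linarith) |>.2
      calc |deriv Real.smoothTransition (q x)| *
            ((b ^ 2 - a ^ 2)⁻¹ * (‖((2 : ℕ) : ℝ)‖ * ‖x - x₀‖)) ≤
            M * ((b ^ 2 - a ^ 2)⁻¹ * (2 * b)) := by
            have : ‖((2 : ℕ) : ℝ)‖ = 2 := by simp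
            rw [this]
            gcongr
            exact hM _
        _ ≤ (2 * M + 1) / (b - a) := by
            rw [show b ^ 2 - a ^ 2 = (b - a) * (b + a) by ring, le_div_iff₀ (by linarith)]
            have h7 : 0 < b - a := by linarith
            have h8 : 0 < b + a := by linarith
            have : M * (((b - a) * (b + a))⁻¹ * (2 * b)) * (b - a) = 2 * M * (b / (b + a)) := by
              field_simp
            rw [this]
            have h9 : b / (b + a) ≤ 1 := by rw [div_le_one h8]; linarith
            nlinarith
    · rw [deriv_smoothTransition_eq_zero hs]
      simp only [abs_zero, zero_mul]
      have : 0 < b - a := by linarith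
      positivity
  refine ⟨fun x => Real.smoothTransition (q x), hψ, fun x => Real.smoothTransition.nonneg _,
    fun x => Real.smoothTransition.le_one _, fun x hx => ?_, ?_, hgrad, fun x y => ?_⟩
  · refine Real.smoothTransition.one_of_one_le ?_
    rw [Metric.mem_ball, dist_eq_norm] at hx
    rw [one_le_div hba]
    nlinarith [norm_nonneg (x - x₀)]
  · refine closure_minimal (fun x hx => ?_) Metric.isClosed_closedBall
    by_contra h
    rw [Metric.mem_closedBall, dist_eq_norm, not_le] at h
    refine hx (Real.smoothTransition.zero_of_nonpos ?_)
    refine div_nonpos_of_nonpos_of_nonneg ?_ hba.le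
    nlinarith
  · have := Convex.norm_image_sub_le_of_norm_fderiv_le (𝕜 := ℝ)
      (f := fun x => Real.smoothTransition (q x)) (s := univ) (C := (2 * M + 1) / (b - a))
      (fun x _ => (hψ.differentiable (by simp)).differentiableAt)
      (fun x _ => by rw [← norm_gradient_eq]; exact hgrad x) convex_univ (mem_univ y) (mem_univ x)
    simpa using this

theorem gradient_pow {ψ : 𝔼 → ℝ} {x : 𝔼} (hψ : DifferentiableAt ℝ ψ x) (m : ℕ) :
    gradient (fun y => ψ y ^ m) x = ((m : ℝ) * ψ x ^ (m - 1)) • gradient ψ x := by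
  have h : HasFDerivAt (fun y => ψ y ^ m) (((m : ℝ) * ψ x ^ (m - 1)) • fderiv ℝ ψ x) x := by
    have := ((hasDerivAt_pow m (ψ x)).comp_hasFDerivAt x hψ.hasFDerivAt)
    exact this
  rw [gradient, h.fderiv, map_smul]
  rfl

/-- Polar coordinates. The exponent of interest is e = p - (n + ps), where n + e = p(1 - s) is
positive because s < 1. -/
theorem lintegral_ball_rpow_norm (hn : 1 ≤ n) {e : ℝ} (he : 0 < n + e) :
    ∃ C : ℝ, 0 < C ∧ ∀ (x : 𝔼) (R : ℝ), 0 < R →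
      ∫⁻ y in Metric.ball x R, ENNReal.ofReal (‖x - y‖ ^ e) ≤ ENNReal.ofReal (C * R ^ (n + e)) := by
  have : Nonempty (Fin n) := ⟨⟨0, hn⟩⟩
  refine ⟨n * (volume (Metric.ball (0 : 𝔼) 1)).toReal / (n + e) + 1, by positivity,
    fun x R hR => ?_⟩
  have hint : IntegrableOn (fun z : 𝔼 => ‖z‖ ^ e) (Metric.ball 0 R) volume := by
    rw [integrableOn_fun_norm_addHaar volume (f := fun t : ℝ => t ^ e)]
    have h1 : IntegrableOn (fun t : ℝ => t ^ ((n : ℝ) - 1 + e)) (Ioo 0 R) := by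
      rw [intervalIntegral.integrableOn_Ioo_rpow_iff hR]
      linarith
    refine h1.congr_fun (fun t ht => ?_) measurableSet_Ioo
    simp only [finrank_euclideanSpace, Fintype.card_fin, smul_eq_mul]
    rw [← Real.rpow_natCast, ← Real.rpow_add ht.1, Nat.cast_sub hn]
    simp
  have h2 : ∫⁻ y in Metric.ball x R, ENNReal.ofReal (‖x - y‖ ^ e) =
      ∫⁻ z in Metric.ball (0 : 𝔼) R, ENNReal.ofReal (‖z‖ ^ e) := by
    rw [← lintegral_indicator measurableSet_ball, ← lintegral_indicator measurableSet_ball]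
    rw [← lintegral_sub_left_eq_self _ x]
    refine lintegral_congr fun y => ?_
    simp [indicator, dist_eq_norm]
  rw [h2, ← ofReal_integral_eq_lintegral_ofReal hint
    (Eventually.of_forall fun z => by positivity)]
  refine ENNReal.ofReal_le_ofReal ?_
  have h3 : ∫ z in Metric.ball (0 : 𝔼) R, ‖z‖ ^ e =
      n * (volume (Metric.ball (0 : 𝔼) 1)).toReal / (n + e) * R ^ (n + e) := by
    have h4 : ∫ z in Metric.ball (0 : 𝔼) R, ‖z‖ ^ e =
        ∫ z : 𝔼, (Iio R).indicator (fun t : ℝ => t ^ e) ‖z‖ := by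
      rw [← integral_indicator measurableSet_ball]
      refine integral_congr_ae (Eventually.of_forall fun z => ?_)
      simp [indicator]
    rw [h4, integral_fun_norm_addHaar volume]
    have h5 : ∫ t in Ioi (0 : ℝ), t ^ (Module.finrank ℝ 𝔼 - 1) •
        (Iio R).indicator (fun t : ℝ => t ^ e) t = R ^ (n + e) / (n + e) := by
      have h6 : ∫ t in Ioi (0 : ℝ), t ^ (Module.finrank ℝ 𝔼 - 1) •
          (Iio R).indicator (fun t : ℝ => t ^ e) t =
          ∫ t in Ioo (0 : ℝ) R, t ^ ((n : ℝ) - 1 + e) := by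
        rw [← integral_indicator measurableSet_Ioi, ← integral_indicator measurableSet_Ioo]
        refine integral_congr_ae (Eventually.of_forall fun t => ?_)
        by_cases h0 : 0 < t
        · by_cases h7 : t < R
          · simp only [indicator, mem_Ioi, h0, mem_Iio, h7, mem_Ioo, and_self, if_true,
              finrank_euclideanSpace, Fintype.card_fin, smul_eq_mul]
            rw [← Real.rpow_natCast, ← Real.rpow_add h0, Nat.cast_sub hn]
            simp
          · simp [indicator, h0, h7]
        · simp [indicator, h0]
      rw [h6, ← integral_Ioc_eq_integral_Ioo, ← intervalIntegral.integral_of_le hR.le,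
        integral_rpow (Or.inl (by linarith)), Real.zero_rpow (by linarith)]
      ring_nf
    rw [h5]
    simp [Measure.real, nsmul_eq_mul]
    ring
  rw [h3, add_mul]
  have : 0 ≤ 1 * R ^ (n + e) := by positivity
  linarith

theorem integrableOn_compl_ball_rpow_norm (hn : 1 ≤ n) {e : ℝ} (he : n < e) (x₀ : 𝔼) {R : ℝ}
    (hR : 0 < R) : IntegrableOn (fun y => 1 / ‖y - x₀‖ ^ e) (Metric.ball x₀ R)ᶜ volume := by
  have : Nonempty (Fin n) := ⟨⟨0, hn⟩⟩
  have h1 : Integrable (fun z : 𝔼 => (Ici R).indicator (fun t : ℝ => 1 / t ^ e) ‖z‖) volume := by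
    rw [integrable_fun_norm_addHaar volume]
    have h2 : IntegrableOn (fun t : ℝ => t ^ ((n : ℝ) - 1 - e)) (Ici R) := by
      rw [integrableOn_Ici_iff_integrableOn_Ioi]
      exact integrableOn_Ioi_rpow_of_lt (by linarith) hR
    have h3 := (integrable_indicator_iff measurableSet_Ici).2 h2
    refine h3.integrableOn.congr_fun (fun t ht => ?_) measurableSet_Ioi
    rw [mem_Ioi] at ht
    by_cases h4 : R ≤ t
    · simp only [indicator, mem_Ici, h4, if_true, finrank_euclideanSpace, Fintype.card_fin,
        smul_eq_mul]
      rw [Real.rpow_sub ht, Real.rpow_sub_one ht.ne', Real.rpow_natCast]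
      rw [← pow_sub_one_mul (by omega : n ≠ 0) t]
      field_simp
    · simp [indicator, h4]
  have h5 := h1.comp_sub_right x₀
  rw [← integrable_indicator_iff measurableSet_ball.compl]
  refine h5.congr (Eventually.of_forall fun y => ?_)
  simp [indicator, dist_eq_norm]

/-! ### Lower bound for the nonlocal energy -/

/-- The integrand of the nonlocal energy. -/
noncomputable def nonlocalIntegrand (p : ℝ) (K : 𝔼 → 𝔼 → ℝ) (u φ : 𝔼 → ℝ) (x y : 𝔼) : ℝ :=
  |u x - u y| ^ (p - 2) * (u x - u y) * (φ x - φ y) * K x y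

theorem nonlocalIntegrand_comm {p s Λ : ℝ} {K : 𝔼 → 𝔼 → ℝ} (hK : IsAdmissibleKernel p s Λ K)
    (u φ : 𝔼 → ℝ) (x y : 𝔼) : nonlocalIntegrand p K u φ x y = nonlocalIntegrand p K u φ y x := by
  unfold nonlocalIntegrand
  rw [abs_sub_comm, hK.2.1 x y]
  ring

theorem IsAdmissibleKernel.nonneg {p s Λ : ℝ} {K : 𝔼 → 𝔼 → ℝ} (hK : IsAdmissibleKernel p s Λ K)
    (hΛ : 1 ≤ Λ) {x y : 𝔼} (hxy : x ≠ y) : 0 ≤ K x y :=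
  le_trans (by positivity) (hK.2.2 x y hxy).1

section Pointwise

variable {p s Λ : ℝ} {K : EuclideanSpace ℝ (Fin n) → EuclideanSpace ℝ (Fin n) → ℝ}
  {u ψ : EuclideanSpace ℝ (Fin n) → ℝ} {ℓ L b ρ : ℝ} {m : ℕ} {x₀ : EuclideanSpace ℝ (Fin n)}

theorem neg_nonlocalIntegrand_le_of_mem (hp : 1 < p) (hΛ : 1 ≤ Λ)
    (hK : IsAdmissibleKernel p s Λ K) (hm : p ≤ m) (hψ0 : ∀ x, 0 ≤ ψ x) (hψ1 : ∀ x, ψ x ≤ 1)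
    (hL : 0 ≤ L) (hψL : ∀ x y, |ψ x - ψ y| ≤ L * ‖x - y‖) {x y : 𝔼} (hxy : x ≠ y) :
    -nonlocalIntegrand p K u (fun x => max (u x - ℓ) 0 * ψ x ^ m) x y ≤
      (max (u x - ℓ) 0) ^ p * ((2 * m) ^ p * L ^ p * Λ * ‖x - y‖ ^ (p - (n + p * s))) +
      (max (u y - ℓ) 0) ^ p * ((2 * m) ^ p * L ^ p * Λ * ‖x - y‖ ^ (p - (n + p * s))) := by
  have hd : 0 < ‖x - y‖ := norm_pos_iff.2 (sub_ne_zero.2 hxy)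
  have h1 := nonlocal_integrand_ge hp hm (a := u x) (b := u y) (ℓ := ℓ)
    (hψ0 x) (hψ1 x) (hψ0 y) (hψ1 y)
  have hK0 := hK.nonneg hΛ hxy
  have h2 := mul_le_mul_of_nonneg_right h1 hK0
  have h3 : |ψ x - ψ y| ^ p ≤ L ^ p * ‖x - y‖ ^ p := by
    rw [← Real.mul_rpow hL hd.le]
    exact Real.rpow_le_rpow (abs_nonneg _) (hψL x y) (by linarith)
  have h4 : 0 ≤ (max (u x - ℓ) 0) ^ p + (max (u y - ℓ) 0) ^ p := by positivity
  unfold nonlocalIntegrand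
  calc _ ≤ (2 * m) ^ p * (((max (u x - ℓ) 0) ^ p + (max (u y - ℓ) 0) ^ p) * |ψ x - ψ y| ^ p) *
        K x y := by linarith
    _ ≤ (2 * m) ^ p * (((max (u x - ℓ) 0) ^ p + (max (u y - ℓ) 0) ^ p) *
        (L ^ p * ‖x - y‖ ^ p)) * (Λ / ‖x - y‖ ^ ((n : ℝ) + p * s)) := by
        gcongr
        exact (hK.2.2 x y hxy).2
    _ = _ := by
        rw [Real.rpow_sub hd]
        ring

/-- For x in the support ball of radius b and y outside the ball of radius ρ, |y - x₀| ≤ ρ/(ρ - b)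
|x - y|. This replaces the kernel by the weight of the tail, centred at x₀. -/
theorem neg_nonlocalIntegrand_le_of_notMem (hp : 1 < p) (hs : 0 < s) (hΛ : 1 ≤ Λ)
    (hK : IsAdmissibleKernel p s Λ K) (hm : p ≤ m) (hψ0 : ∀ x, 0 ≤ ψ x) (hψ1 : ∀ x, ψ x ≤ 1)
    (hb : b < ρ) (hρ : 0 < ρ) (hψb : ∀ x, x ∉ Metric.closedBall x₀ b → ψ x = 0) (hℓ : 0 ≤ ℓ)
    {x y : 𝔼} (hxy : x ≠ y) (hy : y ∉ Metric.ball x₀ ρ) :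
    -nonlocalIntegrand p K u (fun x => max (u x - ℓ) 0 * ψ x ^ m) x y ≤
      max (u x - ℓ) 0 * (Λ * (ρ / (ρ - b)) ^ (n + p * s) *
        (|max (u y) 0| ^ (p - 1) / ‖y - x₀‖ ^ ((n : ℝ) + p * s))) := by
  have hm0 : m ≠ 0 := by
    rintro rfl
    norm_num at hm
    linarith
  have hyb : y ∉ Metric.closedBall x₀ b := fun h => hy (Metric.closedBall_subset_ball hb h)
  have hK0 := hK.nonneg hΛ hxy
  have hρb : 0 < ρ - b := by linarith
  have hw : 0 ≤ max (u x - ℓ) 0 := le_max_right _ _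
  unfold nonlocalIntegrand
  simp only [hψb y hyb, zero_pow hm0, mul_zero, sub_zero]
  by_cases hx : x ∈ Metric.closedBall x₀ b
  · have h1 := nonlocal_integrand_ge_of_zero hp (a := u x) (b := u y) (ℓ := ℓ)
      (pow_nonneg (hψ0 x) m) (pow_le_one₀ (hψ0 x) (hψ1 x))
    have h2 := mul_le_mul_of_nonneg_right h1 hK0
    rw [Metric.mem_closedBall, dist_eq_norm] at hx
    rw [Metric.mem_ball, dist_eq_norm, not_lt] at hy
    have hy0 : 0 < ‖y - x₀‖ := hρ.trans_le hy
    have hd : 0 < ‖x - y‖ := norm_pos_iff.2 (sub_ne_zero.2 hxy)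
    have h3 : ‖y - x₀‖ ≤ ρ / (ρ - b) * ‖x - y‖ := by
      have h4 : ‖y - x₀‖ ≤ ‖x - y‖ + ‖x - x₀‖ := by
        rw [norm_sub_rev x y]
        simpa using norm_add_le (y - x) (x - x₀)
      rw [div_mul_eq_mul_div, le_div_iff₀ hρb]
      -- If b < 0 the closed ball is empty, contradicting `hx`.
      have h5 : ‖y - x₀‖ * (ρ - b) ≤ ‖y - x₀‖ * ρ - ρ * b ∨ b < 0 := by
        by_cases hb0 : b < 0
        · exact Or.inr hb0
        · left
          nlinarith
      rcases h5 with h5 | h5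
      · nlinarith
      · linarith [norm_nonneg (x - x₀)]
    have hE : 0 ≤ (n : ℝ) + p * s := by positivity
    have h6 : K x y ≤ Λ * (ρ / (ρ - b)) ^ (n + p * s) / ‖y - x₀‖ ^ ((n : ℝ) + p * s) := by
      refine (hK.2.2 x y hxy).2.trans ?_
      rw [div_le_div_iff₀ (by positivity) (by positivity), mul_assoc,
        ← Real.mul_rpow (by positivity) hd.le]
      gcongr
    have h7 : (max (u y - ℓ) 0) ^ (p - 1) ≤ |max (u y) 0| ^ (p - 1) := by
      rw [abs_of_nonneg (le_max_right _ _)]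
      refine Real.rpow_le_rpow (le_max_right _ _) ?_ (by linarith)
      exact max_le_max (by linarith) le_rfl
    calc _ ≤ (max (u y - ℓ) 0) ^ (p - 1) * max (u x - ℓ) 0 * K x y := by linarith
      _ ≤ |max (u y) 0| ^ (p - 1) * max (u x - ℓ) 0 *
          (Λ * (ρ / (ρ - b)) ^ (n + p * s) / ‖y - x₀‖ ^ ((n : ℝ) + p * s)) := by
          gcongr
      _ = _ := by ring
  · rw [hψb x hx, zero_pow hm0]
    simp only [mul_zero, zero_mul, neg_zero]
    have : 0 ≤ ρ / (ρ - b) := by positivity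
    positivity

/-- Lower bound of the nonlocal energy tested with `(u - ℓ)₊ ψ ^ m`. -/
theorem neg_le_nonlocal_energy (hn : 1 ≤ n) (hp : 1 < p) (hs : 0 < s) (hΛ : 1 ≤ Λ)
    (hK : IsAdmissibleKernel p s Λ K) (hm : p ≤ m) (hψ0 : ∀ x, 0 ≤ ψ x) (hψ1 : ∀ x, ψ x ≤ 1)
    (hb : b < ρ) (hρ : 0 < ρ) (hψb : ∀ x, x ∉ Metric.closedBall x₀ b → ψ x = 0) (hℓ : 0 ≤ ℓ)
    (hL : 0 ≤ L) (hψL : ∀ x y, |ψ x - ψ y| ≤ L * ‖x - y‖) (hu : AEMeasurable u volume)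
    {C : ℝ} (hC : ∀ (x : 𝔼) (R : ℝ), 0 < R → ∫⁻ y in Metric.ball x R,
      ENNReal.ofReal (‖x - y‖ ^ (p - (n + p * s))) ≤
        ENNReal.ofReal (C * R ^ (n + (p - (n + p * s))))) (hC0 : 0 ≤ C)
    (hw : IntegrableOn (fun x => max (u x - ℓ) 0) (Metric.ball x₀ ρ) volume)
    (hwp : IntegrableOn (fun x => (max (u x - ℓ) 0) ^ p) (Metric.ball x₀ ρ) volume)
    {R : ℝ} (hR : R ≤ ρ) (hT : IntegrableOn
      (fun y => |max (u y) 0| ^ (p - 1) / ‖y - x₀‖ ^ ((n : ℝ) + p * s))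
      (Metric.ball x₀ R)ᶜ volume) :
    -(2 * ((∫ x in Metric.ball x₀ ρ, (max (u x - ℓ) 0) ^ p) *
        ((2 * m) ^ p * L ^ p * Λ * (C * (2 * ρ) ^ (p - p * s)))) +
      2 * ((∫ x in Metric.ball x₀ ρ, max (u x - ℓ) 0) * (Λ * (ρ / (ρ - b)) ^ (n + p * s) *
        ∫ y in (Metric.ball x₀ R)ᶜ, |max (u y) 0| ^ (p - 1) / ‖y - x₀‖ ^ ((n : ℝ) + p * s)))) ≤
      ∫ x, ∫ y, nonlocalIntegrand p K u (fun x => max (u x - ℓ) 0 * ψ x ^ m) x y := by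
  have : Nonempty (Fin n) := ⟨⟨0, hn⟩⟩
  have hρb : 0 < ρ - b := by linarith
  have hρb' : 0 ≤ ρ / (ρ - b) := by positivity
  set B := Metric.ball x₀ ρ with hB
  have hBm : MeasurableSet B := measurableSet_ball
  set c₁ : ℝ := (2 * m) ^ p * L ^ p * Λ with hc₁
  set c₂ : ℝ := Λ * (ρ / (ρ - b)) ^ (n + p * s) with hc₂
  have hc₁0 : 0 ≤ c₁ := by positivity
  have hc₂0 : 0 ≤ c₂ := by positivity
  set g : 𝔼 → ℝ := fun y => |max (u y) 0| ^ (p - 1) / ‖y - x₀‖ ^ ((n : ℝ) + p * s) with hg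
  have hg0 : ∀ y, 0 ≤ g y := fun y => by positivity
  have hwm : AEMeasurable (fun x => max (u x - ℓ) 0) volume :=
    (hu.sub aemeasurable_const).max aemeasurable_const
  -- F₁ majorizes pairs inside B and F₂ pairs with exactly the second point outside. Symmetrizing
  -- both covers every off-diagonal pair, since the integrand vanishes when both points are outside.
  let F₁ : 𝔼 → 𝔼 → ENNReal := fun x y =>
    B.indicator (fun x => ENNReal.ofReal ((max (u x - ℓ) 0) ^ p)) x *
      B.indicator (fun y => ENNReal.ofReal (c₁ * ‖x - y‖ ^ (p - (n + p * s)))) y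
  let F₂ : 𝔼 → 𝔼 → ENNReal := fun x y =>
    B.indicator (fun x => ENNReal.ofReal (max (u x - ℓ) 0)) x *
      Bᶜ.indicator (fun y => ENNReal.ofReal (c₂ * g y)) y
  have hpt : ∀ x y, x ≠ y → ENNReal.ofReal
      (-nonlocalIntegrand p K u (fun x => max (u x - ℓ) 0 * ψ x ^ m) x y) ≤
      (F₁ x y + F₁ y x) + (F₂ x y + F₂ y x) := by
    intro x y hxy
    by_cases hx : x ∈ B <;> by_cases hy : y ∈ B
    · refine le_trans ?_ le_self_add
      simp only [F₁, indicator_of_mem hx, indicator_of_mem hy]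
      rw [norm_sub_rev y x, ← ENNReal.ofReal_mul (by positivity),
        ← ENNReal.ofReal_mul (by positivity), ← ENNReal.ofReal_add (by positivity) (by positivity)]
      exact ENNReal.ofReal_le_ofReal
        (neg_nonlocalIntegrand_le_of_mem hp hΛ hK hm hψ0 hψ1 hL hψL hxy)
    · refine le_trans ?_ (le_add_of_nonneg_left zero_le)
      refine le_trans ?_ le_self_add
      simp only [F₂, indicator_of_mem hx, indicator_of_mem (mem_compl hy)]
      rw [← ENNReal.ofReal_mul (le_max_right _ _)]
      exact ENNReal.ofReal_le_ofReal (neg_nonlocalIntegrand_le_of_notMem hp hs hΛ hK hm hψ0 hψ1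
        hb hρ hψb hℓ hxy hy)
    · refine le_trans ?_ (le_add_of_nonneg_left zero_le)
      refine le_trans ?_ le_add_self
      simp only [F₂, indicator_of_mem hy, indicator_of_mem (mem_compl hx)]
      rw [← ENNReal.ofReal_mul (le_max_right _ _), nonlocalIntegrand_comm hK]
      exact ENNReal.ofReal_le_ofReal (neg_nonlocalIntegrand_le_of_notMem hp hs hΛ hK hm hψ0 hψ1
        hb hρ hψb hℓ hxy.symm hx)
    · have hm0 : m ≠ 0 := by
        rintro rfl
        norm_num at hm
        linarith
      have hx' : ψ x = 0 := hψb x fun h => hx (Metric.closedBall_subset_ball hb h)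
      have hy' : ψ y = 0 := hψb y fun h => hy (Metric.closedBall_subset_ball hb h)
      simp [nonlocalIntegrand, hx', hy', hm0]
  have hfst : AEMeasurable (fun z : 𝔼 × 𝔼 => u z.1) (volume.prod volume) :=
    hu.comp_quasiMeasurePreserving Measure.quasiMeasurePreserving_fst
  have hsnd : AEMeasurable (fun z : 𝔼 × 𝔼 => u z.2) (volume.prod volume) :=
    hu.comp_quasiMeasurePreserving Measure.quasiMeasurePreserving_snd
  have hF₁m : AEMeasurable (Function.uncurry F₁) (volume.prod volume) := by
    have h1 : AEMeasurable (B.indicator fun x => ENNReal.ofReal ((max (u x - ℓ) 0) ^ p)) volume :=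
      ((hwm.pow_const p).ennreal_ofReal).indicator hBm
    have h2 : Measurable fun z : 𝔼 × 𝔼 =>
        (univ ×ˢ B).indicator (fun z : 𝔼 × 𝔼 =>
          ENNReal.ofReal (c₁ * ‖z.1 - z.2‖ ^ (p - (n + p * s)))) z :=
      Measurable.indicator (by fun_prop) (MeasurableSet.univ.prod hBm)
    refine ((h1.comp_quasiMeasurePreserving Measure.quasiMeasurePreserving_fst).mul
      h2.aemeasurable).congr (Eventually.of_forall fun z => ?_)
    obtain ⟨x, y⟩ := z
    by_cases hy : y ∈ B
    · simp [F₁, Function.uncurry, hy]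
    · simp [F₁, Function.uncurry, hy]
  have hgm : AEMeasurable g volume := by
    have h1 : AEMeasurable (fun y => |max (u y) 0| ^ (p - 1)) volume :=
      ((hu.max aemeasurable_const).abs).pow_const _
    have h2 : Measurable fun y : 𝔼 => ‖y - x₀‖ ^ ((n : ℝ) + p * s) := by fun_prop
    exact h1.div h2.aemeasurable
  have hF₂m : AEMeasurable (Function.uncurry F₂) (volume.prod volume) := by
    have h1 : AEMeasurable (B.indicator fun x => ENNReal.ofReal (max (u x - ℓ) 0)) volume :=
      (hwm.ennreal_ofReal).indicator hBm
    have h2 : AEMeasurable (Bᶜ.indicator fun y => ENNReal.ofReal (c₂ * g y)) volume :=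
      ((hgm.const_mul c₂).ennreal_ofReal).indicator hBm.compl
    exact (h1.comp_quasiMeasurePreserving Measure.quasiMeasurePreserving_fst).mul
      (h2.comp_quasiMeasurePreserving Measure.quasiMeasurePreserving_snd)
  have hI₁ : ∫⁻ x, ∫⁻ y, F₁ x y ≤ ENNReal.ofReal ((∫ x in B, (max (u x - ℓ) 0) ^ p) *
      (c₁ * (C * (2 * ρ) ^ (p - p * s)))) := by
    have h1 : ∀ x, ∫⁻ y, F₁ x y ≤
        B.indicator (fun x => ENNReal.ofReal ((max (u x - ℓ) 0) ^ p)) x *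
          ENNReal.ofReal (c₁ * (C * (2 * ρ) ^ (p - p * s))) := by
      intro x
      by_cases hx : x ∈ B
      · simp only [F₁]
        rw [lintegral_const_mul' _ _ (by simp [indicator_of_mem hx])]
        gcongr
        rw [lintegral_indicator hBm]
        simp only [ENNReal.ofReal_mul hc₁0]
        rw [lintegral_const_mul' _ _ ENNReal.ofReal_ne_top]
        gcongr
        -- For x in B, the ball B lies in the ball of radius 2ρ around x.
        have h2 := hC x (2 * ρ) (by linarith)
        rw [show (n : ℝ) + (p - (n + p * s)) = p - p * s by ring] at h2
        refine le_trans (lintegral_mono_set fun y hy => ?_) h2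
        rw [Metric.mem_ball] at hx hy ⊢
        calc dist y x ≤ dist y x₀ + dist x x₀ := dist_triangle_right _ _ _
          _ < 2 * ρ := by linarith
      · simp [F₁, indicator_of_notMem hx]
    refine (lintegral_mono h1).trans (le_of_eq ?_)
    rw [lintegral_mul_const' _ _ ENNReal.ofReal_ne_top, lintegral_indicator hBm,
      ← ofReal_integral_eq_lintegral_ofReal hwp (Eventually.of_forall fun x => by positivity),
      ← ENNReal.ofReal_mul (integral_nonneg fun x => by positivity)]
  have hI₂ : ∫⁻ x, ∫⁻ y, F₂ x y ≤ ENNReal.ofReal ((∫ x in B, max (u x - ℓ) 0) *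
      (c₂ * ∫ y in (Metric.ball x₀ R)ᶜ, g y)) := by
    have h0 : ∫⁻ y, Bᶜ.indicator (fun y => ENNReal.ofReal (c₂ * g y)) y ≤
        ENNReal.ofReal (c₂ * ∫ y in (Metric.ball x₀ R)ᶜ, g y) := by
      rw [lintegral_indicator hBm.compl]
      simp only [ENNReal.ofReal_mul hc₂0]
      rw [lintegral_const_mul' _ _ ENNReal.ofReal_ne_top]
      gcongr
      rw [ofReal_integral_eq_lintegral_ofReal hT (Eventually.of_forall hg0)]
      exact lintegral_mono_set (compl_subset_compl.2 (Metric.ball_subset_ball hR))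
    have h1 : ∀ x, ∫⁻ y, F₂ x y ≤
        B.indicator (fun x => ENNReal.ofReal (max (u x - ℓ) 0)) x *
          ENNReal.ofReal (c₂ * ∫ y in (Metric.ball x₀ R)ᶜ, g y) := by
      intro x
      by_cases hx : x ∈ B
      · simp only [F₂]
        rw [lintegral_const_mul' _ _ (by simp [indicator_of_mem hx])]
        gcongr
      · simp [F₂, indicator_of_notMem hx]
    refine (lintegral_mono h1).trans (le_of_eq ?_)
    rw [lintegral_mul_const' _ _ ENNReal.ofReal_ne_top, lintegral_indicator hBm,
      ← ofReal_integral_eq_lintegral_ofReal hw (Eventually.of_forall fun x => le_max_right _ _),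
      ← ENNReal.ofReal_mul (integral_nonneg fun x => (le_max_right _ _ : 0 ≤ max (u x - ℓ) 0))]
  set A₁ := (∫ x in B, (max (u x - ℓ) 0) ^ p) * (c₁ * (C * (2 * ρ) ^ (p - p * s)))
  set A₂ := (∫ x in B, max (u x - ℓ) 0) * (c₂ * ∫ y in (Metric.ball x₀ R)ᶜ, g y)
  have hA₁ : 0 ≤ A₁ := mul_nonneg (integral_nonneg fun x => by positivity) (by positivity)
  have hA₂ : 0 ≤ A₂ := mul_nonneg (integral_nonneg fun x => le_max_right _ _)
    (mul_nonneg hc₂0 (integral_nonneg hg0))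
  clear_value A₁ A₂
  have hswap : ∀ {F : 𝔼 → 𝔼 → ENNReal}, AEMeasurable (Function.uncurry F) (volume.prod volume) →
      ∫⁻ x, ∫⁻ y, (F x y + F y x) = 2 * ∫⁻ x, ∫⁻ y, F x y := by
    intro F hF
    have hF₀ : AEMeasurable (fun z : 𝔼 × 𝔼 => F z.1 z.2) (volume.prod volume) := hF
    have hF' : AEMeasurable (fun z : 𝔼 × 𝔼 => F z.2 z.1) (volume.prod volume) := hF.prod_swap
    rw [lintegral_lintegral (f := fun x y => F x y + F y x) (hF.add hF'),
      lintegral_add_left' hF₀, two_mul, lintegral_lintegral hF]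
    congr 1
    rw [← lintegral_lintegral (f := fun x y => F y x) hF', lintegral_lintegral_swap hF',
      lintegral_lintegral hF]
  have htot : ∫⁻ x, ∫⁻ y, ((F₁ x y + F₁ y x) + (F₂ x y + F₂ y x)) ≤
      ENNReal.ofReal (2 * A₁ + 2 * A₂) := by
    have hG₁ : AEMeasurable (fun z : 𝔼 × 𝔼 => F₁ z.1 z.2 + F₁ z.2 z.1) (volume.prod volume) :=
      hF₁m.add hF₁m.prod_swap
    have hG₂ : AEMeasurable (fun z : 𝔼 × 𝔼 => F₂ z.1 z.2 + F₂ z.2 z.1) (volume.prod volume) :=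
      hF₂m.add hF₂m.prod_swap
    rw [lintegral_lintegral (f := fun x y => (F₁ x y + F₁ y x) + (F₂ x y + F₂ y x))
      (hG₁.add hG₂), lintegral_add_left' hG₁,
      ← lintegral_lintegral (f := fun x y => F₁ x y + F₁ y x) hG₁,
      ← lintegral_lintegral (f := fun x y => F₂ x y + F₂ y x) hG₂, hswap hF₁m, hswap hF₂m,
      ENNReal.ofReal_add (by positivity) (by positivity), ENNReal.ofReal_mul (by norm_num),
      ENNReal.ofReal_mul (by norm_num), ENNReal.ofReal_ofNat]
    gcongr
  have hne : ∫⁻ x, ∫⁻ y, ((F₁ x y + F₁ y x) + (F₂ x y + F₂ y x)) ≠ ⊤ :=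
    (htot.trans_lt ENNReal.ofReal_lt_top).ne
  refine le_trans (neg_le_neg ?_) (neg_toReal_lintegral_lintegral_le_integral
    (Eventually.of_forall fun x => ?_) hne)
  · exact ENNReal.toReal_le_of_le_ofReal (by positivity) htot
  -- The pointwise bound excludes the diagonal, which is a null set in y for each x.
  · filter_upwards [(measure_eq_zero_iff_ae_notMem (μ := volume)).1 (measure_singleton x)] with y hy
    exact hpt x y fun h => hy h.symm

end Pointwise

/-! ### Integrability, Caccioppoli inequality and gain of integrability -/

theorem exists_ae_abs_le {u : 𝔼 → ℝ} (hu : MemLp u ⊤ volume) :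
    ∃ M : ℝ, 0 ≤ M ∧ ∀ᵐ x ∂volume, |u x| ≤ M := by
  have h := hu.2
  rw [eLpNorm_exponent_top] at h
  refine ⟨(eLpNormEssSup u volume).toReal, ENNReal.toReal_nonneg, ?_⟩
  filter_upwards [enorm_ae_le_eLpNormEssSup u volume] with x hx
  have := ENNReal.toReal_mono h.ne hx
  simpa using this

theorem integrableOn_ball_posPart_rpow {u : 𝔼 → ℝ} (hu : MemLp u ⊤ volume) {k q : ℝ} (hk : 0 ≤ k)
    (hq : 0 ≤ q) (x₀ : 𝔼) (ρ : ℝ) :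
    IntegrableOn (fun x => (max (u x - k) 0) ^ q) (Metric.ball x₀ ρ) volume := by
  obtain ⟨M, hM0, hM⟩ := exists_ae_abs_le hu
  refine Measure.integrableOn_of_bounded (M := M ^ q) measure_ball_lt_top.ne ?_ ?_
  · exact (((hu.1.aemeasurable.sub aemeasurable_const).max
      aemeasurable_const).pow_const q).aestronglyMeasurable
  · refine ae_restrict_of_ae ?_
    filter_upwards [hM] with x hx
    rw [Real.norm_eq_abs, abs_of_nonneg (by positivity)]
    refine Real.rpow_le_rpow (le_max_right _ _) (max_le ?_ hM0) hq
    linarith [le_abs_self (u x)]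

/-- Boundedness of u makes the tail a genuine finite integral, not the default value 0 of a
divergent one. -/
theorem integrableOn_tail {u : 𝔼 → ℝ} (hn : 1 ≤ n) {p s : ℝ} (hp : 1 < p) (hs : 0 < s)
    (hu : MemLp u ⊤ volume) (x₀ : 𝔼) {R : ℝ} (hR : 0 < R) :
    IntegrableOn (fun y => |max (u y) 0| ^ (p - 1) / ‖y - x₀‖ ^ ((n : ℝ) + p * s))
      (Metric.ball x₀ R)ᶜ volume := by
  obtain ⟨M, hM0, hM⟩ := exists_ae_abs_le hu
  have he : (n : ℝ) < n + p * s := by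
    have : 0 < p * s := by positivity
    linarith
  refine Integrable.mono' ((integrableOn_compl_ball_rpow_norm hn he x₀ hR).const_mul
    (M ^ (p - 1))) ?_ ?_
  · have h1 : AEMeasurable (fun y => |max (u y) 0| ^ (p - 1)) volume :=
      ((hu.1.aemeasurable.max aemeasurable_const).abs).pow_const _
    have h2 : Measurable fun y : 𝔼 => ‖y - x₀‖ ^ ((n : ℝ) + p * s) := by fun_prop
    exact (h1.div h2.aemeasurable).aestronglyMeasurable.restrict
  · refine ae_restrict_of_ae ?_
    filter_upwards [hM] with y hy
    have h1 : |max (u y) 0| ≤ M := by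
      rw [abs_of_nonneg (le_max_right _ _)]
      exact max_le ((le_abs_self _).trans hy) hM0
    rw [Real.norm_eq_abs, abs_of_nonneg (by positivity), mul_one_div]
    exact div_le_div_of_nonneg_right
      (Real.rpow_le_rpow (abs_nonneg _) h1 (by linarith)) (by positivity)

theorem tail_nonneg (p s : ℝ) (v : 𝔼 → ℝ) (x₀ : 𝔼) {r : ℝ} (hr : 0 ≤ r) :
    0 ≤ Tail p s v x₀ r := by
  refine Real.rpow_nonneg (mul_nonneg (by positivity) (integral_nonneg fun y => ?_)) _
  positivity

theorem tail_rpow {p : ℝ} (hp : 1 < p) (s : ℝ) (v : 𝔼 → ℝ) (x₀ : 𝔼) {r : ℝ} (hr : 0 ≤ r) :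
    Tail p s v x₀ r ^ (p - 1) =
      r ^ p * ∫ y in (Metric.ball x₀ r)ᶜ, |v y| ^ (p - 1) / ‖y - x₀‖ ^ ((n : ℝ) + p * s) := by
  rw [Tail, ← Real.rpow_mul, one_div_mul_cancel (by linarith), Real.rpow_one]
  exact mul_nonneg (by positivity) (integral_nonneg fun y => by positivity)

theorem IsTestFunction.mono {U V : Set 𝔼} {η : 𝔼 → ℝ} (h : IsTestFunction U η) (hUV : U ⊆ V) :
    IsTestFunction V η := ⟨h.1, h.2.1, h.2.2.trans hUV⟩

set_option maxHeartbeats 1000000 in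
/-- Caccioppoli inequality for truncated and localized subsolutions. -/
theorem caccioppoli (hn : 1 ≤ n) {p s Λ : ℝ} (hp : 1 < p) (hs : 0 < s) (hs1 : s < 1)
    (hΛ : 1 ≤ Λ) : ∃ C : ℝ, 0 < C ∧ ∀ (Ω : Set 𝔼) (K : 𝔼 → 𝔼 → ℝ) (u : 𝔼 → ℝ),
      IsAdmissibleKernel p s Λ K → IsWeakSubsolution p K Ω u →
      ∀ (x₀ : 𝔼) (r ρ' ρ ℓ : ℝ), 0 < r → r ≤ 1 → r / 2 ≤ ρ' → ρ' < ρ → ρ ≤ r →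
        Metric.ball x₀ r ⊆ Ω → 0 ≤ ℓ →
        ∃ (τ : ℝ) (φ : 𝔼 → ℝ) (H : 𝔼 → 𝔼), ρ' ≤ τ ∧ τ ≤ r ∧
          IsSobolevLimit p (Metric.ball x₀ τ) φ H ∧
          HasSobolevGradient p (Metric.ball x₀ τ) φ H ∧
          (∀ x ∈ Metric.ball x₀ ρ', φ x = max (u x - ℓ) 0) ∧
          ∫ x in Metric.ball x₀ τ, ‖H x‖ ^ p ≤
            C * (r ^ (-p) * ((ρ - ρ') / r) ^ (-(n + p)) *
              ((∫ x in Metric.ball x₀ ρ, (max (u x - ℓ) 0) ^ p) +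
                Tail p s (fun y => max (u y) 0) x₀ (r / 2) ^ (p - 1) *
                  ∫ x in Metric.ball x₀ ρ, max (u x - ℓ) 0)) := by
  have hps : 0 < p * (1 - s) := mul_pos (by linarith) (by linarith)
  obtain ⟨M, hM0, hM⟩ := exists_cutoff n
  obtain ⟨CK, hCK0, hCK⟩ := lintegral_ball_rpow_norm hn (e := p - (n + p * s)) (by linarith)
  set m : ℕ := ⌈p⌉₊ with hmdef
  have hm : p ≤ m := Nat.le_ceil p
  have hm0 : m ≠ 0 := by
    intro h
    rw [h] at hm
    norm_num at hm
    linarith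
  set a₁ : ℝ := 2 * 2 ^ p with ha₁
  set a₂ : ℝ := 2 * 2 ^ p * (2 * m) ^ p + 2 ^ p * m ^ p with ha₂
  -- The terms come, in order, from interactions inside the ball, from the tail, and from the
  -- gradient of the cutoff in the local energy.
  refine ⟨a₁ * (2 * ((2 * m) ^ p * (2 * M) ^ p * Λ * (CK * 2 ^ p)) +
    2 * (Λ * (2 ^ (n + p) * 2 ^ p))) + a₂ * (2 * M) ^ p, by positivity, ?_⟩
  intro Ω K u hK hu x₀ r ρ' ρ ℓ hr hr1 hρ'r hρ' hρr hΩ hℓ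
  have hρ'0 : 0 < ρ' := by linarith
  -- The radii satisfy ρ' < b < τ < ρ ≤ r. The cutoff is 1 on the ball of radius ρ' and supported in
  -- radius b, and τ < r makes U compactly contained in Ω even if the ball of radius r touches the
  -- boundary.
  set b : ℝ := (ρ' + ρ) / 2 with hb
  set τ : ℝ := (b + ρ) / 2 with hτ
  set U := Metric.ball x₀ τ with hU
  obtain ⟨ψ, hψs, hψ0, hψ1, hψeq, hψsupp, hψg, hψL⟩ := hM x₀ ρ' b hρ'0 (by linarith)
  have hψb : ∀ x, x ∉ Metric.closedBall x₀ b → ψ x = 0 := fun x hx =>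
    image_eq_zero_of_notMem_tsupport fun h => hx (hψsupp h)
  set L : ℝ := M / (b - ρ') with hL
  have hbρ : 0 < b - ρ' := by linarith
  have hL0 : 0 ≤ L := by positivity
  have hθsupp : tsupport (fun x => ψ x ^ m) ⊆ Metric.closedBall x₀ b :=
    (closure_mono fun x hx => by
      rw [Function.mem_support] at hx ⊢
      exact fun h => hx (by simp [h, hm0])).trans hψsupp
  have hθ : IsTestFunction U fun x => ψ x ^ m :=
    ⟨hψs.pow m, (isCompact_closedBall x₀ b).of_isClosed_subset (isClosed_tsupport _) hθsupp,
      hθsupp.trans (Metric.closedBall_subset_ball (by linarith))⟩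
  have hUΩ : CompactlyContained U Ω := by
    refine ⟨Metric.isOpen_ball, (isCompact_closedBall x₀ τ).of_isClosed_subset isClosed_closure
      Metric.closure_ball_subset_closedBall, ?_⟩
    exact Metric.closure_ball_subset_closedBall.trans
      ((Metric.closedBall_subset_ball (by linarith)).trans hΩ)
  obtain ⟨G, hG⟩ := hu.2.1 U hUΩ
  have hUv : volume U ≠ ⊤ := measure_ball_lt_top.ne
  obtain ⟨hφm, hHm, hlim⟩ := isSobolevLimit_posPart_mul hp.le Metric.isOpen_ball hUv hG hθ ℓ
  set φ : 𝔼 → ℝ := fun x => max (u x - ℓ) 0 * ψ x ^ m with hφ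
  set H : 𝔼 → 𝔼 := fun x => ((if 0 < u x - ℓ then 1 else 0) * ψ x ^ m) • G x +
    max (u x - ℓ) 0 • gradient (fun x => ψ x ^ m) x with hH
  have hφH := hlim.hasSobolevGradient hp.le hUv hφm hHm
  refine ⟨τ, φ, H, by linarith, by linarith, hlim, hφH, fun x hx => by simp [hφ, hψeq x hx], ?_⟩
  have hφ0 : MemW1pZero p U φ :=
    ⟨fun x hx => by
      have : ψ x ^ m = 0 := hθ.eq_zero_of_notMem x hx
      simp [hφ, this], H, hφH, hlim.exists_seq⟩
  have hsub := hu.2.2 U hUΩ φ hφ0 (Eventually.of_forall fun x =>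
    mul_nonneg (le_max_right _ _) (pow_nonneg (hψ0 x) m)) G H hG hφH
  have hwp := integrableOn_ball_posPart_rpow hu.1 hℓ (by linarith : 0 ≤ p) x₀ ρ
  have hw : IntegrableOn (fun x => max (u x - ℓ) 0) (Metric.ball x₀ ρ) volume := by
    simpa using integrableOn_ball_posPart_rpow hu.1 hℓ zero_le_one x₀ ρ
  have hnl := neg_le_nonlocal_energy hn hp hs hΛ hK hm hψ0 hψ1 (by linarith : b < ρ)
    (by linarith) hψb hℓ hL0 hψL hu.1.1.aemeasurable hCK hCK0.le hw hwp
    (by linarith : r / 2 ≤ ρ) (integrableOn_tail hn hp hs hu.1 x₀ (by linarith : 0 < r / 2))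
  change _ ≤ ∫ x, ∫ y, nonlocalIntegrand p K u φ x y at hnl
  have hρ0 : 0 < ρ := by linarith
  set Ap := ∫ x in Metric.ball x₀ ρ, (max (u x - ℓ) 0) ^ p with hAp
  set A1 := ∫ x in Metric.ball x₀ ρ, max (u x - ℓ) 0 with hA1
  set J := ∫ y in (Metric.ball x₀ (r / 2))ᶜ,
    |max (u y) 0| ^ (p - 1) / ‖y - x₀‖ ^ ((n : ℝ) + p * s) with hJ
  set T := Tail p s (fun y => max (u y) 0) x₀ (r / 2) with hT
  have hAp0 : 0 ≤ Ap := integral_nonneg fun x => Real.rpow_nonneg (le_max_right _ _) _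
  have hA10 : 0 ≤ A1 := integral_nonneg fun x => (le_max_right _ _ : 0 ≤ max (u x - ℓ) 0)
  have hJ0 : 0 ≤ J := integral_nonneg fun y => by positivity
  have hTJ : T ^ (p - 1) = (r / 2) ^ p * J := tail_rpow hp s _ x₀ (by linarith)
  have hGp : Integrable (fun x => ‖G x‖ ^ p) (volume.restrict U) := by
    have := hG.2.1.integrable_norm_rpow (by simp; linarith) ENNReal.ofReal_ne_top
    rwa [ENNReal.toReal_ofReal (by linarith)] at this
  have hHp : Integrable (fun x => ‖H x‖ ^ p) (volume.restrict U) := by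
    have := hHm.integrable_norm_rpow (by simp; linarith) ENNReal.ofReal_ne_top
    rwa [ENNReal.toReal_ofReal (by linarith)] at this
  have hflux : Integrable (fun x => ‖G x‖ ^ (p - 2) * inner ℝ (G x) (H x))
      (volume.restrict U) := by
    refine Integrable.mono' (hGp.add hHp) ?_ (Eventually.of_forall fun x => ?_)
    · exact ((hG.2.1.1.norm.aemeasurable.pow_const _).aestronglyMeasurable).mul
        (hG.2.1.1.inner hHm.1)
    · exact norm_flux_inner_le hp _ _
  have hUρ : U ⊆ Metric.ball x₀ ρ := Metric.ball_subset_ball (by linarith)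
  have hwpU := hwp.mono_set hUρ
  have hpt : ∀ x, ‖H x‖ ^ p ≤ a₁ * (‖G x‖ ^ (p - 2) * inner ℝ (G x) (H x)) +
      a₂ * L ^ p * (max (u x - ℓ) 0) ^ p := by
    intro x
    have hgx : gradient (fun x => ψ x ^ m) x = ((m : ℝ) * ψ x ^ (m - 1)) • gradient ψ x :=
      gradient_pow ((hψs.differentiable (by simp)) x) m
    by_cases h : 0 < u x - ℓ
    · have hHx : H x = ψ x ^ m • G x +
          (max (u x - ℓ) 0 * (m * ψ x ^ (m - 1))) • gradient ψ x := by
        simp only [hH, h, if_true, one_mul, hgx, smul_smul]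
      have h1 := local_integrand_ge hp hm (G x) (gradient ψ x) (w := max (u x - ℓ) 0)
        (le_max_right _ _) (hψ0 x) (hψ1 x) (hψg x)
      rw [← hHx, Real.mul_rpow (le_max_right _ _) hL0] at h1
      linarith
    · have hHx : H x = 0 := by
        simp only [hH, if_neg h, max_eq_right (not_lt.1 h), zero_mul, zero_smul, add_zero]
      rw [hHx, norm_zero, Real.zero_rpow (by linarith), inner_zero_right]
      have : 0 ≤ a₂ * L ^ p * (max (u x - ℓ) 0) ^ p := by positivity
      linarith
  have hloc : ∫ x in U, ‖H x‖ ^ p ≤ a₁ * (∫ x in U, ‖G x‖ ^ (p - 2) * inner ℝ (G x) (H x)) +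
      a₂ * L ^ p * ∫ x in U, (max (u x - ℓ) 0) ^ p := by
    rw [← integral_const_mul, ← integral_const_mul, ← integral_add (hflux.const_mul _)
      (hwpU.const_mul _)]
    exact integral_mono hHp ((hflux.const_mul _).add (hwpU.const_mul _)) hpt
  have hAU : ∫ x in U, (max (u x - ℓ) 0) ^ p ≤ Ap :=
    setIntegral_mono_set hwp (Eventually.of_forall fun x => by positivity)
      (Eventually.of_forall hUρ)
  clear_value Ap A1 J T φ H
  set σ := (ρ - ρ') / r with hσ
  have hσ0 : 0 < σ := div_pos (by linarith) hr
  have hσ1 : σ ≤ 1 := by rw [hσ, div_le_one hr]; linarith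
  have hσr : ρ - ρ' = σ * r := by rw [hσ]; field_simp
  set X := r ^ (-p) * σ ^ (-(n + p)) with hX
  have hX0 : 0 ≤ X := by positivity
  -- Since b - ρ' = σr/2, L^p is (2M)^p r^(-p) σ^(-p); as σ ≤ 1, the power of σ may be lowered to
  -- -(n + p), the one needed by the tail.
  have hLp : L ^ p ≤ (2 * M) ^ p * X := by
    have h1 : L = 2 * M * (r⁻¹ * σ⁻¹) := by
      rw [hL, show b - ρ' = σ * r / 2 by rw [hb, ← hσr]; ring]
      field_simp
    rw [h1, Real.mul_rpow (x := 2 * M) (by positivity) (by positivity),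
      Real.mul_rpow (x := r⁻¹) (by positivity) (by positivity), hX, Real.inv_rpow hr.le,
      Real.inv_rpow hσ0.le, ← Real.rpow_neg hr.le, ← Real.rpow_neg hσ0.le]
    gcongr ?_ * (?_ * ?_)
    exact Real.rpow_le_rpow_of_exponent_ge hσ0 hσ1 (by
      have : (0 : ℝ) ≤ n := by positivity
      linarith)
  -- Here r ≤ 1 enters: the factor ρ^(p - ps) from the nonlocal scaling is bounded by 1.
  have h2ρ : (2 * ρ) ^ (p - p * s) ≤ 2 ^ p := by
    calc (2 * ρ) ^ (p - p * s) ≤ 2 ^ (p - p * s) :=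
          Real.rpow_le_rpow (by linarith) (by linarith) (by linarith)
      _ ≤ 2 ^ p := Real.rpow_le_rpow_of_exponent_le (by norm_num) (by
          have : 0 < p * s := by positivity
          linarith)
  have hJX : (ρ / (ρ - b)) ^ (n + p * s) * J ≤ 2 ^ (n + p) * 2 ^ p * (X * T ^ (p - 1)) := by
    have h1 : ρ / (ρ - b) ≤ 2 * σ⁻¹ := by
      rw [show ρ - b = σ * r / 2 by rw [hb, ← hσr]; ring, div_le_iff₀ (by positivity)]
      field_simp
      linarith
    have h2 : (ρ / (ρ - b)) ^ (n + p * s) ≤ 2 ^ (n + p) * σ ^ (-(n + p)) := by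
      have h3 : 1 ≤ 2 * σ⁻¹ := by
        have : 1 ≤ σ⁻¹ := (one_le_inv₀ hσ0).2 hσ1
        linarith
      calc (ρ / (ρ - b)) ^ (n + p * s) ≤ (2 * σ⁻¹) ^ (n + p * s) :=
            Real.rpow_le_rpow (div_nonneg (by linarith) (by linarith)) h1 (by positivity)
        _ ≤ (2 * σ⁻¹) ^ (n + p) := Real.rpow_le_rpow_of_exponent_le h3 (by nlinarith)
        _ = _ := by
            rw [Real.mul_rpow (by norm_num) (by positivity), Real.inv_rpow hσ0.le,
              ← Real.rpow_neg hσ0.le]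
    have h4 : J = 2 ^ p * r ^ (-p) * T ^ (p - 1) := by
      rw [hTJ, Real.div_rpow hr.le (by norm_num), Real.rpow_neg hr.le]
      have : r ^ p ≠ 0 := by positivity
      have : (2 : ℝ) ^ p ≠ 0 := by positivity
      field_simp
    calc (ρ / (ρ - b)) ^ (n + p * s) * J ≤ 2 ^ (n + p) * σ ^ (-(n + p)) * J := by gcongr
      _ = _ := by rw [h4, hX]; ring
  have hT0 : 0 ≤ T ^ (p - 1) := by rw [hTJ]; positivity
  have hN1 : Ap * ((2 * m) ^ p * L ^ p * Λ * (CK * (2 * ρ) ^ (p - p * s))) ≤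
      (2 * m) ^ p * (2 * M) ^ p * Λ * (CK * 2 ^ p) * (X * Ap) := by
    calc _ ≤ Ap * ((2 * m) ^ p * ((2 * M) ^ p * X) * Λ * (CK * 2 ^ p)) := by gcongr
      _ = _ := by ring
  have hN2 : A1 * (Λ * (ρ / (ρ - b)) ^ (n + p * s) * J) ≤
      Λ * (2 ^ (n + p) * 2 ^ p) * (X * (T ^ (p - 1) * A1)) := by
    rw [mul_assoc Λ]
    calc _ ≤ A1 * (Λ * (2 ^ (n + p) * 2 ^ p * (X * T ^ (p - 1)))) := by gcongr
      _ = _ := by ring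
  have hN3 : a₂ * L ^ p * ∫ x in U, (max (u x - ℓ) 0) ^ p ≤ a₂ * (2 * M) ^ p * (X * Ap) := by
    calc _ ≤ a₂ * ((2 * M) ^ p * X) * Ap := by gcongr
      _ = _ := by ring
  have hsub' : (∫ x in U, ‖G x‖ ^ (p - 2) * inner ℝ (G x) (H x)) ≤
      2 * (Ap * ((2 * m) ^ p * L ^ p * Λ * (CK * (2 * ρ) ^ (p - p * s)))) +
      2 * (A1 * (Λ * (ρ / (ρ - b)) ^ (n + p * s) * J)) := by
    have h1 : ∫ x, ∫ y, nonlocalIntegrand p K u φ x y =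
        ∫ x, ∫ y, |u x - u y| ^ (p - 2) * (u x - u y) * (φ x - φ y) * K x y := rfl
    rw [← h1] at hsub
    linarith
  have hXA : 0 ≤ X * Ap := by positivity
  have hXT : 0 ≤ X * (T ^ (p - 1) * A1) := by positivity
  have ha₁0 : 0 ≤ a₁ := by positivity
  calc ∫ x in U, ‖H x‖ ^ p
      ≤ a₁ * (2 * ((2 * m) ^ p * (2 * M) ^ p * Λ * (CK * 2 ^ p) * (X * Ap)) +
          2 * (Λ * (2 ^ (n + p) * 2 ^ p) * (X * (T ^ (p - 1) * A1)))) +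
          a₂ * (2 * M) ^ p * (X * Ap) := by
        refine hloc.trans (add_le_add (mul_le_mul_of_nonneg_left ?_ ha₁0) hN3)
        linarith
    _ ≤ _ := by
        have e1 : 0 ≤ a₁ * (2 * ((2 * m) ^ p * (2 * M) ^ p * Λ * (CK * 2 ^ p))) := by positivity
        have e2 : 0 ≤ a₁ * (2 * (Λ * (2 ^ (n + p) * 2 ^ p))) := by positivity
        have e3 : 0 ≤ a₂ * (2 * M) ^ p := by positivity
        have f1 := mul_nonneg e1 hXT
        have f2 := mul_nonneg e2 hXA
        have f3 := mul_nonneg e3 hXT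
        linarith

/-- Gain of integrability from the Caccioppoli and Sobolev inequalities. -/
theorem higher_integrability (hn : 1 ≤ n) {p s Λ : ℝ} (hp : 1 < p) (hs : 0 < s) (hs1 : s < 1)
    (hΛ : 1 ≤ Λ) : ∃ C : ℝ, 0 < C ∧ ∀ (Ω : Set 𝔼) (K : 𝔼 → 𝔼 → ℝ) (u : 𝔼 → ℝ),
      IsAdmissibleKernel p s Λ K → IsWeakSubsolution p K Ω u →
      ∀ (x₀ : 𝔼) (r ρ' ρ ℓ : ℝ), 0 < r → r ≤ 1 → r / 2 ≤ ρ' → ρ' < ρ → ρ ≤ r →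
        Metric.ball x₀ r ⊆ Ω → 0 ≤ ℓ →
        ∫ x in Metric.ball x₀ ρ', (max (u x - ℓ) 0) ^ (kappa n p * p) ≤
          C * (r ^ (kappa n p * p - n * (kappa n p - 1)) *
            (r ^ (-p) * ((ρ - ρ') / r) ^ (-(n + p)) *
              ((∫ x in Metric.ball x₀ ρ, (max (u x - ℓ) 0) ^ p) +
                Tail p s (fun y => max (u y) 0) x₀ (r / 2) ^ (p - 1) *
                  ∫ x in Metric.ball x₀ ρ, max (u x - ℓ) 0)) ^ kappa n p) := by
  obtain ⟨C₁, hC₁, hcac⟩ := caccioppoli (n := n) hn hp hs hs1 hΛ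
  obtain ⟨CS, hCS⟩ := sobolev_testFunction (n := n) hn hp
  have hκ := one_lt_kappa n hp
  set κ := kappa n p with hκdef
  have hκp : 0 < κ * p := mul_pos (by linarith) (by linarith)
  -- The added 1 guarantees positivity, as the Sobolev constant is only known to be nonnegative.
  refine ⟨(CS : ℝ) ^ (κ * p) * C₁ ^ κ + 1, by positivity, ?_⟩
  intro Ω K u hK hu x₀ r ρ' ρ ℓ hr hr1 hρ'r hρ' hρr hΩ hℓ
  obtain ⟨τ, φ, H, hτ, hτr, hlim, hφH, hφeq, hE⟩ :=
    hcac Ω K u hK hu x₀ r ρ' ρ ℓ hr hr1 hρ'r hρ' hρr hΩ hℓ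
  set E := r ^ (-p) * ((ρ - ρ') / r) ^ (-(n + p)) *
              ((∫ x in Metric.ball x₀ ρ, (max (u x - ℓ) 0) ^ p) +
                Tail p s (fun y => max (u y) 0) x₀ (r / 2) ^ (p - 1) *
                  ∫ x in Metric.ball x₀ ρ, max (u x - ℓ) 0) with hEdef
  have hρ'0 : 0 < ρ' := by linarith
  have hE0 : 0 ≤ E := by
    have h1 : 0 ≤ ∫ x in Metric.ball x₀ ρ, (max (u x - ℓ) 0) ^ p :=
      integral_nonneg fun x => Real.rpow_nonneg (le_max_right _ _) _
    have h2 : 0 ≤ ∫ x in Metric.ball x₀ ρ, max (u x - ℓ) 0 :=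
      integral_nonneg fun x => (le_max_right _ _ : 0 ≤ max (u x - ℓ) 0)
    have h3 := tail_nonneg p s (fun y => max (u y) 0) x₀ (by linarith : 0 ≤ r / 2)
    have h4 : 0 ≤ (ρ - ρ') / r := div_nonneg (by linarith) hr.le
    positivity
  clear_value E
  set γ := 1 - n * (1 - 1 / κ) / p with hγ
  have hsob := hlim.eLpNorm_le hp.le (q := κ * p) hφH.1.1 hφH.2.1.1
    (C := CS * ENNReal.ofReal (r ^ γ)) (ENNReal.mul_ne_top (by simp) ENNReal.ofReal_ne_top)
    (fun η hη => hCS x₀ r hr η (hη.mono (Metric.ball_subset_ball hτr))) measurableSet_ball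
  set I := ∫ x in Metric.ball x₀ τ, ‖H x‖ ^ p with hI
  have hI0 : 0 ≤ I := integral_nonneg fun x => by positivity
  have hHI : eLpNorm H (ENNReal.ofReal p) (volume.restrict (Metric.ball x₀ τ)) =
      ENNReal.ofReal (I ^ (1 / p)) := by
    rw [hφH.2.1.eLpNorm_eq_integral_rpow_norm (by simp; linarith) ENNReal.ofReal_ne_top,
      ENNReal.toReal_ofReal (by linarith), one_div]
  have hle : ENNReal.ofReal (∫ x in Metric.ball x₀ ρ', (max (u x - ℓ) 0) ^ (κ * p)) ≤
      ENNReal.ofReal ((CS * r ^ γ * I ^ (1 / p)) ^ (κ * p)) := by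
    rw [ofReal_integral_eq_lintegral_ofReal
      (integrableOn_ball_posPart_rpow hu.1 hℓ hκp.le x₀ ρ')
      (Eventually.of_forall fun x => by positivity)]
    calc ∫⁻ x in Metric.ball x₀ ρ', ENNReal.ofReal ((max (u x - ℓ) 0) ^ (κ * p))
        = ∫⁻ x in Metric.ball x₀ ρ', ‖φ x‖ₑ ^ (κ * p) := by
          refine setLIntegral_congr_fun measurableSet_ball fun x hx => ?_
          rw [hφeq x hx, Real.enorm_of_nonneg (le_max_right _ _),
            ENNReal.ofReal_rpow_of_nonneg (le_max_right _ _) hκp.le]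
      _ ≤ ∫⁻ x in Metric.ball x₀ τ, ‖φ x‖ₑ ^ (κ * p) :=
          lintegral_mono_set (Metric.ball_subset_ball hτ)
      _ = (eLpNorm φ (ENNReal.ofReal (κ * p)) (volume.restrict (Metric.ball x₀ τ))) ^
          (κ * p) := by
          rw [eLpNorm_eq_lintegral_rpow_enorm_toReal (by simpa using hκp) ENNReal.ofReal_ne_top,
            ENNReal.toReal_ofReal hκp.le, ← ENNReal.rpow_mul,
            one_div_mul_cancel hκp.ne', ENNReal.rpow_one]
      _ ≤ (CS * ENNReal.ofReal (r ^ γ) * ENNReal.ofReal (I ^ (1 / p))) ^ (κ * p) := by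
          rw [← hHI]
          gcongr
      _ = _ := by
          rw [← ENNReal.ofReal_coe_nnreal, ← ENNReal.ofReal_mul (by positivity),
            ← ENNReal.ofReal_mul (by positivity),
            ENNReal.ofReal_rpow_of_nonneg (by positivity) hκp.le]
  have hle' := (ENNReal.ofReal_le_ofReal_iff (by positivity)).1 hle
  refine hle'.trans ?_
  have h1 : (CS * r ^ γ * I ^ (1 / p)) ^ (κ * p) =
      (CS : ℝ) ^ (κ * p) * r ^ (κ * p - n * (κ - 1)) * I ^ κ := by
    rw [Real.mul_rpow (by positivity) (by positivity),
      Real.mul_rpow (by positivity) (by positivity), ← Real.rpow_mul hr.le, ← Real.rpow_mul hI0]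
    congr 2
    · congr 1
      rw [hγ]
      have : p ≠ 0 := by linarith
      have : κ ≠ 0 := by linarith
      field_simp
    · have : p ≠ 0 := by linarith
      field_simp
  have h2 : I ^ κ ≤ C₁ ^ κ * E ^ κ := by
    rw [← Real.mul_rpow hC₁.le hE0]
    exact Real.rpow_le_rpow hI0 hE (by linarith)
  rw [h1]
  calc _ ≤ (CS : ℝ) ^ (κ * p) * r ^ (κ * p - n * (κ - 1)) * (C₁ ^ κ * E ^ κ) := by gcongr
    _ ≤ _ := by
      have : 0 ≤ r ^ (κ * p - n * (κ - 1)) * E ^ κ := by positivity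
      linarith

/-! ### De Giorgi iteration -/

/-- A pointwise Chebyshev bound: where a > k', the excess a - k is at least k' - k, so lowering its
exponent from q to p costs (k' - k)^(p-q). -/
theorem posPart_rpow_le_of_lt {p q a k k' : ℝ} (hp : 0 < p) (hpq : p ≤ q) (hk : k < k') :
    (max (a - k') 0) ^ p ≤ (k' - k) ^ (p - q) * (max (a - k) 0) ^ q := by
  rcases le_or_gt a k' with h | h
  · rw [max_eq_right (by linarith : a - k' ≤ 0), Real.zero_rpow hp.ne']
    have : 0 ≤ max (a - k) 0 := le_max_right _ _
    have : 0 < k' - k := by linarith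
    positivity
  · rw [max_eq_left (by linarith : 0 ≤ a - k'), max_eq_left (by linarith : 0 ≤ a - k)]
    have h1 : 0 < a - k := by linarith
    have h2 : (a - k') ^ p ≤ (a - k) ^ p := Real.rpow_le_rpow (by linarith) (by linarith) hp.le
    have h3 : (a - k) ^ p = (a - k) ^ (p - q) * (a - k) ^ q := by
      rw [← Real.rpow_add h1]; ring_nf
    rw [h3] at h2
    refine h2.trans ?_
    gcongr ?_ * _
    exact Real.rpow_le_rpow_of_nonpos (by linarith) (by linarith) (by linarith)

/-- One step of the De Giorgi iteration. -/
theorem level_step (hn : 1 ≤ n) {p s Λ : ℝ} (hp : 1 < p) (hs : 0 < s) (hs1 : s < 1)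
    (hΛ : 1 ≤ Λ) : ∃ C : ℝ, 0 < C ∧ ∀ (Ω : Set 𝔼) (K : 𝔼 → 𝔼 → ℝ) (u : 𝔼 → ℝ),
      IsAdmissibleKernel p s Λ K → IsWeakSubsolution p K Ω u →
      ∀ (x₀ : 𝔼) (r ρ' ρ k k' : ℝ), 0 < r → r ≤ 1 → r / 2 ≤ ρ' → ρ' < ρ → ρ ≤ r →
        Metric.ball x₀ r ⊆ Ω → 0 ≤ k → k < k' →
        ∫ x in Metric.ball x₀ ρ', (max (u x - k') 0) ^ p ≤
          C * ((k' - k) ^ (-((kappa n p - 1) * p)) * r ^ (-(n * (kappa n p - 1))) *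
            (((ρ - ρ') / r) ^ (-(n + p)) *
              (1 + (Tail p s (fun y => max (u y) 0) x₀ (r / 2) / (k' - k)) ^ (p - 1)) *
              ∫ x in Metric.ball x₀ ρ, (max (u x - k) 0) ^ p) ^ kappa n p) := by
  obtain ⟨C₁, hC₁, hhi⟩ := higher_integrability (n := n) hn hp hs hs1 hΛ
  have hκ := one_lt_kappa n hp
  set κ := kappa n p with hκdef
  have hκp : p ≤ κ * p := by nlinarith
  refine ⟨2 ^ ((κ - 1) * p) * C₁ * (2 ^ (p - 1)) ^ κ, by positivity, ?_⟩
  intro Ω K u hK hu x₀ r ρ' ρ k k' hr hr1 hρ'r hρ' hρr hΩ hk hkk'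
  set h := k' - k with hh
  have hh0 : 0 < h := by linarith
  -- The gap is used twice: from ℓ to k' to replace the exponent p by κp, and from k to ℓ to bound
  -- the L¹ norm in the tail term by the p-th power integral.
  set ℓ := (k + k') / 2 with hℓ
  have hℓk' : k' - ℓ = h / 2 := by rw [hℓ, hh]; ring
  have hℓk : ℓ - k = h / 2 := by rw [hℓ, hh]; ring
  have hℓ0 : 0 ≤ ℓ := by linarith
  set T := Tail p s (fun y => max (u y) 0) x₀ (r / 2) with hT
  have hT0 : 0 ≤ T := tail_nonneg p s _ x₀ (by linarith)
  have h1 := hhi Ω K u hK hu x₀ r ρ' ρ ℓ hr hr1 hρ'r hρ' hρr hΩ hℓ0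
  have hi := fun (k q ρ : ℝ) (hk : 0 ≤ k) (hq : 0 ≤ q) =>
    integrableOn_ball_posPart_rpow hu.1 hk hq x₀ ρ
  set A := ∫ x in Metric.ball x₀ ρ, (max (u x - k) 0) ^ p with hA
  have hA0 : 0 ≤ A := integral_nonneg fun x => Real.rpow_nonneg (le_max_right _ _) _
  have h2 : ∫ x in Metric.ball x₀ ρ', (max (u x - k') 0) ^ p ≤
      (h / 2) ^ (-((κ - 1) * p)) * ∫ x in Metric.ball x₀ ρ', (max (u x - ℓ) 0) ^ (κ * p) := by
    rw [← integral_const_mul]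
    refine integral_mono (hi k' p ρ' (by linarith) (by linarith))
      ((hi ℓ (κ * p) ρ' hℓ0 (by linarith)).const_mul _) fun x => ?_
    have := posPart_rpow_le_of_lt (a := u x) (by linarith : 0 < p) hκp (by linarith : ℓ < k')
    rwa [hℓk', show p - κ * p = -((κ - 1) * p) by ring] at this
  have h3 : ∫ x in Metric.ball x₀ ρ, (max (u x - ℓ) 0) ^ p ≤ A := by
    refine integral_mono (hi ℓ p ρ hℓ0 (by linarith)) (hi k p ρ hk (by linarith)) fun x => ?_
    exact Real.rpow_le_rpow (le_max_right _ _) (max_le_max (by linarith) le_rfl) (by linarith)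
  have h4 : ∫ x in Metric.ball x₀ ρ, max (u x - ℓ) 0 ≤ (h / 2) ^ (-(p - 1)) * A := by
    rw [hA, ← integral_const_mul]
    have hi1 : IntegrableOn (fun x => max (u x - ℓ) 0) (Metric.ball x₀ ρ) volume := by
      simpa using hi ℓ 1 ρ hℓ0 zero_le_one
    refine integral_mono hi1 ((hi k p ρ hk (by linarith)).const_mul _) fun x => ?_
    have := posPart_rpow_le_of_lt (a := u x) one_pos hp.le (by linarith : k < ℓ)
    rwa [hℓk, Real.rpow_one, show 1 - p = -(p - 1) by ring] at this
  set σ := (ρ - ρ') / r with hσ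
  have hσ0 : 0 < σ := div_pos (by linarith) hr
  have h5 : r ^ (-p) * σ ^ (-(n + p)) * ((∫ x in Metric.ball x₀ ρ, (max (u x - ℓ) 0) ^ p) +
      T ^ (p - 1) * ∫ x in Metric.ball x₀ ρ, max (u x - ℓ) 0) ≤
      2 ^ (p - 1) * r ^ (-p) * (σ ^ (-(n + p)) * (1 + (T / h) ^ (p - 1)) * A) := by
    have h6 : (h / 2) ^ (-(p - 1)) = 2 ^ (p - 1) * h ^ (-(p - 1)) := by
      rw [Real.div_rpow hh0.le (by norm_num), Real.rpow_neg (by norm_num : (0 : ℝ) ≤ 2)]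
      field_simp
    have h7 : (T / h) ^ (p - 1) = T ^ (p - 1) * h ^ (-(p - 1)) := by
      rw [Real.div_rpow hT0 hh0.le, Real.rpow_neg hh0.le]; rfl
    have h8 : (1 : ℝ) ≤ 2 ^ (p - 1) := Real.one_le_rpow (by norm_num) (by linarith)
    have h9 : 0 ≤ T ^ (p - 1) := by positivity
    have h10 : (∫ x in Metric.ball x₀ ρ, (max (u x - ℓ) 0) ^ p) +
      T ^ (p - 1) * ∫ x in Metric.ball x₀ ρ, max (u x - ℓ) 0 ≤
        2 ^ (p - 1) * ((1 + (T / h) ^ (p - 1)) * A) := by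
      have h11 := mul_le_mul_of_nonneg_left h4 h9
      rw [h6] at h11
      rw [h7]
      have h12 : A ≤ 2 ^ (p - 1) * A := le_mul_of_one_le_left hA0 h8
      linarith
    calc _ ≤ r ^ (-p) * σ ^ (-(n + p)) * (2 ^ (p - 1) * ((1 + (T / h) ^ (p - 1)) * A)) := by
          gcongr
      _ = _ := by ring
  set Y := σ ^ (-(n + p)) * (1 + (T / h) ^ (p - 1)) * A with hY
  have hY0 : 0 ≤ Y := by positivity
  have hE0 : 0 ≤ r ^ (-p) * σ ^ (-(n + p)) *
      ((∫ x in Metric.ball x₀ ρ, (max (u x - ℓ) 0) ^ p) +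
      T ^ (p - 1) * ∫ x in Metric.ball x₀ ρ, max (u x - ℓ) 0) := by
    have e1 : 0 ≤ ∫ x in Metric.ball x₀ ρ, (max (u x - ℓ) 0) ^ p :=
      integral_nonneg fun x => Real.rpow_nonneg (le_max_right _ _) _
    have e2 : 0 ≤ ∫ x in Metric.ball x₀ ρ, max (u x - ℓ) 0 :=
      integral_nonneg fun x => (le_max_right _ _ : 0 ≤ max (u x - ℓ) 0)
    positivity
  have h13 := Real.rpow_le_rpow hE0 h5 (by linarith : 0 ≤ κ)
  have h14 : (2 ^ (p - 1) * r ^ (-p) * Y) ^ κ =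
      (2 ^ (p - 1)) ^ κ * r ^ (-(κ * p)) * Y ^ κ := by
    rw [Real.mul_rpow (by positivity) hY0, Real.mul_rpow (by positivity) (by positivity),
      ← Real.rpow_mul hr.le]
    ring_nf
  rw [h14] at h13
  have h15 : (h / 2) ^ (-((κ - 1) * p)) = 2 ^ ((κ - 1) * p) * h ^ (-((κ - 1) * p)) := by
    rw [Real.div_rpow hh0.le (by norm_num), Real.rpow_neg (by norm_num : (0 : ℝ) ≤ 2)]
    field_simp
  have h16 : r ^ (κ * p - n * (κ - 1)) * r ^ (-(κ * p)) = r ^ (-(n * (κ - 1))) := by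
    rw [← Real.rpow_add hr]; ring_nf
  rw [h15] at h2
  refine h2.trans ?_
  calc _ ≤ 2 ^ ((κ - 1) * p) * h ^ (-((κ - 1) * p)) * (C₁ * (r ^ (κ * p - n * (κ - 1)) *
        ((2 ^ (p - 1)) ^ κ * r ^ (-(κ * p)) * Y ^ κ))) := by
        refine mul_le_mul_of_nonneg_left (h1.trans ?_) (by positivity)
        gcongr
    _ = _ := by rw [← h16]; ring

/-- Fast geometric convergence. -/
theorem tendsto_zero_of_superlinear {Z : ℕ → ℝ} {D b β : ℝ} (hZ : ∀ j, 0 ≤ Z j) (hD : 0 < D)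
    (hb : 1 < b) (hβ : 0 < β) (hstep : ∀ j, Z (j + 1) ≤ D * b ^ (j : ℝ) * Z j ^ (1 + β))
    (h0 : Z 0 ≤ D ^ (-(1 / β)) * b ^ (-(1 / β ^ 2))) : Tendsto Z atTop (𝓝 0) := by
  have hb0 : 0 < b := by linarith
  -- The threshold on Z₀ is chosen so that each induction step gains exactly the factor b^(-1/β).
  have hZ0 : D * Z 0 ^ β ≤ b ^ (-(1 / β)) := by
    have h1 := Real.rpow_le_rpow (hZ 0) h0 hβ.le
    rw [Real.mul_rpow (by positivity) (by positivity), ← Real.rpow_mul hD.le,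
      ← Real.rpow_mul hb0.le, show -(1 / β) * β = -1 by field_simp,
      show -(1 / β ^ 2) * β = -(1 / β) by field_simp, Real.rpow_neg_one] at h1
    calc D * Z 0 ^ β ≤ D * (D⁻¹ * b ^ (-(1 / β))) := by gcongr
      _ = _ := by field_simp
  have key : ∀ j : ℕ, Z j ≤ b ^ (-((j : ℝ) / β)) * Z 0 := by
    intro j
    induction j with
    | zero => simp
    | succ j ih =>
      have h1 : Z j ^ (1 + β) ≤ (b ^ (-((j : ℝ) / β)) * Z 0) ^ (1 + β) :=
        Real.rpow_le_rpow (hZ j) ih (by linarith)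
      have h2 : (b ^ (-((j : ℝ) / β)) * Z 0) ^ (1 + β) =
          b ^ (-((j : ℝ) / β)) * b ^ (-(j : ℝ)) * (Z 0 * Z 0 ^ β) := by
        rw [Real.mul_rpow (by positivity) (hZ 0), ← Real.rpow_mul hb0.le, ← Real.rpow_add hb0,
          Real.rpow_add_of_nonneg (hZ 0) zero_le_one hβ.le, Real.rpow_one]
        congr 2
        field_simp
        ring
      calc Z (j + 1) ≤ D * b ^ (j : ℝ) * Z j ^ (1 + β) := hstep j
        _ ≤ D * b ^ (j : ℝ) * (b ^ (-((j : ℝ) / β)) * b ^ (-(j : ℝ)) * (Z 0 * Z 0 ^ β)) := by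
            rw [← h2]; gcongr
        _ = (b ^ (j : ℝ) * b ^ (-(j : ℝ))) * (b ^ (-((j : ℝ) / β)) * Z 0) * (D * Z 0 ^ β) := by
            ring
        _ ≤ (b ^ (j : ℝ) * b ^ (-(j : ℝ))) * (b ^ (-((j : ℝ) / β)) * Z 0) * b ^ (-(1 / β)) := by
            have := hZ 0
            gcongr
        _ = _ := by
            rw [← Real.rpow_add hb0, add_neg_cancel, Real.rpow_zero, one_mul, mul_right_comm,
              ← Real.rpow_add hb0]
            congr 2
            push_cast
            ring
  have hlim : Tendsto (fun j : ℕ => b ^ (-((j : ℝ) / β)) * Z 0) atTop (𝓝 0) := by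
    have h1 : ∀ j : ℕ, b ^ (-((j : ℝ) / β)) = (b ^ (-(1 / β))) ^ j := fun j => by
      rw [← Real.rpow_natCast, ← Real.rpow_mul hb0.le]
      ring_nf
    simp only [h1]
    have h2 := tendsto_pow_atTop_nhds_zero_of_lt_one (r := b ^ (-(1 / β))) (by positivity)
      (Real.rpow_lt_one_of_one_lt_of_neg hb (by
        have : 0 < 1 / β := by positivity
        linarith))
    simpa using h2.mul_const (Z 0)
  exact squeeze_zero hZ key hlim

/-- The scale-invariant form of one iteration step at the dyadic scale `t = 2 ^ j`. -/
theorem scaled_level_step {N p κ C r m t δ T A A' : ℝ} (hp : 1 < p)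
    (hκ : 1 < κ) (hC : 0 < C) (hr : 0 < r) (hm : 0 < m) (ht : 1 ≤ t) (hδ : 0 < δ) (hδ1 : δ ≤ 1)
    (hT : 0 ≤ T) (hTm : δ * T ≤ m) (hA : 0 ≤ A)
    (h : A' ≤ C * ((m / (2 * t)) ^ (-((κ - 1) * p)) * r ^ (-(N * (κ - 1))) *
      ((1 / (4 * t)) ^ (-(N + p)) * (1 + (T / (m / (2 * t))) ^ (p - 1)) * A) ^ κ)) :
    A' / (r ^ N * m ^ p) ≤
      C * (2 ^ ((κ - 1) * p) * (4 ^ (N + p) * 2 * 2 ^ (p - 1)) ^ κ) * δ ^ ((1 - p) * κ) *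
        t ^ ((κ - 1) * p + (N + p + (p - 1)) * κ) * (A / (r ^ N * m ^ p)) ^ κ := by
  have ht0 : 0 < t := by linarith
  set Z := A / (r ^ N * m ^ p) with hZ
  have hZ0 : 0 ≤ Z := by positivity
  have hAZ : A = Z * (r ^ N * m ^ p) := by rw [hZ]; field_simp
  have h1 : (m / (2 * t)) ^ (-((κ - 1) * p)) =
      2 ^ ((κ - 1) * p) * t ^ ((κ - 1) * p) * m ^ (-((κ - 1) * p)) := by
    rw [Real.rpow_neg (by positivity), Real.div_rpow hm.le (by positivity),
      Real.mul_rpow (by norm_num) ht0.le, Real.rpow_neg hm.le]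
    field_simp
  have h2 : (1 / (4 * t)) ^ (-(N + p)) = 4 ^ (N + p) * t ^ (N + p) := by
    rw [Real.rpow_neg (by positivity), Real.div_rpow (by norm_num) (by positivity),
      Real.mul_rpow (by norm_num) ht0.le, Real.one_rpow]
    field_simp
  -- From δT ≤ m the ratio is at most 2t/δ, which is at least 1 and so also absorbs the summand 1.
  -- This is the origin of the power of δ.
  have h3 : 1 + (T / (m / (2 * t))) ^ (p - 1) ≤
      2 * 2 ^ (p - 1) * t ^ (p - 1) * δ ^ (1 - p) := by
    have e1 : T / (m / (2 * t)) ≤ 2 * t / δ := by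
      rw [div_div_eq_mul_div, div_le_div_iff₀ hm hδ]
      nlinarith
    have e2 : 1 ≤ 2 * t / δ := by rw [le_div_iff₀ hδ]; linarith
    have e3 := Real.rpow_le_rpow (by positivity) e1 (by linarith : 0 ≤ p - 1)
    have e4 := Real.one_le_rpow e2 (by linarith : 0 ≤ p - 1)
    have e5 : (2 * t / δ) ^ (p - 1) = 2 ^ (p - 1) * t ^ (p - 1) * δ ^ (1 - p) := by
      rw [Real.div_rpow (by positivity) hδ.le, Real.mul_rpow (by norm_num) ht0.le,
        show 1 - p = -(p - 1) by ring, Real.rpow_neg hδ.le]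
      rfl
    rw [e5] at e3 e4
    linarith
  have h4 : ((1 / (4 * t)) ^ (-(N + p)) * (1 + (T / (m / (2 * t))) ^ (p - 1)) * A) ^ κ ≤
      ((4 ^ (N + p) * 2 * 2 ^ (p - 1)) * (t ^ (N + p + (p - 1)) * (δ ^ (1 - p) *
        (Z * (r ^ N * m ^ p))))) ^ κ := by
    refine Real.rpow_le_rpow (by positivity) ?_ (by linarith)
    rw [h2, hAZ, Real.rpow_add ht0 (N + p) (p - 1)]
    calc _ ≤ 4 ^ (N + p) * t ^ (N + p) * (2 * 2 ^ (p - 1) * t ^ (p - 1) * δ ^ (1 - p)) *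
          (Z * (r ^ N * m ^ p)) := by gcongr
      _ = _ := by ring
  have h5 : ((4 ^ (N + p) * 2 * 2 ^ (p - 1)) * (t ^ (N + p + (p - 1)) * (δ ^ (1 - p) *
        (Z * (r ^ N * m ^ p))))) ^ κ = (4 ^ (N + p) * 2 * 2 ^ (p - 1)) ^ κ *
        (t ^ ((N + p + (p - 1)) * κ) * (δ ^ ((1 - p) * κ) *
        (Z ^ κ * (r ^ (N * κ) * m ^ (p * κ))))) := by
    rw [Real.mul_rpow (x := 4 ^ (N + p) * 2 * 2 ^ (p - 1))
        (y := t ^ (N + p + (p - 1)) * (δ ^ (1 - p) * (Z * (r ^ N * m ^ p)))) (by positivity) (by positivity),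
      Real.mul_rpow (x := t ^ (N + p + (p - 1))) (by positivity) (by positivity),
      Real.mul_rpow (x := δ ^ (1 - p)) (by positivity) (by positivity), Real.mul_rpow hZ0 (by positivity),
      Real.mul_rpow (x := r ^ N) (by positivity) (by positivity), ← Real.rpow_mul ht0.le, ← Real.rpow_mul hδ.le,
      ← Real.rpow_mul hr.le, ← Real.rpow_mul hm.le]
  have h6 : m ^ (-((κ - 1) * p)) * m ^ (p * κ) = m ^ p := by
    rw [← Real.rpow_add hm]; ring_nf
  have h7 : r ^ (-(N * (κ - 1))) * r ^ (N * κ) = r ^ N := by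
    rw [← Real.rpow_add hr]; ring_nf
  rw [div_le_iff₀ (by positivity)]
  refine h.trans ?_
  rw [h1]
  calc _ ≤ C * (2 ^ ((κ - 1) * p) * t ^ ((κ - 1) * p) * m ^ (-((κ - 1) * p)) *
        r ^ (-(N * (κ - 1))) * ((4 ^ (N + p) * 2 * 2 ^ (p - 1)) ^ κ *
        (t ^ ((N + p + (p - 1)) * κ) * (δ ^ ((1 - p) * κ) *
        (Z ^ κ * (r ^ (N * κ) * m ^ (p * κ))))))) := by
        rw [← h5]; gcongr
    _ = _ := by
        rw [Real.rpow_add ht0 ((κ - 1) * p)]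
        linear_combination (C * 2 ^ ((κ - 1) * p) * t ^ ((κ - 1) * p) *
          (4 ^ (N + p) * 2 * 2 ^ (p - 1)) ^ κ * t ^ ((N + p + (p - 1)) * κ) * δ ^ ((1 - p) * κ) *
          Z ^ κ) * (m ^ (-((κ - 1) * p)) * m ^ (p * κ) * h7 + r ^ N * h6)

/-- If the `p`-th power of the excess over `m` has zero integral, then `u ≤ m` almost everywhere. -/
theorem ae_le_of_integral_posPart_rpow_le_zero {u : 𝔼 → ℝ} {p m : ℝ} (hp : 0 < p) (hm : 0 ≤ m)
    (hu : MemLp u ⊤ volume) {x₀ : 𝔼} {ρ : ℝ}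
    (h : ∫ x in Metric.ball x₀ ρ, (max (u x - m) 0) ^ p ≤ 0) :
    ∀ᵐ x ∂volume.restrict (Metric.ball x₀ ρ), u x ≤ m := by
  have h0 : 0 ≤ fun x => (max (u x - m) 0) ^ p := fun x =>
    Real.rpow_nonneg (le_max_right _ _) _
  have h1 := (setIntegral_eq_zero_iff_of_nonneg_ae (Eventually.of_forall h0)
    (integrableOn_ball_posPart_rpow hu hm hp.le x₀ ρ)).1 (le_antisymm h (integral_nonneg h0))
  filter_upwards [h1] with x hx
  by_contra hlt
  push Not at hlt
  have : 0 < (max (u x - m) 0) ^ p :=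
    Real.rpow_pos_of_pos (lt_max_of_lt_left (by linarith)) _
  simp only [Pi.zero_apply] at hx
  linarith

theorem average_ball_eq (f : 𝔼 → ℝ) (x₀ : 𝔼) {r : ℝ} (hr : 0 < r) :
    ⨍ x in Metric.ball x₀ r, f x =
      (∫ x in Metric.ball x₀ r, f x) / (volume.real (Metric.ball (0 : 𝔼) 1) * r ^ (n : ℝ)) := by
  rw [setAverage_eq, measureReal_def, Measure.addHaar_ball_of_pos _ _ hr, finrank_euclideanSpace_fin,
    ENNReal.toReal_mul, ENNReal.toReal_ofReal (by positivity), Real.rpow_natCast, smul_eq_mul,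
    measureReal_def]
  ring

/-- The sup estimate for every level above the right-hand side. -/
theorem ae_le_of_tail_le_of_average_le (hn : 1 ≤ n) {p s Λ : ℝ} (hp : 1 < p) (hs : 0 < s)
    (hs1 : s < 1) (hΛ : 1 ≤ Λ) : ∃ c : ℝ, 0 < c ∧ ∀ (Ω : Set 𝔼) (K : 𝔼 → 𝔼 → ℝ) (u : 𝔼 → ℝ),
      IsAdmissibleKernel p s Λ K → IsWeakSubsolution p K Ω u →
      ∀ (x₀ : 𝔼) (r δ m : ℝ), 0 < r → r ≤ 1 → Metric.ball x₀ r ⊆ Ω → 0 < δ → δ ≤ 1 → 0 < m →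
        δ * Tail p s (fun y => max (u y) 0) x₀ (r / 2) ≤ m →
        c * δ ^ (-((p - 1) * kappa n p / (p * (kappa n p - 1)))) *
          (⨍ x in Metric.ball x₀ r, (max (u x) 0) ^ p) ^ (1 / p) ≤ m →
        ∀ᵐ x ∂volume.restrict (Metric.ball x₀ (r / 2)), u x ≤ m := by
  obtain ⟨C, hC, hstep⟩ := level_step (n := n) hn hp hs hs1 hΛ
  have hκ := one_lt_kappa n hp
  set κ := kappa n p with hκdef
  set β := κ - 1 with hβ
  have hβ0 : 0 < β := by rw [hβ]; linarith
  set M := C * (2 ^ (β * p) * (4 ^ ((n : ℝ) + p) * 2 * 2 ^ (p - 1)) ^ κ) with hM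
  have hM0 : 0 < M := by positivity
  set e := β * p + ((n : ℝ) + p + (p - 1)) * κ with he
  have hn0 : (0 : ℝ) ≤ n := by positivity
  have he0 : 0 < e := by
    have : 0 < β * p := by positivity
    have : 0 ≤ ((n : ℝ) + p + (p - 1)) * κ := mul_nonneg (by linarith) (by linarith)
    linarith
  set b := (2 : ℝ) ^ e with hb
  have hb1 : 1 < b := Real.one_lt_rpow (by norm_num) he0
  have hb0 : 0 < b := by linarith
  set V := volume.real (Metric.ball (0 : 𝔼) 1) with hV
  have hV0 : 0 < V :=
    ENNReal.toReal_pos (Metric.measure_ball_pos volume _ one_pos).ne' measure_ball_lt_top.ne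
  -- The reciprocal of the δ-free part of the smallness threshold, times the volume V of the unit
  -- ball, which converts the average into an integral over r^n.
  set W := V * M ^ (1 / β) * b ^ (1 / β ^ 2) with hW
  have hW0 : 0 < W := by positivity
  have hp0 : 0 < p := by linarith
  refine ⟨W ^ (1 / p), by positivity, ?_⟩
  intro Ω K u hK hu x₀ r δ m hr hr1 hΩ hδ hδ1 hm hT havg
  set T := Tail p s (fun y => max (u y) 0) x₀ (r / 2) with hTdef
  have hT0 : 0 ≤ T := tail_nonneg p s _ x₀ (by linarith)
  set A : ℕ → ℝ := fun j =>
    ∫ x in Metric.ball x₀ (r / 2 + r / (2 * 2 ^ j)), (max (u x - m * (1 - 1 / 2 ^ j)) 0) ^ p with hA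
  have hA0 : ∀ j, 0 ≤ A j := fun j =>
    integral_nonneg fun x => Real.rpow_nonneg (le_max_right _ _) _
  set Q := r ^ (n : ℝ) * m ^ p with hQ
  have hQ0 : 0 < Q := by positivity
  have hlim : Tendsto (fun j => A j / Q) atTop (𝓝 0) := by
    refine tendsto_zero_of_superlinear (D := M * δ ^ ((1 - p) * κ)) (b := b) (β := β)
      (fun j => div_nonneg (hA0 j) hQ0.le) (by positivity) hb1 hβ0 (fun j => ?_) ?_
    · have ht : (1 : ℝ) ≤ 2 ^ j := one_le_pow₀ (by norm_num)
      set t : ℝ := 2 ^ j with htdef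
      have ht0 : 0 < t := by linarith
      have hbt : b ^ (j : ℝ) = t ^ e := by
        rw [hb, htdef, ← Real.rpow_natCast, ← Real.rpow_mul (by norm_num),
          ← Real.rpow_mul (by norm_num), mul_comm]
      rw [hbt, show 1 + β = κ by rw [hβ]; ring]
      have h2t : (2 : ℝ) ^ (j + 1) = 2 * t := by rw [pow_succ, mul_comm]
      have hlvl : m * (1 - 1 / (2 * t)) - m * (1 - 1 / t) = m / (2 * t) := by
        field_simp; ring
      have hrad : (r / 2 + r / (2 * t) - (r / 2 + r / (2 * (2 * t)))) / r = 1 / (4 * t) := by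
        field_simp; ring
      have h1 := hstep Ω K u hK hu x₀ r (r / 2 + r / (2 * (2 * t))) (r / 2 + r / (2 * t))
        (m * (1 - 1 / t)) (m * (1 - 1 / (2 * t))) hr hr1
        (by have : 0 < r / (2 * (2 * t)) := by positivity
            linarith)
        (by gcongr; linarith)
        (by have : r / (2 * t) ≤ r / 2 := by gcongr; linarith
            linarith) hΩ
        (mul_nonneg hm.le (by rw [sub_nonneg, div_le_one ht0]; exact ht))
        (by have : 0 < m / (2 * t) := by positivity
            linarith)
      rw [hlvl, hrad] at h1
      have h2 : A (j + 1) = ∫ x in Metric.ball x₀ (r / 2 + r / (2 * (2 * t))),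
          (max (u x - m * (1 - 1 / (2 * t))) 0) ^ p := by
        simp only [hA, h2t]
      rw [← h2] at h1
      exact scaled_level_step hp hκ hC hr hm ht hδ hδ1 hT0 hT (hA0 j) h1
    · have h0 : A 0 = ∫ x in Metric.ball x₀ r, (max (u x) 0) ^ p := by
        simp [hA]
      have hav := average_ball_eq (fun x => (max (u x) 0) ^ p) x₀ hr
      rw [← h0, ← hV] at hav
      rw [hav] at havg
      have hav0 : 0 ≤ A 0 / (V * r ^ (n : ℝ)) := div_nonneg (hA0 0) (by positivity)
      -- The p-th power of the hypothesis on m is the smallness condition on Z₀ in disguise.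
      have h1 := Real.rpow_le_rpow (by positivity) havg hp0.le
      rw [Real.mul_rpow (by positivity) (by positivity), Real.mul_rpow (by positivity)
        (by positivity), ← Real.rpow_mul hW0.le, ← Real.rpow_mul hav0, ← Real.rpow_mul hδ.le,
        one_div_mul_cancel hp0.ne', Real.rpow_one, Real.rpow_one,
        show -((p - 1) * κ / (p * β)) * p = -((p - 1) * κ / β) by field_simp,
        Real.rpow_neg hδ.le] at h1
      have h2 : (M * δ ^ ((1 - p) * κ)) ^ (-(1 / β)) * b ^ (-(1 / β ^ 2)) =
          V / W * δ ^ ((p - 1) * κ / β) := by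
        rw [Real.mul_rpow hM0.le (by positivity), ← Real.rpow_mul hδ.le,
          show (1 - p) * κ * -(1 / β) = (p - 1) * κ / β by field_simp; ring,
          Real.rpow_neg hM0.le, Real.rpow_neg hb0.le, hW]
        field_simp
      rw [h2, hQ]
      have hδE : 0 < δ ^ ((p - 1) * κ / β) := by positivity
      set dE := δ ^ ((p - 1) * κ / β) with hdE
      have h3 : W * dE⁻¹ * (A 0 / (V * r ^ (n : ℝ))) =
        (A 0 / (r ^ (n : ℝ) * m ^ p)) * (W / (V * dE)) * m ^ p := by field_simp
      rw [h3] at h1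
      have hmp : 0 < m ^ p := by positivity
      have h4 : A 0 / (r ^ (n : ℝ) * m ^ p) * (W / (V * dE)) ≤ 1 := by
        by_contra hcon
        push Not at hcon
        nlinarith
      calc A 0 / (r ^ (n : ℝ) * m ^ p) =
            (A 0 / (r ^ (n : ℝ) * m ^ p) * (W / (V * dE))) * (V / W * dE) := by field_simp
        _ ≤ 1 * (V / W * dE) := by gcongr
        _ = _ := one_mul _
  refine ae_le_of_integral_posPart_rpow_le_zero hp0 hm.le hu.1 ?_
  -- Every stage has a larger ball and a lower level than the limiting integral.
  have hle : ∀ j, ∫ x in Metric.ball x₀ (r / 2), (max (u x - m) 0) ^ p ≤ A j / Q * Q := by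
    intro j
    rw [div_mul_cancel₀ _ hQ0.ne']
    have ht : (1 : ℝ) ≤ 2 ^ j := one_le_pow₀ (by norm_num)
    have hk : 0 ≤ m * (1 - 1 / 2 ^ j) :=
      mul_nonneg hm.le (by rw [sub_nonneg, div_le_one (by linarith)]; exact ht)
    have hkm : m * (1 - 1 / 2 ^ j) ≤ m := by
      have : 0 < m * (1 / 2 ^ j) := by positivity
      linarith
    refine (integral_mono (integrableOn_ball_posPart_rpow hu.1 hm.le hp0.le x₀ _)
      (integrableOn_ball_posPart_rpow hu.1 hk hp0.le x₀ _) fun x =>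
        Real.rpow_le_rpow (le_max_right _ _) (max_le_max (by linarith) le_rfl) hp0.le).trans ?_
    refine setIntegral_mono_set (integrableOn_ball_posPart_rpow hu.1 hk hp0.le x₀ _)
      (Eventually.of_forall fun x => Real.rpow_nonneg (le_max_right _ _) _)
      (Metric.ball_subset_ball ?_).eventuallyLE
    have : 0 < r / (2 * 2 ^ j) := by positivity
    linarith
  have := ge_of_tendsto' (hlim.mul_const Q) hle
  simpa using this

end MixedPLaplace

/-! ### Conclusion -/

theorem theorem4p2 (n : ℕ) (hn : 1 ≤ n) (p s Λ : ℝ) (hp : 1 < p) (hs0 : 0 < s) (hs1 : s < 1)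
    (hΛ : 1 ≤ Λ) :
    ∃ c : ℝ, 0 < c ∧
      ∀ (Ω : Set (EuclideanSpace ℝ (Fin n))), IsOpen Ω → IsConnected Ω →
        Bornology.IsBounded Ω →
      ∀ K : EuclideanSpace ℝ (Fin n) → EuclideanSpace ℝ (Fin n) → ℝ,
        MixedPLaplace.IsAdmissibleKernel p s Λ K →
      ∀ u : EuclideanSpace ℝ (Fin n) → ℝ, MixedPLaplace.IsWeakSubsolution p K Ω u →
        (∀ S : Set (EuclideanSpace ℝ (Fin n)), IsCompact S → S ⊆ Ω →
          essSup (fun x => (u x : EReal)) (volume.restrict S) < ⊤) ∧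
        ∀ (x₀ : EuclideanSpace ℝ (Fin n)) (r δ : ℝ), 0 < r → r ≤ 1 →
          Metric.ball x₀ r ⊆ Ω → 0 < δ → δ ≤ 1 →
          essSup (fun x => (u x : EReal)) (volume.restrict (Metric.ball x₀ (r / 2))) ≤
            ((δ * MixedPLaplace.Tail p s (fun y => max (u y) 0) x₀ (r / 2) +
              c * δ ^ (-((p - 1) * MixedPLaplace.kappa n p /
                  (p * (MixedPLaplace.kappa n p - 1)))) *
                (⨍ x in Metric.ball x₀ r, (max (u x) 0) ^ p) ^ (1 / p) : ℝ) : EReal) := by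
 
  obtain ⟨c, hc, hmain⟩ :=
    MixedPLaplace.ae_le_of_tail_le_of_average_le (n := n) hn hp hs0 hs1 hΛ
  refine ⟨c, hc, fun Ω _ _ _ K hK u hu => ⟨fun S _ _ => ?_, fun x₀ r δ hr hr1 hΩ hδ hδ1 => ?_⟩⟩
  -- The qualitative claim is immediate, as a subsolution is globally essentially bounded by
  -- definition.
  · obtain ⟨M, -, hM⟩ := MixedPLaplace.exists_ae_abs_le hu.1
    refine (essSup_le_of_ae_le (M : EReal) ?_).trans_lt (EReal.coe_lt_top M)
    filter_upwards [ae_restrict_of_ae hM] with x hx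
    exact EReal.coe_le_coe_iff.2 ((le_abs_self _).trans hx)
  · refine essSup_le_of_ae_le _ ?_
    have hT := mul_nonneg hδ.le
      (MixedPLaplace.tail_nonneg p s (fun y => max (u y) 0) x₀ (half_pos hr).le)
    have havg : 0 ≤ ⨍ x in Metric.ball x₀ r, (max (u x) 0) ^ p := by
      rw [MixedPLaplace.average_ball_eq _ x₀ hr]
      exact div_nonneg (integral_nonneg fun x => Real.rpow_nonneg (le_max_right _ _) _)
        (by positivity)
    have hb : 0 ≤ c * δ ^ (-((p - 1) * MixedPLaplace.kappa n p /
          (p * (MixedPLaplace.kappa n p - 1)))) *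
        (⨍ x in Metric.ball x₀ r, (max (u x) 0) ^ p) ^ (1 / p) := by positivity
    -- The iteration needs a positive level, whereas the right-hand side may be 0. It is raised by
    -- 1/(i + 1), and the countably many exceptional null sets are united.
    have h : ∀ᵐ x ∂volume.restrict (Metric.ball x₀ (r / 2)), ∀ i : ℕ,
        u x ≤ (δ * MixedPLaplace.Tail p s (fun y => max (u y) 0) x₀ (r / 2) +
          c * δ ^ (-((p - 1) * MixedPLaplace.kappa n p /
            (p * (MixedPLaplace.kappa n p - 1)))) *
          (⨍ x in Metric.ball x₀ r, (max (u x) 0) ^ p) ^ (1 / p)) + 1 / ((i : ℝ) + 1) := by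
      refine ae_all_iff.2 fun i => ?_
      have hi : 0 < 1 / ((i : ℝ) + 1) := by positivity
      exact hmain Ω K u hK hu x₀ r δ _ hr hr1 hΩ hδ hδ1 (by linarith) (by linarith) (by linarith)
    filter_upwards [h] with x hx
    refine EReal.coe_le_coe_iff.2 (le_of_forall_pos_le_add fun ε hε => ?_)
    obtain ⟨i, hi⟩ := exists_nat_one_div_lt hε
    exact (hx i).trans (by linarith)
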